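/- Let $d\ge 1$. Let $\mathcal C$ be the set of locally finite subsets (configurations) $\gamma$ of $\mathbb R^d$, with the $\sigma$-field generated by the counting functions $N_\Lambda(\gamma)=\#(\gamma\cap\Lambda)$, $\Lambda$ bounded Borel, and let $\mathcal C_f\subset\mathcal C$ be the set of finite configurations. Write $\gamma_\Lambda=\gamma\cap\Lambda$, $\tau_u\gamma=\gamma+u$, let $\lambda^d$ be Lebesgue measure, and let $\pi_\Lambda$ be the law of the Poisson point process of intensity $1$ in $\Lambda$. An energy function is a measurable $H:\mathcal C_f\to\mathbb R\cup\{+\infty\}$ which is non-degenerate ($H(\emptyset)<\infty$), hereditary ($H(\gamma)<\infty$ and $x\in\gamma$ imply $H(\gamma\setminus\{x\})<\infty$) and stable (for some $A\in\mathbb R$, $H(\gamma)\ge A\,\#\gamma$ for all $\gamma\in\mathcal C_f$). It is stationary if $H(\tau_u\gamma)=H(\gamma)$ for all $u\in\mathbb R^d$, $\gamma\in\mathcal C_f$. For bounded $\Delta$ and $\gamma\in\mathcal C_f$ put $H_\Delta(\gamma)=H(\gamma)-H(\gamma_{\Delta^c})$, with $\infty-\infty=0$. $H$ has finite range $R>0$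 if $H_\Delta(\gamma)=H_\Delta(\gamma_{\Delta\oplus B(0,R)})$ for every bounded $\Delta$ and every $\gamma\in\mathcal C_f$ with $H(\gamma_{\Delta^c})<\infty$, where $B(0,R)$ is the closed ball and $\oplus$ is the Minkowski sum; in this case put $H_\Delta(\gamma):=H_\Delta(\gamma_{\Delta\oplus B(0,R)})$ for every $\gamma\in\mathcal C$. Let $z>0$, $\beta\ge0$ (with $0\cdot\infty=0$). For $n\ge1$ let $\Lambda_n=[-n,n]^d$, let $P_{\Lambda_n}^{z,\beta}=\frac1{Z_{\Lambda_n}}z^{N_{\Lambda_n}}e^{-\beta H}\pi_{\Lambda_n}$ be the finite-volume Gibbs measure, with $Z_{\Lambda_n}$ the normalizing constant, and let $\bar P_n$ be the probability measure on $\mathcal C$ given by $$\int f\,d\bar P_n=\frac1{\lambda^d(\Lambda_n)}\int_{\Lambda_n}\int f(\tau_u\gamma)\,P_{\Lambda_n}^{z,\beta}(d\gamma)\,du .$$ The local convergence topology is the smallest topology on the set of probability measures on $\mathcal C$ for which $P\mapsto\int f\,dP$ is continuous for every bounded measurable $f:\mathcal C\to\mathbb R$ that is local, i.e. $f(\gamma)=f(\gamma_\Delta)$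 for all $\gamma\in\mathcal C$, for some bounded $\Delta$. **Theorem.** Let $H$ be a stationary energy function of finite range $R>0$, let $z>0$ and $\beta\ge0$. Then: 1. the sequence $(\bar P_n)_{n\ge1}$ is tight for the local convergence topology: each of its subsequences has a further subsequence that converges to a probability measure on $\mathcal C$; 2. every accumulation point $P$ of $(\bar P_n)_{n\ge1}$ in the local convergence topology is an infinite-volume Gibbs measure: $P$ is stationary ($P\circ\tau_u^{-1}=P$ for all $u\in\mathbb R^d$), and it satisfies the DLR equations, that is, for every bounded Borel set $\Delta$ with $\lambda^d(\Delta)>0$ and $P$-almost every $\gamma$, the conditional law under $P$ of the configuration in $\Delta$, given the configuration $\gamma_{\Delta^c}$ outside, is $$\frac{1}{Z_\Delta^{z,\beta}(\gamma_{\Delta^c})}\,z^{N_\Delta(\gamma'_\Delta)}\,e^{-\beta H_\Delta(\gamma'_\Delta\cup\gamma_{\Delta^c})}\,\pi_\Delta(d\gamma'_\Delta),$$ where $Z_\Delta^{z,\beta}(\gamma_{\Delta^c})$ is the normalizing constant. -/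

import Mathlib

open MeasureTheory ProbabilityTheory Filter Topology Bornology
open scoped ENNReal NNReal Pointwise

noncomputable section

namespace GibbsPP

/-- The space `ℝ^d` with its Euclidean norm and its Lebesgue measure `volume`. -/
abbrev Space (d : ℕ) := EuclideanSpace ℝ (Fin d)

/-! ### Configurations -/

/-- A configuration: a locally finite subset of `ℝ^d`. -/
@[ext]
structure Config (d : ℕ) where
  carrier : Set (Space d)
  finite_inter : ∀ Λ : Set (Space d), IsBounded Λ → (carrier ∩ Λ).Finite

namespace Config

variable {d : ℕ}

/-- The counting function `N_Λ`. -/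
def count (Λ : Set (Space d)) (γ : Config d) : ℕ := (γ.carrier ∩ Λ).ncard

/-- The sigma-field generated by the counting functions of bounded Borel sets. -/
instance : MeasurableSpace (Config d) :=
  ⨆ (Λ : Set (Space d)) (_ : IsBounded Λ) (_ : MeasurableSet Λ),
    MeasurableSpace.comap (count Λ) ⊤

/-- `γ_Λ = γ ∩ Λ`. -/
def restrict (γ : Config d) (Λ : Set (Space d)) : Config d where
  carrier := γ.carrier ∩ Λ
  finite_inter Δ hΔ :=
    (γ.finite_inter Δ hΔ).subset fun _ hx => ⟨hx.1.1, hx.2⟩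

/-- `γ ∪ γ'`. -/
def union (γ γ' : Config d) : Config d where
  carrier := γ.carrier ∪ γ'.carrier
  finite_inter Δ hΔ := by
    rw [Set.union_inter_distrib_right]
    exact (γ.finite_inter Δ hΔ).union (γ'.finite_inter Δ hΔ)

/-- The translate `τ_u(γ) = {x + u, x ∈ γ}`. -/
def translate (u : Space d) (γ : Config d) : Config d where
  carrier := (fun x => x + u) '' γ.carrier
  finite_inter Δ hΔ := by
    have hb : IsBounded ((fun x : Space d => x + -u) '' Δ) :=
      ((LipschitzWith.id.add (LipschitzWith.const (-u))).isBounded_image hΔ)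
    refine ((γ.finite_inter _ hb).image (fun x => x + u)).subset ?_
    rintro _ ⟨⟨x, hx, rfl⟩, hxΔ⟩
    exact ⟨x, ⟨hx, ⟨x + u, hxΔ, by simp⟩⟩, rfl⟩

end Config

/-- The space of finite configurations, with the trace of the sigma-field of `Config d`. -/
abbrev FinConf (d : ℕ) := {γ : Config d // γ.carrier.Finite}

namespace FinConf

variable {d : ℕ}

/-- The empty configuration. -/
def empty : FinConf d := ⟨⟨∅, fun _ _ => by simp⟩, Set.finite_empty⟩

/-- `γ_Λ = γ ∩ Λ` for a finite configuration `γ` and any set `Λ`. -/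
def restrict (γ : FinConf d) (Λ : Set (Space d)) : FinConf d :=
  ⟨γ.1.restrict Λ, γ.2.subset Set.inter_subset_left⟩

/-- The translate `τ_u(γ)`. -/
def translate (u : Space d) (γ : FinConf d) : FinConf d :=
  ⟨γ.1.translate u, γ.2.image _⟩

/-- The finite configuration `{x₁, …, xₙ}`. -/
def ofPoints {n : ℕ} (x : Fin n → Space d) : FinConf d :=
  ⟨⟨Set.range x, fun _ _ => (Set.finite_range x).subset Set.inter_subset_left⟩,
    Set.finite_range x⟩

end FinConf

/-- `γ_Λ` as a finite configuration, for bounded `Λ` and an arbitrary configuration `γ`. -/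
def Config.finRestrict {d : ℕ} (γ : Config d) (Λ : Set (Space d)) (hΛ : IsBounded Λ) :
    FinConf d :=
  ⟨γ.restrict Λ, γ.finite_inter Λ hΛ⟩

/-! ### The Poisson point process -/

/-- The distribution `π_Λ` of the Poisson point process of intensity one in a set `Λ` of finite
volume: the number of points is Poisson with parameter `|Λ|` and, given this number, the points are
independent and uniform in `Λ`, that is
`π_Λ = e^{-|Λ|} ∑ₙ (1 / n!) · law of {x₁, …, xₙ} under dx₁ … dxₙ on Λⁿ`. -/
def poisson {d : ℕ} (Λ : Set (Space d)) : Measure (FinConf d) :=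
  ENNReal.ofReal (Real.exp (-(volume Λ).toReal)) •
    Measure.sum fun n : ℕ => ((n.factorial : ℝ≥0∞))⁻¹ •
      (Measure.pi fun _ : Fin n => (volume : Measure (Space d)).restrict Λ).map FinConf.ofPoints

/-! ### Energy functions -/

/-- An energy function: a measurable function from finite configurations to `ℝ ∪ {+∞}` (the value
`-∞` is excluded by stability) which is non-degenerate, hereditary and stable. -/
structure EnergyFunction (d : ℕ) where
  toFun : FinConf d → EReal
  measurable' : Measurable toFun
  nondegenerate : toFun FinConf.empty < ⊤
  hereditary : ∀ (γ : FinConf d), ∀ x ∈ γ.1.carrier,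
    toFun γ < ⊤ → toFun (γ.restrict {x}ᶜ) < ⊤
  stable : ∃ A : ℝ, ∀ γ : FinConf d, ((A * (γ.1.carrier.ncard : ℝ) : ℝ) : EReal) ≤ toFun γ

instance {d : ℕ} : CoeFun (EnergyFunction d) fun _ => FinConf d → EReal := ⟨EnergyFunction.toFun⟩

open Classical in
/-- The difference `a - b` in `ℝ ∪ {+∞}` with the convention `∞ - ∞ = 0`. -/
def energyDiff (a b : EReal) : EReal := if a = ⊤ ∧ b = ⊤ then 0 else a - b

namespace EnergyFunction

variable {d : ℕ} (H : EnergyFunction d)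

/-- `H(τ_u(γ)) = H(γ)` for all `u` and all finite `γ`. -/
def IsStationary : Prop := ∀ (u : Space d) (γ : FinConf d), H (γ.translate u) = H γ

/-- The local energy `H_Δ(γ) = H(γ) - H(γ_{Δᶜ})` of a finite configuration. -/
def localEnergy (Δ : Set (Space d)) (γ : FinConf d) : EReal :=
  energyDiff (H γ) (H (γ.restrict Δᶜ))

/-- `H` has finite range `R`: for every bounded `Δ` the local energy `H_Δ(γ)` depends only on the
points of `γ` in `Δ ⊕ B(0,R)`. The identity is required where `H(γ) - H(γ_{Δᶜ})` is
a genuine difference, that is for allowed exterior configurations, `H(γ_{Δᶜ}) < ∞`. (Where the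
convention `∞ - ∞ = 0` is in force it would fail for every `H` that takes the value `∞`.) -/
def HasFiniteRange (R : ℝ) : Prop :=
  0 < R ∧ ∀ Δ : Set (Space d), IsBounded Δ → ∀ γ : FinConf d, H (γ.restrict Δᶜ) < ⊤ →
    H.localEnergy Δ γ = H.localEnergy Δ (γ.restrict (Δ + Metric.closedBall 0 R))

/-- The local energy of an arbitrary configuration, `H_Δ(γ) := H_Δ(γ_{Δ ⊕ B(0,R)})`, for `H` of
finite range `R` and bounded `Δ`. -/
def localEnergyExt (R : ℝ) (Δ : Set (Space d)) (hΔ : IsBounded Δ) (γ : Config d) : EReal :=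
  H.localEnergy Δ (γ.finRestrict (Δ + Metric.closedBall 0 R) (hΔ.add Metric.isBounded_closedBall))

end EnergyFunction

/-! ### Finite volume Gibbs measures -/

/-- The Boltzmann factor `e^{-β E}` for `E ∈ ℝ ∪ {+∞}`; it is `0` for `E = ∞`, `β > 0`, and `1` for
`β = 0`. -/
def boltzmann (β : ℝ≥0) (E : EReal) : ℝ≥0∞ := EReal.exp (-(((β : ℝ) : EReal) * E))

section FiniteVolume

variable {d : ℕ} (H : EnergyFunction d) (z β : ℝ≥0)

/-- The unnormalized density `z^{N_Λ} e^{-β H}`. -/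
def gibbsWeight (Λ : Set (Space d)) (γ : FinConf d) : ℝ≥0∞ :=
  (z : ℝ≥0∞) ^ γ.1.count Λ * boltzmann β (H γ)

/-- The partition function `Z_Λ`. -/
def partitionFunction (Λ : Set (Space d)) : ℝ≥0∞ :=
  ∫⁻ γ, gibbsWeight H z β Λ γ ∂poisson Λ

/-- The finite volume Gibbs measure `P_Λ = Z_Λ⁻¹ z^{N_Λ} e^{-β H} π_Λ`. -/
def gibbsMeasure (Λ : Set (Space d)) : Measure (FinConf d) :=
  (partitionFunction H z β Λ)⁻¹ • (poisson Λ).withDensity (gibbsWeight H z β Λ)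

/-- The window `Λₙ = [-n,n]^d`. -/
def box (d n : ℕ) : Set (Space d) := {x | ∀ i, x i ∈ Set.Icc (-(n : ℝ)) n}

/-- The empirical field: the image of the normalized Lebesgue measure on `Λₙ` times `P_{Λₙ}` under
`(u, γ) ↦ τ_u(γ)`, so that its integral of `f` is `|Λₙ|⁻¹ ∫_{Λₙ} ∫ f(τ_u(γ)) P_{Λₙ}(dγ) du`. -/
def empiricalMeasure (n : ℕ) : Measure (Config d) :=
  (volume (box d n))⁻¹ •
    (((volume : Measure (Space d)).restrict (box d n)).prod (gibbsMeasure H z β (box d n))).map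
      fun p => p.2.1.translate p.1

end FiniteVolume

/-! ### The empirical field is a probability measure -/

section Facts

variable {d : ℕ}

theorem measurable_count {Λ : Set (Space d)} (hb : IsBounded Λ) (hm : MeasurableSet Λ) :
    Measurable (Config.count Λ) := by
  rw [measurable_iff_comap_le]
  exact le_iSup_of_le Λ (le_iSup_of_le hb (le_iSup_of_le hm le_rfl))

theorem measurable_config {α : Type*} [MeasurableSpace α] {g : α → Config d}
    (h : ∀ Λ : Set (Space d), IsBounded Λ → MeasurableSet Λ →
      Measurable fun a => (g a).count Λ) : Measurable g := by
  rw [measurable_iff_comap_le]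
  simp only [Config.instMeasurableSpace, MeasurableSpace.comap_iSup, iSup_le_iff,
    MeasurableSpace.comap_comp]
  intro Λ hb hm
  exact measurable_iff_comap_le.1 (h Λ hb hm)

theorem measurable_ofPoints (n : ℕ) :
    Measurable (FinConf.ofPoints : (Fin n → Space d) → FinConf d) := by
  classical
  refine Measurable.subtype_mk (measurable_config fun Λ _ hm => ?_)
  have key : ∀ x : Fin n → Space d,
      (Config.mk (Set.range x) fun _ _ => (Set.finite_range x).subset
        Set.inter_subset_left).count Λ =
        ∑ i, if x i ∈ Λ ∧ ∀ j, j < i → x j ≠ x i then 1 else 0 := by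
    intro x
    rw [← Finset.card_filter]
    have himg : Set.range x ∩ Λ =
        ((Finset.univ.filter fun i => x i ∈ Λ ∧ ∀ j, j < i → x j ≠ x i).image x :
          Set (Space d)) := by
      ext y
      simp only [Set.mem_inter_iff, Set.mem_range, Finset.coe_image, Finset.coe_filter,
        Finset.mem_univ, true_and, Set.mem_image, Set.mem_ofPred_eq]
      constructor
      · rintro ⟨⟨i, rfl⟩, hy⟩
        have hne : (Finset.univ.filter fun j => x j = x i).Nonempty := ⟨i, by simp⟩
        obtain ⟨hmem, hmin⟩ : Finset.min' _ hne ∈ _ ∧ ∀ j ∈ _, Finset.min' _ hne ≤ j :=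
          ⟨Finset.min'_mem _ hne, fun j hj => Finset.min'_le _ j hj⟩
        have hk := (Finset.mem_filter.1 hmem).2
        refine ⟨Finset.min' _ hne, ⟨by rw [hk]; exact hy, fun j hj hje => ?_⟩, hk⟩
        exact absurd (hmin j (by simp [hje, hk])) (not_le.2 hj)
      · rintro ⟨i, ⟨hi, -⟩, rfl⟩
        exact ⟨⟨i, rfl⟩, hi⟩
    change (Set.range x ∩ Λ).ncard = _
    rw [himg, Set.ncard_coe_finset, Finset.card_image_of_injOn]
    intro i hi j hj hij
    simp only [Finset.coe_filter, Finset.mem_univ, true_and, Set.mem_ofPred_eq] at hi hj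
    rcases lt_trichotomy i j with h | h | h
    · exact absurd hij (hj.2 i h)
    · exact h
    · exact absurd hij.symm (hi.2 j h)
  simp_rw [key]
  refine Finset.measurable_sum _ fun i _ => Measurable.ite ?_ measurable_const measurable_const
  refine MeasurableSet.inter (measurable_pi_apply i hm) ?_
  have : {x : Fin n → Space d | ∀ j, j < i → x j ≠ x i} =
      ⋂ j, ⋂ (_ : j < i), {x | x j = x i}ᶜ := by
    ext x; simp
  change MeasurableSet {x : Fin n → Space d | ∀ j, j < i → x j ≠ x i}
  rw [this]
  exact MeasurableSet.iInter fun j => MeasurableSet.iInter fun _ =>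
    (measurableSet_eq_fun (measurable_pi_apply j) (measurable_pi_apply i)).compl

/-- Counting measure of a bounded piece of a configuration. -/
theorem count_eq_measure (γ : Config d) {Λ : Set (Space d)} (hb : IsBounded Λ) :
    (γ.count Λ : ℝ≥0∞) = Measure.count (γ.carrier ∩ Λ) := by
  rw [Measure.count_apply_finite _ (γ.finite_inter Λ hb), Config.count,
    Set.ncard_eq_toFinset_card _ (γ.finite_inter Λ hb)]

theorem measurable_section_count {Λ : Set (Space d)} (hb : IsBounded Λ) (hm : MeasurableSet Λ)
    {C : Set (Space d × Space d)} (hC : MeasurableSet C) :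
    Measurable fun p : Space d × Config d =>
      Measure.count (p.2.carrier ∩ (Λ ∩ {x | (p.1, x) ∈ C})) := by
  have hfin : ∀ (γ : Config d) (s : Set (Space d)), (γ.carrier ∩ (Λ ∩ s)).Finite := fun γ s =>
    (γ.finite_inter Λ hb).subset fun x hx => ⟨hx.1, hx.2.1⟩
  refine MeasurableSpace.induction_on_inter
    (C := fun C _ => Measurable fun p : Space d × Config d =>
      Measure.count (p.2.carrier ∩ (Λ ∩ {x | (p.1, x) ∈ C})))
    generateFrom_prod.symm isPiSystem_prod ?_ ?_ ?_ ?_ C hC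
  · simp
  · rintro _ ⟨U, hU, V, hV, rfl⟩
    have : (fun p : Space d × Config d =>
        Measure.count (p.2.carrier ∩ (Λ ∩ {x | (p.1, x) ∈ U ×ˢ V}))) =
        fun p => U.indicator 1 p.1 * (p.2.count (Λ ∩ V) : ℝ≥0∞) := by
      funext p
      rw [count_eq_measure p.2 (hb.subset Set.inter_subset_left)]
      by_cases h : p.1 ∈ U
      · simp [h]
      · simp [h]
    rw [this]
    have h1 : Measurable (U.indicator (1 : Space d → ℝ≥0∞)) := measurable_one.indicator hU
    have h2 : Measurable fun γ : Config d => (γ.count (Λ ∩ V) : ℝ≥0∞) :=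
      (measurable_from_top (f := fun n : ℕ => (n : ℝ≥0∞))).comp
        (measurable_count (hb.subset Set.inter_subset_left) (hm.inter hV))
    exact (h1.comp measurable_fst).mul (h2.comp measurable_snd)
  · intro t ht ih
    have : (fun p : Space d × Config d =>
        Measure.count (p.2.carrier ∩ (Λ ∩ {x | (p.1, x) ∈ tᶜ}))) =
        fun p => (p.2.count Λ : ℝ≥0∞) -
          Measure.count (p.2.carrier ∩ (Λ ∩ {x | (p.1, x) ∈ t})) := by
      funext p
      have hf := hfin p.2 {x | (p.1, x) ∈ t}
      rw [count_eq_measure p.2 hb, ← measure_sdiff ?_ hf.measurableSet.nullMeasurableSet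
        (Measure.count_apply_lt_top.2 hf).ne]
      · congr 1
        ext x
        simp only [Set.mem_inter_iff, Set.mem_ofPred_eq, Set.mem_compl_iff, Set.mem_sdiff]
        tauto
      · exact fun x hx => ⟨hx.1, hx.2.1⟩
    rw [this]
    have h2 : Measurable fun γ : Config d => (γ.count Λ : ℝ≥0∞) :=
      (measurable_from_top (f := fun n : ℕ => (n : ℝ≥0∞))).comp (measurable_count hb hm)
    exact (h2.comp measurable_snd).sub ih
  · intro f hdisj hf ih
    have : (fun p : Space d × Config d =>
        Measure.count (p.2.carrier ∩ (Λ ∩ {x | (p.1, x) ∈ ⋃ i, f i}))) =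
        fun p => ∑' i, Measure.count (p.2.carrier ∩ (Λ ∩ {x | (p.1, x) ∈ f i})) := by
      funext p
      rw [← measure_iUnion]
      · congr 1
        ext x
        simp
      · intro i j hij
        refine Set.disjoint_left.2 fun x hx hx' => ?_
        exact Set.disjoint_left.1 (hdisj hij) hx.2.2 hx'.2.2
      · exact fun i => (hfin _ _).measurableSet
    rw [this]
    exact Measurable.tsum ih

theorem measurable_translate :
    Measurable fun p : Space d × Config d => p.2.translate p.1 := by
  refine measurable_config fun Λ hb hm => ?_
  have hmeas : ∀ k : ℕ, Measurable fun p : Space d × Config d =>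
      Measure.count (p.2.carrier ∩ (Metric.closedBall 0 (k : ℝ) ∩ {x | x + p.1 ∈ Λ})) := fun k =>
    measurable_section_count Metric.isBounded_closedBall measurableSet_closedBall
      (C := {q | q.2 + q.1 ∈ Λ}) ((measurable_snd.add measurable_fst) hm)
  have hlim : Measurable fun p : Space d × Config d => ((p.2.translate p.1).count Λ : ℝ≥0∞) := by
    refine measurable_of_tendsto_metrizable hmeas (tendsto_pi_nhds.2 fun p => ?_)
    refine tendsto_const_nhds.congr' ?_
    obtain ⟨r, hr⟩ := hb.subset_closedBall (0 : Space d)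
    obtain ⟨k₀, hk₀⟩ := exists_nat_ge (r + ‖p.1‖)
    filter_upwards [eventually_ge_atTop k₀] with k hk
    have hset : p.2.carrier ∩ (Metric.closedBall 0 (k : ℝ) ∩ {x | x + p.1 ∈ Λ}) =
        p.2.carrier ∩ {x | x + p.1 ∈ Λ} := by
      ext x
      simp only [Set.mem_inter_iff, Set.mem_ofPred_eq, and_congr_right_iff, and_iff_right_iff_imp]
      intro _ hx
      have h1 := hr hx
      rw [mem_closedBall_zero_iff] at h1 ⊢
      have h2 : ‖x‖ ≤ ‖x + p.1‖ + ‖p.1‖ := by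
        simpa using norm_sub_le (x + p.1) p.1
      have h3 : (k₀ : ℝ) ≤ k := by exact_mod_cast hk
      linarith
    rw [hset, count_eq_measure _ hb]
    have himg : (p.2.translate p.1).carrier ∩ Λ =
        (fun x => x + p.1) '' (p.2.carrier ∩ {x | x + p.1 ∈ Λ}) := by
      ext y
      constructor
      · rintro ⟨⟨x, hx, rfl⟩, hy⟩
        exact ⟨x, ⟨hx, hy⟩, rfl⟩
      · rintro ⟨x, ⟨hx, hy⟩, rfl⟩
        exact ⟨⟨x, hx, rfl⟩, hy⟩
    rw [himg, Measure.count_injective_image (add_left_injective p.1)]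
  have h' := ENNReal.measurable_toReal.comp hlim
  have h'' : Measurable fun p : Space d × Config d =>
      ⌊((p.2.translate p.1).count Λ : ℝ≥0∞).toReal⌋₊ := Nat.measurable_floor.comp h'
  simpa using h''

theorem measurable_boltzmann (β : ℝ≥0) : Measurable (boltzmann β) := by
  refine Antitone.measurable fun a b hab => ?_
  refine EReal.exp_monotone (EReal.neg_le_neg_iff.2 ?_)
  exact mul_le_mul_of_nonneg_left hab (by exact_mod_cast β.2)

theorem measurable_gibbsWeight (H : EnergyFunction d) (z β : ℝ≥0) {Λ : Set (Space d)}
    (hb : IsBounded Λ) (hm : MeasurableSet Λ) : Measurable (gibbsWeight H z β Λ) := by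
  have h1 : Measurable fun γ : FinConf d => (z : ℝ≥0∞) ^ γ.1.count Λ :=
    (measurable_from_top (f := fun n : ℕ => (z : ℝ≥0∞) ^ n)).comp
      ((measurable_count hb hm).comp measurable_subtype_coe)
  exact h1.mul ((measurable_boltzmann β).comp H.measurable')

theorem lintegral_poisson (Λ : Set (Space d)) {f : FinConf d → ℝ≥0∞} (hf : Measurable f) :
    ∫⁻ γ, f γ ∂poisson Λ = ENNReal.ofReal (Real.exp (-(volume Λ).toReal)) *
      ∑' n : ℕ, ((n.factorial : ℝ≥0∞))⁻¹ *
        ∫⁻ x, f (FinConf.ofPoints x)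
          ∂(Measure.pi fun _ : Fin n => (volume : Measure (Space d)).restrict Λ) := by
  rw [poisson, lintegral_smul_measure, lintegral_sum_measure, smul_eq_mul]
  congr 1
  refine tsum_congr fun n => ?_
  rw [lintegral_smul_measure, lintegral_map hf (measurable_ofPoints n), smul_eq_mul]

theorem tsum_pow_div_factorial_ne_top (a : ℝ≥0) :
    ∑' n : ℕ, ((n.factorial : ℝ≥0∞))⁻¹ * (a : ℝ≥0∞) ^ n ≠ ⊤ := by
  have h := (Real.summable_pow_div_factorial (a : ℝ)).tsum_ofReal_ne_top
  convert h using 3 with n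
  rw [ENNReal.ofReal_div_of_pos (by positivity), ENNReal.ofReal_pow a.coe_nonneg, ENNReal.ofReal_natCast,
    ENNReal.ofReal_coe_nnreal, div_eq_mul_inv, mul_comm]

theorem partitionFunction_pos (H : EnergyFunction d) (z β : ℝ≥0) {Λ : Set (Space d)}
    (hb : IsBounded Λ) (hm : MeasurableSet Λ) : partitionFunction H z β Λ ≠ 0 := by
  rw [partitionFunction, lintegral_poisson Λ (measurable_gibbsWeight H z β hb hm)]
  refine mul_ne_zero (by simp [Real.exp_pos]) fun h0 => ?_
  rw [ENNReal.tsum_eq_zero] at h0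
  have h := h0 0
  have hemp : ∀ x : Fin 0 → Space d, FinConf.ofPoints x = FinConf.empty := fun x => by
    apply Subtype.ext
    ext y
    simp [FinConf.ofPoints, FinConf.empty]
  simp only [hemp, lintegral_const, Nat.factorial_zero, Nat.cast_one, inv_one, one_mul] at h
  have hw : gibbsWeight H z β Λ FinConf.empty ≠ 0 := by
    have hc : (FinConf.empty : FinConf d).1.count Λ = 0 := by
      simp [FinConf.empty, Config.count]
    rw [gibbsWeight, hc, pow_zero, one_mul, boltzmann]
    intro h0
    rw [EReal.exp_eq_zero_iff, EReal.neg_eq_bot_iff] at h0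
    obtain ⟨A, hA⟩ := H.stable
    have hne : H.toFun FinConf.empty ≠ ⊥ :=
      ((EReal.bot_lt_coe _).trans_le (hA FinConf.empty)).ne'
    rw [← EReal.coe_toReal H.nondegenerate.ne hne, ← EReal.coe_mul] at h0
    exact EReal.coe_ne_top _ h0
  rcases mul_eq_zero.1 h with h | h
  · exact hw h
  · simp at h

theorem partitionFunction_ne_top (H : EnergyFunction d) (z β : ℝ≥0) {Λ : Set (Space d)}
    (hb : IsBounded Λ) (hm : MeasurableSet Λ) : partitionFunction H z β Λ ≠ ⊤ := by
  obtain ⟨A, hA⟩ := H.stable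
  set b : ℝ≥0 := ⟨Real.exp (β * |A|), (Real.exp_pos _).le⟩ with hbdef
  have hb1 : 1 ≤ b := by
    rw [← NNReal.coe_le_coe]
    exact Real.one_le_exp (by positivity)
  set c : ℝ≥0 := max 1 z * b with hc
  have hbound : ∀ (n : ℕ) (x : Fin n → Space d),
      gibbsWeight H z β Λ (FinConf.ofPoints x) ≤ (c : ℝ≥0∞) ^ n := by
    intro n x
    set N := (FinConf.ofPoints x).1.carrier.ncard with hN
    have hNn : N ≤ n := by
      calc N = (x '' Set.univ).ncard := by rw [Set.image_univ]; rfl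
        _ ≤ (Set.univ : Set (Fin n)).ncard := Set.ncard_image_le
        _ = n := by simp [Set.ncard_univ]
    have hcN : (FinConf.ofPoints x).1.count Λ ≤ n :=
      (Set.ncard_le_ncard Set.inter_subset_left (FinConf.ofPoints x).2).trans hNn
    have h1 : (z : ℝ≥0∞) ^ (FinConf.ofPoints x).1.count Λ ≤ ((max 1 z : ℝ≥0) : ℝ≥0∞) ^ n := by
      have hz1 : (1 : ℝ≥0) ≤ max 1 z := le_max_left 1 z
      exact_mod_cast (pow_le_pow_left' (le_max_right 1 z) _).trans (pow_le_pow_right' hz1 hcN)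
    have h2 : boltzmann β (H (FinConf.ofPoints x)) ≤ (b : ℝ≥0∞) ^ n := by
      have hle : ((-|A| * n : ℝ) : EReal) ≤ H (FinConf.ofPoints x) := by
        refine le_trans ?_ (hA _)
        rw [EReal.coe_le_coe_iff]
        have h3 : (N : ℝ) ≤ n := by exact_mod_cast hNn
        have h4 : -|A| ≤ A := neg_abs_le A
        have h5 : (0 : ℝ) ≤ N := by positivity
        have h6 : 0 ≤ |A| := abs_nonneg A
        nlinarith
      have hmono : boltzmann β (H (FinConf.ofPoints x)) ≤ boltzmann β ((-|A| * n : ℝ) : EReal) :=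
        EReal.exp_monotone (EReal.neg_le_neg_iff.2
          (mul_le_mul_of_nonneg_left hle (by exact_mod_cast β.2)))
      refine hmono.trans (le_of_eq ?_)
      rw [boltzmann, ← EReal.coe_mul, ← EReal.coe_neg, EReal.exp_coe]
      have hr : -((β : ℝ) * (-|A| * n)) = n * (β * |A|) := by ring
      rw [hr, Real.exp_nat_mul, ENNReal.ofReal_pow (Real.exp_pos _).le]
      congr 1
      exact ENNReal.ofReal_eq_coe_nnreal _
    calc gibbsWeight H z β Λ (FinConf.ofPoints x)
        ≤ ((max 1 z : ℝ≥0) : ℝ≥0∞) ^ n * (b : ℝ≥0∞) ^ n := mul_le_mul' h1 h2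
      _ = (c : ℝ≥0∞) ^ n := by rw [hc, ENNReal.coe_mul, mul_pow]
  have hv : volume Λ ≠ ⊤ := hb.measure_lt_top.ne
  rw [partitionFunction, lintegral_poisson Λ (measurable_gibbsWeight H z β hb hm)]
  refine ENNReal.mul_ne_top ENNReal.ofReal_ne_top ?_
  refine ne_top_of_le_ne_top (tsum_pow_div_factorial_ne_top (c * (volume Λ).toNNReal)) ?_
  refine ENNReal.tsum_le_tsum fun n => mul_le_mul' le_rfl ?_
  refine (lintegral_mono fun x => hbound n x).trans (le_of_eq ?_)
  rw [lintegral_const, Measure.pi_univ]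
  simp only [Measure.restrict_apply MeasurableSet.univ, Set.univ_inter, Finset.prod_const,
    Finset.card_univ, Fintype.card_fin]
  rw [ENNReal.coe_mul c, mul_pow (c : ℝ≥0∞), ENNReal.coe_toNNReal hv]

theorem isProbabilityMeasure_gibbsMeasure (H : EnergyFunction d) (z β : ℝ≥0) {Λ : Set (Space d)}
    (hb : IsBounded Λ) (hm : MeasurableSet Λ) :
    IsProbabilityMeasure (gibbsMeasure H z β Λ) := by
  constructor
  rw [gibbsMeasure, Measure.smul_apply, withDensity_apply _ MeasurableSet.univ,
    Measure.restrict_univ, smul_eq_mul]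
  exact ENNReal.inv_mul_cancel (partitionFunction_pos H z β hb hm)
    (partitionFunction_ne_top H z β hb hm)

theorem isBounded_box (d n : ℕ) : IsBounded (box d n) := by
  refine (Metric.isBounded_closedBall (x := (0 : Space d)) (r := √(d * (n : ℝ) ^ 2))).subset ?_
  intro x hx
  rw [mem_closedBall_zero_iff, EuclideanSpace.norm_eq]
  refine Real.sqrt_le_sqrt ?_
  calc ∑ i, ‖x i‖ ^ 2 ≤ ∑ _i : Fin d, (n : ℝ) ^ 2 := by
        refine Finset.sum_le_sum fun i _ => ?_
        have h := hx i
        rw [Real.norm_eq_abs]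
        exact pow_le_pow_left₀ (abs_nonneg _) (abs_le.2 ⟨h.1, h.2⟩) 2
    _ = d * (n : ℝ) ^ 2 := by simp

theorem measurableSet_box (d n : ℕ) : MeasurableSet (box d n) := by
  have : box d n = ⋂ i, (fun x : Space d => x i) ⁻¹' Set.Icc (-(n : ℝ)) n := by
    ext x; simp [box]
  rw [this]
  exact MeasurableSet.iInter fun i => (by fun_prop : Measurable fun x : Space d => x i)
    measurableSet_Icc

theorem volume_box_ne_zero (d : ℕ) {n : ℕ} (hn : 1 ≤ n) : volume (box d n) ≠ 0 := by
  have hsub : Metric.ball (0 : Space d) 1 ⊆ box d n := by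
    intro x hx i
    rw [mem_ball_zero_iff] at hx
    have h1 : ‖x i‖ ≤ ‖x‖ := PiLp.norm_apply_le x i
    have h2 : (1 : ℝ) ≤ n := by exact_mod_cast hn
    rw [Real.norm_eq_abs] at h1
    have h3 := abs_le.1 (h1.trans (hx.le.trans h2))
    exact ⟨h3.1, h3.2⟩
  exact ((Metric.measure_ball_pos volume (0 : Space d) one_pos).trans_le (measure_mono hsub)).ne'

theorem isProbabilityMeasure_empiricalMeasure (H : EnergyFunction d) (z β : ℝ≥0) {n : ℕ}
    (hn : 1 ≤ n) : IsProbabilityMeasure (empiricalMeasure H z β n) := by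
  have := isProbabilityMeasure_gibbsMeasure H z β (isBounded_box d n) (measurableSet_box d n)
  have hmeas : Measurable fun p : Space d × FinConf d => p.2.1.translate p.1 :=
    measurable_translate.comp
      (measurable_fst.prodMk (measurable_subtype_coe.comp measurable_snd))
  constructor
  rw [empiricalMeasure, Measure.smul_apply, Measure.map_apply hmeas MeasurableSet.univ,
    Set.preimage_univ, ← Set.univ_prod_univ, Measure.prod_prod,
    measure_univ (μ := gibbsMeasure H z β (box d n)), mul_one,
    Measure.restrict_apply MeasurableSet.univ, Set.univ_inter, smul_eq_mul]
  exact ENNReal.inv_mul_cancel (volume_box_ne_zero d hn) (isBounded_box d n).measure_lt_top.ne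

end Facts

/-- The sequence of empirical fields on `Λ₁, Λ₂, …`, as probability measures on configurations; the
entry of index `n` is the empirical field on `Λ_{n+1}`. -/
def empiricalField {d : ℕ} (H : EnergyFunction d) (z β : ℝ≥0) (n : ℕ) :
    ProbabilityMeasure (Config d) :=
  ⟨empiricalMeasure H z β (n + 1), isProbabilityMeasure_empiricalMeasure H z β (by omega)⟩

/-! ### The local convergence topology -/

/-- Bounded measurable local functions: `f(γ) = f(γ_Δ)` for some bounded `Δ`. -/
def IsBoundedLocal {d : ℕ} (f : Config d → ℝ) : Prop :=
  Measurable f ∧ (∃ C : ℝ, ∀ γ, |f γ| ≤ C) ∧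
    ∃ Δ : Set (Space d), IsBounded Δ ∧ ∀ γ, f γ = f (γ.restrict Δ)

/-- The local convergence topology: the smallest topology on the space of probability measures on
configurations such that `P ↦ ∫ f dP` is continuous for every bounded local function `f`. -/
abbrev localTopology (d : ℕ) : TopologicalSpace (ProbabilityMeasure (Config d)) :=
  ⨅ (f : Config d → ℝ) (_ : IsBoundedLocal f),
    TopologicalSpace.induced
      (fun P : ProbabilityMeasure (Config d) => ∫ γ, f γ ∂(P : Measure (Config d))) inferInstance

/-! ### Infinite volume Gibbs measures -/

section Specification

variable {d : ℕ} (H : EnergyFunction d) (R : ℝ) (z β : ℝ≥0) (Δ : Set (Space d)) (hΔ : IsBounded Δ)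

/-- The density `z^{N_Δ(γ')} e^{-β H_Δ(γ'_Δ ∪ γ_{Δᶜ})}` in the variable `γ'`. -/
def dlrWeight (γ : Config d) (γ' : FinConf d) : ℝ≥0∞ :=
  (z : ℝ≥0∞) ^ γ'.1.count Δ *
    boltzmann β (H.localEnergyExt R Δ hΔ ((γ'.1.restrict Δ).union (γ.restrict Δᶜ)))

/-- The measure `Z_Δ(γ_{Δᶜ})⁻¹ z^{N_Δ} e^{-β H_Δ(· ∪ γ_{Δᶜ})} π_Δ` on configurations in `Δ`, with
`Z_Δ(γ_{Δᶜ})` the normalizing constant. It depends on `γ` through `γ_{Δᶜ}` only. -/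
def dlrMeasure (γ : Config d) : Measure (FinConf d) :=
  (∫⁻ γ', dlrWeight H R z β Δ hΔ γ γ' ∂poisson Δ)⁻¹ •
    (poisson Δ).withDensity (dlrWeight H R z β Δ hΔ γ)

end Specification

/-- The sigma-field generated by `γ ↦ γ_{Δᶜ}`. -/
abbrev exteriorSigma {d : ℕ} (Δ : Set (Space d)) : MeasurableSpace (Config d) :=
  MeasurableSpace.comap (fun γ : Config d => γ.restrict Δᶜ) inferInstance

/-- Stationary probability measures on configurations. -/
def IsStationaryLaw {d : ℕ} (P : ProbabilityMeasure (Config d)) : Prop :=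
  ∀ u : Space d, (P : Measure (Config d)).map (Config.translate u) = P

/-- `P` satisfies the DLR equations: for every bounded Borel set `Δ` of positive volume, a version
of the conditional law under `P` of `γ_Δ` given `γ_{Δᶜ}` is `dlrMeasure … γ`. -/
def SatisfiesDLR {d : ℕ} (H : EnergyFunction d) (R : ℝ) (z β : ℝ≥0)
    (P : ProbabilityMeasure (Config d)) : Prop :=
  ∀ (Δ : Set (Space d)) (hΔ : IsBounded Δ), MeasurableSet Δ → 0 < volume Δ →
    ∀ A : Set (FinConf d), MeasurableSet A →
      (P : Measure (Config d))⟦{γ | γ.finRestrict Δ hΔ ∈ A} | exteriorSigma Δ⟧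
        =ᵐ[(P : Measure (Config d))] fun γ => (dlrMeasure H R z β Δ hΔ γ).real A

/-- Infinite volume Gibbs measures with activity `z`, inverse temperature `β` and energy function
`H` of finite range `R`. -/
def IsInfiniteVolumeGibbs {d : ℕ} (H : EnergyFunction d) (R : ℝ) (z β : ℝ≥0)
    (P : ProbabilityMeasure (Config d)) : Prop :=
  IsStationaryLaw P ∧ SatisfiesDLR H R z β P

end GibbsPP

end

/-!
The empirical fields are sequentially compact because their traces in a fixed window are uniformly
absolutely continuous with respect to a Lebesgue-Poisson measure (`lpm`, the unnormalized Poisson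
process). Stability bounds the density of a finite volume Gibbs measure by `C c^N`, where the
partition function is at least the weight of the empty configuration, so `P_Λ ≤ C · lpm (c |Λ)`
uniformly in `Λ` (`exists_gibbsMeasure_le`). The constant `C` does not grow with the volume, and the
total mass of `lpm (c |Λ)` grows like `e^{c |Λ|}`. Now divide `Λₙ` into cells of fixed size. Under the
Lebesgue-Poisson measure the cells are independent, and an exponential Chebyshev inequality shows
that if an event `A` in a cell has Lebesgue-Poisson measure at most `e^{-p}`, then the expected
fraction of cells whose trace lies in `A` is of order `1/p` (`sum_measure_cells_le`). The empirical
field averages over translations, so its probability of `A` is such an expected fraction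
(`exists_empiricalMeasure_uniformlyAC`). This replaces the usual compactness argument through the
specific entropy.

Uniform absolute continuity turns convergence on a countable dense family of events into convergence
on all events of the window, with a countably additive limit (`UniformlyAC.exists_setwise_limit`).
The limits in the windows are consistent. They have densities with respect to Lebesgue-Poisson
measures, so that conditional laws exist without any topology on the configuration space, and
a Markov chain that adds the points of one shell after the other realizes them jointly
(`exists_projective_limit`).

For an accumulation point `P` it suffices to compare the integrals of two local functions under the
empirical fields, up to the boundary fraction of the windows (`lintegral_le_of_mapClusterPt`,
`lintegral_empiricalMeasure_le`). Stationarity follows at once. For the DLR equations, the finite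
range property splits the Boltzmann factor of `η_Δ ∪ ξ_{Δᶜ}` into a factor of `ξ_{Δᶜ}` and a local
one (`boltzmann_glue`). Hence the Gibbs measure in any window that contains `Δ` satisfies the DLR
equations in `Δ` exactly, with a local kernel (`lintegral_gibbsMeasure_localProb`), and translates
of Gibbs measures are Gibbs measures in translated windows. Passing to the limit gives the integrated
equations for local exterior events (`lintegral_localProb_eq`), which determine the conditional law.
Forbidden exterior configurations, on which the finite range property says nothing, are not charged
by `P` when `β > 0` (`measure_energy_inBox_eq_top`) and are harmless when `β = 0`.
-/

noncomputable section

namespace GibbsPP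

/-! ### Setwise limits and Markov chains -/

section Abstract

/-- A law on a product that is absolutely continuous with respect to a product measure
disintegrates over its first marginal. The kernel is the normalized density, so that no
topological assumption on the spaces is needed. -/
theorem exists_isMarkovKernel_fst_compProd_eq {α β : Type*} [MeasurableSpace α]
    [MeasurableSpace β] [Nonempty β] {μ : Measure α} {ν : Measure β} [IsFiniteMeasure μ]
    [IsFiniteMeasure ν] {ρ : Measure (α × β)} [IsProbabilityMeasure ρ] (h : ρ ≪ μ.prod ν) :
    ∃ κ : Kernel α β, IsMarkovKernel κ ∧ ρ.fst ⊗ₘ κ = ρ := by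
  classical
  set g := ρ.rnDeriv (μ.prod ν) with hg
  have hgm : Measurable g := Measure.measurable_rnDeriv _ _
  have hρ : (μ.prod ν).withDensity g = ρ := Measure.withDensity_rnDeriv_eq _ _ h
  set Z : α → ℝ≥0∞ := fun x => ∫⁻ y, g (x, y) ∂ν with hZ
  have hZm : Measurable Z := hgm.lintegral_prod_right'
  have hfst : ρ.fst = μ.withDensity Z := by
    ext s hs
    rw [Measure.fst_apply hs, ← hρ, withDensity_apply _ (measurable_fst hs),
      withDensity_apply _ hs, ← lintegral_indicator (measurable_fst hs),
      lintegral_prod _ (hgm.indicator (measurable_fst hs)).aemeasurable, ← lintegral_indicator hs]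
    refine lintegral_congr fun x => ?_
    by_cases hx : x ∈ s
    · rw [Set.indicator_of_mem hx]
      exact lintegral_congr fun y => Set.indicator_of_mem (by exact hx) _
    · rw [Set.indicator_of_notMem hx]
      refine (lintegral_congr fun y => Set.indicator_of_notMem (by exact hx) _).trans (by simp)
  have hZint : ∫⁻ x, Z x ∂μ = 1 := by
    have : ρ.fst Set.univ = 1 := measure_univ
    rwa [hfst, withDensity_apply _ MeasurableSet.univ, Measure.restrict_univ] at this
  have hZtop : ∀ᵐ x ∂μ, Z x < ⊤ := ae_lt_top hZm (by simp [hZint])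
  have hS : MeasurableSet {x | Z x ≠ 0 ∧ Z x ≠ ⊤} :=
    ((hZm (measurableSet_singleton 0)).compl).inter ((hZm (measurableSet_singleton ⊤)).compl)
  set w : α → β → ℝ≥0∞ := fun x y => (Z x)⁻¹ * g (x, y) with hw
  have hwm : Measurable (Function.uncurry w) := (hZm.comp measurable_fst).inv.mul hgm
  obtain ⟨b⟩ := ‹Nonempty β›
  -- Off the set where the density can be normalized, which is negligible, any law will do.
  let κ : Kernel α β := Kernel.piecewise hS ((Kernel.const α ν).withDensity w)
    (Kernel.const α (Measure.dirac b))
  have hκ1 : ∀ x, Z x ≠ 0 → Z x ≠ ⊤ → ∀ t, MeasurableSet t →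
      κ x t = (Z x)⁻¹ * ∫⁻ y in t, g (x, y) ∂ν := by
    intro x h0 h1 t ht
    have hmem : x ∈ {x | Z x ≠ 0 ∧ Z x ≠ ⊤} := ⟨h0, h1⟩
    rw [Kernel.piecewise_apply, if_pos hmem, Kernel.withDensity_apply _ hwm,
      withDensity_apply _ ht, Kernel.const_apply, lintegral_const_mul]
    exact hgm.comp measurable_prodMk_left
  have hκ : IsMarkovKernel κ := by
    refine ⟨fun x => ?_⟩
    by_cases hx : Z x ≠ 0 ∧ Z x ≠ ⊤
    · constructor
      rw [hκ1 x hx.1 hx.2 _ MeasurableSet.univ, Measure.restrict_univ]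
      exact ENNReal.inv_mul_cancel hx.1 hx.2
    · have hmem : x ∉ {x | Z x ≠ 0 ∧ Z x ≠ ⊤} := hx
      rw [Kernel.piecewise_apply, if_neg hmem, Kernel.const_apply]
      infer_instance
  refine ⟨κ, hκ, ?_⟩
  refine Measure.ext_prod fun {s t} hs ht => ?_
  rw [Measure.compProd_apply_prod hs ht, hfst,
    setLIntegral_withDensity_eq_setLIntegral_mul _ hZm (κ.measurable_coe ht) hs]
  conv_rhs => rw [← hρ]
  rw [withDensity_apply _ (hs.prod ht), ← Measure.prod_restrict, lintegral_prod _ hgm.aemeasurable]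
  refine lintegral_congr_ae (ae_restrict_of_ae ?_)
  filter_upwards [hZtop] with x hx
  rw [Pi.mul_apply]
  by_cases h0 : Z x = 0
  · rw [h0, zero_mul]
    exact (le_antisymm ((setLIntegral_le_lintegral t _).trans h0.le) zero_le).symm
  · rw [hκ1 x h0 hx.ne t ht, ← mul_assoc, ENNReal.mul_inv_cancel h0 hx.ne, one_mul]

/-- A Markov chain with prescribed one-dimensional marginals: the Ionescu-Tulcea theorem for
transition kernels that depend on the last state only. -/
theorem exists_markovChain {E : Type*} [MeasurableSpace E] (μ : ℕ → Measure E)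
    [∀ n, IsProbabilityMeasure (μ n)] (η : ℕ → Kernel E E) [∀ n, IsMarkovKernel (η n)]
    (hμ : ∀ n, (μ n ⊗ₘ η n).snd = μ (n + 1)) :
    ∃ P : Measure (ℕ → E), IsProbabilityMeasure P ∧
      ∀ n, P.map (fun x => (x n, x (n + 1))) = μ n ⊗ₘ η n := by
  let κ : (n : ℕ) → Kernel ((i : Finset.Iic n) → E) E := fun n =>
    (η n).comap (fun x => x ⟨n, Finset.mem_Iic.2 le_rfl⟩) (measurable_pi_apply _)
  have hmc : Measurable fun (e : E) (_ : Finset.Iic 0) => e := by fun_prop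
  let m0 : Measure ((i : Finset.Iic 0) → E) := (μ 0).map fun e _ => e
  have : IsProbabilityMeasure m0 := Measure.isProbabilityMeasure_map hmc.aemeasurable
  -- `T a` is the law of the trajectory given the history up to time `a`, and `m n` is the law of
  -- the history up to time `n`.
  let T : (a : ℕ) → Kernel ((i : Finset.Iic a) → E) (ℕ → E) := fun a =>
    Kernel.traj (X := fun _ => E) κ a
  let m : (n : ℕ) → Measure ((i : Finset.Iic n) → E) := fun n =>
    (Kernel.partialTraj (X := fun _ => E) κ 0 n) ∘ₘ m0
  have hP : ∀ n, T 0 ∘ₘ m0 = T n ∘ₘ m n := by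
    intro n
    rw [Measure.comp_assoc]
    exact congrArg (fun k : Kernel ((i : Finset.Iic 0) → E) (ℕ → E) => k ∘ₘ m0)
      (Kernel.traj_comp_partialTraj (X := fun _ => E) (κ := κ) (Nat.zero_le n)).symm
  have hlast : ∀ n (x₀ : (i : Finset.Iic n) → E) (s : Set E), MeasurableSet s →
      x₀ ⟨n, Finset.mem_Iic.2 le_rfl⟩ ∈ s → ∀ᵐ x ∂(T n x₀), x n ∈ s := by
    intro n x₀ s hs hx
    have h1 := Kernel.traj_map_frestrictLe_of_le (X := fun _ => E) (κ := κ) (le_refl n)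
    have h2 : (T n x₀).map (Preorder.frestrictLe n) = Measure.dirac x₀ := by
      have := congrArg (fun k : Kernel ((i : Finset.Iic n) → E) ((i : Finset.Iic n) → E) => k x₀) h1
      rw [Kernel.map_apply _ (Preorder.measurable_frestrictLe n),
        Kernel.deterministic_apply] at this
      exact this
    have hs' : MeasurableSet
        {y : (i : Finset.Iic n) → E | y ⟨n, Finset.mem_Iic.2 le_rfl⟩ ∈ s} :=
      measurable_pi_apply _ hs
    have h3 : ∀ᵐ y ∂((T n x₀).map (Preorder.frestrictLe n)),
        y ⟨n, Finset.mem_Iic.2 le_rfl⟩ ∈ s := by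
      rw [h2, ae_dirac_iff hs']
      exact hx
    exact ae_of_ae_map (Preorder.measurable_frestrictLe n).aemeasurable h3
  have hpair : ∀ n, (T 0 ∘ₘ m0).map (fun x => (x n, x (n + 1))) =
      (m n).map (fun x => x ⟨n, Finset.mem_Iic.2 le_rfl⟩) ⊗ₘ η n := by
    intro n
    have hm2 : Measurable fun x : ℕ → E => (x n, x (n + 1)) := by fun_prop
    have hmn : IsProbabilityMeasure (m n) := by infer_instance
    have hT0 : IsProbabilityMeasure (T 0 ∘ₘ m0) := by infer_instance
    have : IsProbabilityMeasure ((T 0 ∘ₘ m0).map (fun x => (x n, x (n + 1)))) :=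
      Measure.isProbabilityMeasure_map hm2.aemeasurable
    have hmp : IsProbabilityMeasure
        ((m n).map (fun x => x ⟨n, Finset.mem_Iic.2 le_rfl⟩)) :=
      Measure.isProbabilityMeasure_map (measurable_pi_apply _).aemeasurable
    refine Measure.ext_prod fun {s t} hs ht => ?_
    rw [Measure.map_apply hm2 (hs.prod ht), hP n, Measure.bind_apply (hm2 (hs.prod ht))
      (Kernel.aemeasurable _), Measure.compProd_apply_prod hs ht,
      setLIntegral_map hs ((η n).measurable_coe ht) (measurable_pi_apply _),
      ← lintegral_indicator (measurable_pi_apply _ hs)]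
    refine lintegral_congr fun x₀ => ?_
    have h3 : T n x₀ {x | x (n + 1) ∈ t} = η n (x₀ ⟨n, Finset.mem_Iic.2 le_rfl⟩) t := by
      have := congrArg (fun k => k x₀ t) (Kernel.map_traj_succ_self (X := fun _ => E) (κ := κ) (a := n))
      rw [Kernel.map_apply' _ (measurable_pi_apply _) _ ht] at this
      exact this
    by_cases hx : x₀ ⟨n, Finset.mem_Iic.2 le_rfl⟩ ∈ s
    · rw [Set.indicator_of_mem (by exact hx), ← h3]
      refine measure_congr ?_
      filter_upwards [hlast n x₀ s hs hx] with x hx'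
      exact propext ⟨fun h => h.2, fun h => ⟨hx', h⟩⟩
    · rw [Set.indicator_of_notMem (by exact hx)]
      refine measure_mono_null ?_ (hlast n x₀ sᶜ hs.compl hx)
      intro x hx1 hx2
      exact hx2 hx1.1
  have hmarg : ∀ n, (m n).map (fun x => x ⟨n, Finset.mem_Iic.2 le_rfl⟩) = μ n := by
    intro n
    induction n with
    | zero =>
      have : m 0 = m0 := by
        change (Kernel.partialTraj (X := fun _ => E) κ 0 0) ∘ₘ m0 = m0
        rw [Kernel.partialTraj_self, Measure.id_comp]
      rw [this, Measure.map_map (measurable_pi_apply _) hmc]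
      exact Measure.map_id
    | succ n ih =>
      have h1 := hpair n
      rw [ih] at h1
      rw [← hμ n, ← h1, Measure.snd, Measure.map_map measurable_snd (by fun_prop)]
      have h2 : (T 0 ∘ₘ m0).map (Preorder.frestrictLe (n + 1)) = m (n + 1) := by
        rw [← Measure.deterministic_comp_eq_map (Preorder.measurable_frestrictLe (n + 1)),
          Measure.comp_assoc, Kernel.deterministic_comp_eq_map]
        exact congrArg (fun k : Kernel ((i : Finset.Iic 0) → E) ((i : Finset.Iic (n + 1)) → E) =>
          k ∘ₘ m0)
          (Kernel.traj_map_frestrictLe (X := fun _ => E) (κ := κ) 0 (n + 1))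
      have h3 : Measurable fun x : (i : Finset.Iic (n + 1)) → E =>
          x ⟨n + 1, Finset.mem_Iic.2 le_rfl⟩ := measurable_pi_apply _
      rw [← h2]
      exact Measure.map_map h3 (Preorder.measurable_frestrictLe (n + 1))
  refine ⟨T 0 ∘ₘ m0, inferInstance, fun n => ?_⟩
  rw [hpair, hmarg]

/-- A sequence of measures is uniformly absolutely continuous with respect to `ν`: events of small
`ν`-measure have small measure uniformly along the sequence. -/
def UniformlyAC {E : Type*} [MeasurableSpace E] (Q : ℕ → Measure E) (ν : Measure E) : Prop :=
  ∀ ε : ℝ≥0∞, ε ≠ 0 → ∃ δ : ℝ≥0∞, δ ≠ 0 ∧ ∀ A, MeasurableSet A → ν A ≤ δ → ∀ n, Q n A ≤ ε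

/-- A uniformly absolutely continuous sequence of probability measures that converges on a dense
family of events converges on every event, and the limit is a probability measure. -/
theorem UniformlyAC.exists_setwise_limit {E : Type*} [MeasurableSpace E] {Q : ℕ → Measure E}
    [∀ n, IsProbabilityMeasure (Q n)] {ν : Measure E} [IsFiniteMeasure ν] (h : UniformlyAC Q ν)
    {𝒜 : Set (Set E)} (h𝒜 : ν.MeasureDense 𝒜)
    (hQ : ∀ A ∈ 𝒜, ∃ l, Tendsto (fun n => (Q n).real A) atTop (𝓝 l)) :
    ∃ μ : Measure E, IsProbabilityMeasure μ ∧ μ ≪ ν ∧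
      ∀ A, MeasurableSet A → Tendsto (fun n => Q n A) atTop (𝓝 (μ A)) := by
  have hlim : ∀ A, MeasurableSet A → ∃ l, Tendsto (fun n => Q n A) atTop (𝓝 l) := by
    intro A hA
    have hc : CauchySeq fun n => (Q n).real A := by
      rw [Metric.cauchySeq_iff']
      intro ε hε
      obtain ⟨δ, hδ, hδA⟩ := h (ENNReal.ofReal (ε / 4)) (by simpa using hε)
      obtain ⟨δ', hδ', hδδ'⟩ : ∃ δ' : ℝ, 0 < δ' ∧ ENNReal.ofReal δ' ≤ δ := by
        by_cases ht : δ = ⊤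
        · exact ⟨1, one_pos, by simp [ht]⟩
        · exact ⟨δ.toReal, ENNReal.toReal_pos hδ ht, by rw [ENNReal.ofReal_toReal ht]⟩
      obtain ⟨T, hT, hTA⟩ := h𝒜.approx A hA (measure_ne_top _ _) δ' hδ'
      have hTm := h𝒜.measurable T hT
      have hd : ∀ n, |(Q n).real A - (Q n).real T| ≤ ε / 4 := by
        intro n
        refine (abs_measureReal_sub_le_measureReal_symmDiff hA.nullMeasurableSet hTm.nullMeasurableSet).trans ?_
        exact ENNReal.toReal_le_of_le_ofReal (by positivity)
          (hδA _ (hA.symmDiff hTm) (hTA.le.trans hδδ') n)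
      obtain ⟨l, hl⟩ := hQ T hT
      obtain ⟨N, hN⟩ := Metric.cauchySeq_iff'.1 hl.cauchySeq (ε / 4) (by positivity)
      refine ⟨N, fun n hn => ?_⟩
      have h1 := hd n
      have h2 := hd N
      have h3 := hN n hn
      rw [Real.dist_eq] at h3 ⊢
      rw [abs_le] at h1 h2
      rw [abs_lt] at h3 ⊢
      constructor <;> linarith [h1.1, h1.2, h2.1, h2.2, h3.1, h3.2]
    obtain ⟨l, hl⟩ := cauchySeq_tendsto_of_complete hc
    refine ⟨ENNReal.ofReal l, ?_⟩
    have := (ENNReal.continuous_ofReal.tendsto l).comp hl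
    simpa [Function.comp_def, ofReal_measureReal] using this
  choose! L hL using hlim
  have hsum : ∀ (A : ℕ → Set E), (∀ i, MeasurableSet (A i)) → Pairwise (Function.onFun Disjoint A) →
      L (⋃ i, A i) = ∑' i, L (A i) := by
    intro A hA hd
    have hfin : ∀ N : ℕ, Tendsto (fun n => ∑ i ∈ Finset.range N, Q n (A i)) atTop
        (𝓝 (∑ i ∈ Finset.range N, L (A i))) := fun N =>
      tendsto_finsetSum _ fun i _ => hL _ (hA i)
    have hU := hL _ (MeasurableSet.iUnion hA)
    have hsplit : ∀ N n, Q n (⋃ i, A i) = ∑ i ∈ Finset.range N, Q n (A i) +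
        ∑' i, Q n (A (i + N)) := fun N n => by
      rw [measure_iUnion hd hA]
      exact (ENNReal.summable.sum_add_tsum_nat_add' (f := fun i => Q n (A i))).symm
    refine le_antisymm ?_ ?_
    -- No mass is lost in the limit because the tails of the union are uniformly small.
    · refine ENNReal.le_of_forall_pos_le_add fun ε hε _ => ?_
      obtain ⟨δ, hδ, hδA⟩ := h ε (by simpa using hε.ne')
      have htail : Tendsto (fun N => ∑' i, ν (A (i + N))) atTop (𝓝 0) := by
        refine ENNReal.tendsto_sum_nat_add (fun i => ν (A i)) ?_
        rw [← measure_iUnion hd hA]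
        exact measure_ne_top _ _
      obtain ⟨N, hN⟩ := (htail.eventually (ge_mem_nhds (pos_iff_ne_zero.2 hδ))).exists
      have hle : L (⋃ i, A i) ≤ ∑ i ∈ Finset.range N, L (A i) + ε := by
        refine le_of_tendsto_of_tendsto' hU ((hfin N).add_const _) fun n => ?_
        rw [hsplit N n]
        gcongr
        have hd' : Pairwise (Function.onFun Disjoint fun i => A (i + N)) := fun i j hij =>
          hd (by simpa using hij)
        rw [← measure_iUnion hd' fun i => hA _]
        refine hδA _ (MeasurableSet.iUnion fun i => hA _) ?_ n
        rwa [measure_iUnion hd' fun i => hA _]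
      exact hle.trans (by gcongr; exact ENNReal.sum_le_tsum _)
    · refine ENNReal.tsum_le_of_sum_range_le fun N => ?_
      refine le_of_tendsto_of_tendsto' (hfin N) hU fun n => ?_
      rw [hsplit N n]
      exact le_self_add
  have hempty : L ∅ = 0 := by
    refine tendsto_nhds_unique (hL _ MeasurableSet.empty) ?_
    simp
  let μ : Measure E := Measure.ofMeasurable (fun A _ => L A) hempty
    fun A hA hd => hsum A hA hd
  have hμ : ∀ A, MeasurableSet A → μ A = L A := fun A hA => Measure.ofMeasurable_apply A hA
  refine ⟨μ, ⟨?_⟩, ?_, fun A hA => ?_⟩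
  · rw [hμ _ MeasurableSet.univ]
    refine tendsto_nhds_unique (hL _ MeasurableSet.univ) ?_
    simp
  · refine Measure.AbsolutelyContinuous.mk fun A hA hA0 => ?_
    rw [hμ _ hA]
    refine le_antisymm (le_of_forall_gt_imp_ge_of_dense fun ε hε => ?_) zero_le
    obtain ⟨δ, -, hδA⟩ := h ε hε.ne'
    exact le_of_tendsto' (hL A hA) fun n => hδA A hA (by simp [hA0]) n
  · rw [hμ _ hA]
    exact hL A hA

/-- Setwise convergence of probability measures implies convergence of the integrals of bounded
measurable functions. -/
theorem tendsto_integral_of_tendsto_setwise {E : Type*} [MeasurableSpace E] {Q : ℕ → Measure E}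
    [∀ n, IsProbabilityMeasure (Q n)] {μ : Measure E} [IsProbabilityMeasure μ]
    (h : ∀ A, MeasurableSet A → Tendsto (fun n => Q n A) atTop (𝓝 (μ A)))
    {f : E → ℝ} (hf : Measurable f) {C : ℝ} (hC : ∀ x, |f x| ≤ C) :
    Tendsto (fun n => ∫ x, f x ∂(Q n)) atTop (𝓝 (∫ x, f x ∂μ)) := by
  have hC0 : -C ≤ C := by
    obtain ⟨x⟩ := nonempty_of_isProbabilityMeasure μ
    linarith [(abs_nonneg _).trans (hC x)]
  -- The laws of `f` converge weakly on `ℝ`, by the portmanteau theorem; testing them against a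
  -- bounded continuous function that is the identity on `[-C, C]` gives the integrals of `f`.
  let Q' : ℕ → ProbabilityMeasure ℝ := fun n =>
    ⟨(Q n).map f, Measure.isProbabilityMeasure_map hf.aemeasurable⟩
  let μ' : ProbabilityMeasure ℝ := ⟨μ.map f, Measure.isProbabilityMeasure_map hf.aemeasurable⟩
  have hconv : Tendsto Q' atTop (𝓝 μ') := by
    refine tendsto_of_forall_isOpen_le_liminf fun G hG => ?_
    have h1 : Tendsto (fun n => Q' n G) atTop (𝓝 (μ' G)) := by
      have h2 := h _ (hf hG.measurableSet)
      rw [← ENNReal.tendsto_coe]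
      simp only [ProbabilityMeasure.ennreal_coeFn_eq_coeFn_toMeasure]
      change Tendsto (fun n => (Q n).map f G) atTop (𝓝 (μ.map f G))
      simpa only [Measure.map_apply hf hG.measurableSet] using h2
    exact h1.liminf_eq.ge
  let g : BoundedContinuousFunction ℝ ℝ := BoundedContinuousFunction.mkOfBound
    ⟨fun x => max (-C) (min C x), by fun_prop⟩ (2 * C) (by
      intro x y
      rw [Real.dist_eq, abs_le]
      have h1 : ∀ x : ℝ, -C ≤ max (-C) (min C x) := fun x => le_max_left _ _
      have h2 : ∀ x : ℝ, max (-C) (min C x) ≤ C := fun x => max_le hC0 (min_le_left _ _)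
      constructor <;> simp only [ContinuousMap.coe_mk] <;> linarith [h1 x, h1 y, h2 x, h2 y])
  have hg : ∀ x, g (f x) = f x := by
    intro x
    have := abs_le.1 (hC x)
    change max (-C) (min C (f x)) = f x
    rw [min_eq_right this.2, max_eq_right this.1]
  have h3 := (ProbabilityMeasure.tendsto_iff_forall_integral_tendsto.1 hconv) g
  have h4 : ∀ m : Measure E, ∫ y, g y ∂(m.map f) = ∫ x, f x ∂m := fun m => by
    rw [integral_map hf.aemeasurable g.continuous.aestronglyMeasurable]
    simp only [hg]
  have h5 : (fun n => ∫ y, g y ∂(Q' n : Measure ℝ)) = fun n => ∫ x, f x ∂(Q n) :=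
    funext fun n => h4 (Q n)
  rw [h5] at h3
  have h6 : ∫ y, g y ∂(μ' : Measure ℝ) = ∫ x, f x ∂μ := h4 μ
  rwa [h6] at h3

end Abstract

/-! ### Measurability on the space of configurations -/

section Configurations

variable {d : ℕ}

theorem box_mono {m n : ℕ} (h : m ≤ n) : box d m ⊆ box d n := fun x hx i => by
  have h1 := hx i
  have h2 : (m : ℝ) ≤ n := by exact_mod_cast h
  exact ⟨by linarith [h1.1], by linarith [h1.2]⟩

theorem exists_subset_box {Λ : Set (Space d)} (h : IsBounded Λ) : ∃ m : ℕ, Λ ⊆ box d m := by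
  obtain ⟨r, hr⟩ := h.subset_closedBall (0 : Space d)
  obtain ⟨m, hm⟩ := exists_nat_ge r
  refine ⟨m, fun x hx i => ?_⟩
  have h1 := hr hx
  rw [mem_closedBall_zero_iff] at h1
  have h2 : ‖x i‖ ≤ ‖x‖ := PiLp.norm_apply_le x i
  rw [Real.norm_eq_abs] at h2
  have h3 := abs_le.1 (h2.trans (h1.trans hm))
  exact ⟨h3.1, h3.2⟩

theorem isFiniteMeasure_volume_restrict {Λ : Set (Space d)} (hb : IsBounded Λ) :
    IsFiniteMeasure ((volume : Measure (Space d)).restrict Λ) :=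
  ⟨by rw [Measure.restrict_apply_univ]; exact hb.measure_lt_top⟩

theorem volume_box (d n : ℕ) : volume (box d n) = ENNReal.ofReal ((2 * n : ℝ) ^ d) := by
  have h : box d n = (MeasurableEquiv.toLp 2 (Fin d → ℝ)).symm ⁻¹'
      (Set.Icc (fun _ => -(n : ℝ)) fun _ => (n : ℝ)) := by
    ext x
    simp only [box, Set.mem_ofPred_eq, Set.mem_preimage, Set.mem_Icc, Pi.le_def]
    exact ⟨fun hx => ⟨fun i => (hx i).1, fun i => (hx i).2⟩, fun hx i => ⟨hx.1 i, hx.2 i⟩⟩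
  rw [h, (EuclideanSpace.volume_preserving_symm_measurableEquiv_toLp (Fin d)).measure_preimage
    measurableSet_Icc.nullMeasurableSet, Real.volume_Icc_pi]
  simp only [sub_neg_eq_add, Finset.prod_const, Finset.card_univ, Fintype.card_fin]
  rw [← ENNReal.ofReal_pow (by positivity)]
  ring_nf

@[simp] theorem Config.carrier_restrict (γ : Config d) (Λ : Set (Space d)) :
    (γ.restrict Λ).carrier = γ.carrier ∩ Λ := rfl

@[simp] theorem Config.carrier_translate (u : Space d) (γ : Config d) :
    (γ.translate u).carrier = (fun x => x + u) '' γ.carrier := rfl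

@[simp] theorem FinConf.carrier_restrict (γ : FinConf d) (Λ : Set (Space d)) :
    (γ.restrict Λ).1.carrier = γ.1.carrier ∩ Λ := rfl

@[simp] theorem FinConf.carrier_translate (u : Space d) (γ : FinConf d) :
    (γ.translate u).1.carrier = (fun x => x + u) '' γ.1.carrier := rfl

@[simp] theorem FinConf.carrier_ofPoints {n : ℕ} (x : Fin n → Space d) :
    (FinConf.ofPoints x).1.carrier = Set.range x := rfl

@[simp] theorem FinConf.carrier_empty : (FinConf.empty : FinConf d).1.carrier = ∅ := rfl

@[simp] theorem Config.carrier_finRestrict (γ : Config d) (Λ : Set (Space d)) (h : IsBounded Λ) :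
    (γ.finRestrict Λ h).1.carrier = γ.carrier ∩ Λ := rfl

theorem FinConf.ext_carrier {γ γ' : FinConf d} (h : γ.1.carrier = γ'.1.carrier) : γ = γ' :=
  Subtype.ext (Config.ext h)

/-- The configuration `γ_S ∪ γ'_{Sᶜ}`. Unlike the union of two arbitrary configurations it is
counted additively, hence plainly measurable in `(γ, γ')`. -/
def Config.glue (S : Set (Space d)) (γ γ' : Config d) : Config d :=
  (γ.restrict S).union (γ'.restrict Sᶜ)

/-- The finite configuration `γ_S ∪ γ'_{Sᶜ}`. -/
def FinConf.glue (S : Set (Space d)) (γ γ' : FinConf d) : FinConf d :=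
  ⟨Config.glue S γ.1 γ'.1, (γ.2.subset Set.inter_subset_left).union
    (γ'.2.subset Set.inter_subset_left)⟩

@[simp] theorem Config.carrier_glue (S : Set (Space d)) (γ γ' : Config d) :
    (Config.glue S γ γ').carrier = γ.carrier ∩ S ∪ γ'.carrier ∩ Sᶜ := rfl

@[simp] theorem FinConf.carrier_glue (S : Set (Space d)) (γ γ' : FinConf d) :
    (FinConf.glue S γ γ').1.carrier = γ.1.carrier ∩ S ∪ γ'.1.carrier ∩ Sᶜ := rfl

theorem FinConf.restrict_compl_glue (Δ : Set (Space d)) (η ξ : FinConf d) :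
    (FinConf.glue Δ η ξ).restrict Δᶜ = ξ.restrict Δᶜ := FinConf.ext_carrier (by
  ext x
  simp only [FinConf.carrier_restrict, FinConf.carrier_glue, Set.mem_inter_iff, Set.mem_union,
    Set.mem_compl_iff]
  tauto)

theorem FinConf.restrict_glue (Δ : Set (Space d)) (η ξ : FinConf d) :
    (FinConf.glue Δ η ξ).restrict Δ = η.restrict Δ := FinConf.ext_carrier (by
  ext x
  simp only [FinConf.carrier_restrict, FinConf.carrier_glue, Set.mem_inter_iff, Set.mem_union,
    Set.mem_compl_iff]
  tauto)

theorem Config.measurable_restrict {Λ : Set (Space d)} (hΛ : MeasurableSet Λ) :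
    Measurable fun γ : Config d => γ.restrict Λ := by
  refine measurable_config fun Λ' hb hm => ?_
  have : (fun γ : Config d => (γ.restrict Λ).count Λ') = Config.count (Λ ∩ Λ') := by
    funext γ
    simp only [Config.count, Config.carrier_restrict, Set.inter_assoc]
  rw [this]
  exact measurable_count (hb.subset Set.inter_subset_right) (hΛ.inter hm)

theorem Config.measurable_finRestrict {Λ : Set (Space d)} (hb : IsBounded Λ)
    (hΛ : MeasurableSet Λ) : Measurable fun γ : Config d => γ.finRestrict Λ hb :=
  (Config.measurable_restrict hΛ).subtype_mk

theorem FinConf.measurable_restrict {Λ : Set (Space d)} (hΛ : MeasurableSet Λ) :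
    Measurable fun γ : FinConf d => γ.restrict Λ :=
  ((Config.measurable_restrict hΛ).comp measurable_subtype_coe).subtype_mk

theorem Config.measurable_glue {S : Set (Space d)} (hS : MeasurableSet S) :
    Measurable fun p : Config d × Config d => Config.glue S p.1 p.2 := by
  refine measurable_config fun Λ hb hm => ?_
  have : (fun p : Config d × Config d => (Config.glue S p.1 p.2).count Λ) =
      fun p => p.1.count (S ∩ Λ) + p.2.count (Sᶜ ∩ Λ) := by
    funext p
    have h1 : (Config.glue S p.1 p.2).carrier ∩ Λ =
        (p.1.carrier ∩ (S ∩ Λ)) ∪ (p.2.carrier ∩ (Sᶜ ∩ Λ)) := by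
      rw [Config.carrier_glue, Set.union_inter_distrib_right, Set.inter_assoc, Set.inter_assoc]
    rw [Config.count, h1, Set.ncard_union_eq _
      (p.1.finite_inter _ (hb.subset Set.inter_subset_right))
      (p.2.finite_inter _ (hb.subset Set.inter_subset_right))]
    · rfl
    · exact Set.disjoint_left.2 fun x hx hx' => hx'.2.1 hx.2.1
  rw [this]
  exact ((measurable_count (hb.subset Set.inter_subset_right) (hS.inter hm)).comp
    measurable_fst).add ((measurable_count (hb.subset Set.inter_subset_right)
      (hS.compl.inter hm)).comp measurable_snd)

theorem FinConf.measurable_glue {S : Set (Space d)} (hS : MeasurableSet S) :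
    Measurable fun p : FinConf d × FinConf d => FinConf.glue S p.1 p.2 :=
  ((Config.measurable_glue hS).comp ((measurable_subtype_coe.comp measurable_fst).prodMk
    (measurable_subtype_coe.comp measurable_snd))).subtype_mk

theorem Config.measurable_translate (u : Space d) :
    Measurable fun γ : Config d => γ.translate u :=
  GibbsPP.measurable_translate.comp (measurable_const.prodMk measurable_id)

theorem FinConf.measurable_translate (u : Space d) :
    Measurable fun γ : FinConf d => γ.translate u :=
  ((Config.measurable_translate u).comp measurable_subtype_coe).subtype_mk

theorem Config.translate_translate (u v : Space d) (γ : Config d) :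
    (γ.translate u).translate v = γ.translate (u + v) := by
  ext x
  simp [add_assoc]

theorem FinConf.translate_translate (u v : Space d) (γ : FinConf d) :
    (γ.translate u).translate v = γ.translate (u + v) :=
  Subtype.ext (Config.translate_translate u v γ.1)

/-- The sigma-field of the configuration space is countably generated: the counting functions of a
countable algebra of Borel sets, cut off by the windows, determine all others. -/
instance : MeasurableSpace.CountablyGenerated (Config d) := by
  set 𝒯 : Set (Set (Space d)) := generateSetAlgebra (MeasurableSpace.countableGeneratingSet (Space d))
  have h𝒯a : IsSetAlgebra 𝒯 := isSetAlgebra_generateSetAlgebra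
  have h𝒯c : 𝒯.Countable :=
    countable_generateSetAlgebra MeasurableSpace.countable_countableGeneratingSet
  have h𝒯g : (inferInstance : MeasurableSpace (Space d)) = MeasurableSpace.generateFrom 𝒯 := by
    rw [generateFrom_generateSetAlgebra_eq, MeasurableSpace.generateFrom_countableGeneratingSet]
  have h𝒯p : IsPiSystem 𝒯 := fun s hs t ht _ => h𝒯a.inter_mem hs ht
  have h𝒯m : ∀ T ∈ 𝒯, MeasurableSet T := fun T hT => by
    have := MeasurableSpace.measurableSet_generateFrom hT
    rwa [← h𝒯g] at this
  set 𝒢 : Set (Set (Config d)) := ⋃ T ∈ 𝒯, ⋃ k : ℕ, ⋃ j : ℕ,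
    {Config.count (T ∩ box d k) ⁻¹' {j}} with h𝒢
  have h𝒢c : 𝒢.Countable := h𝒯c.biUnion fun T _ => Set.countable_iUnion fun k =>
    Set.countable_iUnion fun j => Set.countable_singleton _
  have hkey : ∀ T : Set (Space d), MeasurableSet T → ∀ k,
      Measurable[MeasurableSpace.generateFrom 𝒢] (Config.count (T ∩ box d k)) := by
    let _ : MeasurableSpace (Config d) := MeasurableSpace.generateFrom 𝒢
    intro T hT
    have hbase : ∀ T ∈ 𝒯, ∀ k, Measurable (Config.count (T ∩ box d k)) := fun T hT k =>
      measurable_to_countable' fun j => MeasurableSpace.measurableSet_generateFrom (by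
        simp only [h𝒢, Set.mem_iUnion]
        exact ⟨T, hT, k, j, rfl⟩)
    have hbk : ∀ (T : Set (Space d)) k, IsBounded (T ∩ box d k) := fun T k =>
      (isBounded_box d k).subset Set.inter_subset_right
    refine MeasurableSpace.induction_on_inter
      (C := fun T _ => ∀ k, Measurable (Config.count (T ∩ box d k))) h𝒯g h𝒯p ?_ ?_ ?_ ?_ T hT
    · exact hbase ∅ h𝒯a.empty_mem
    · exact fun T hT => hbase T hT
    · intro T hT ih k
      have : Config.count (Tᶜ ∩ box d k) = fun γ : Config d =>
          γ.count (Set.univ ∩ box d k) - γ.count (T ∩ box d k) := by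
        funext γ
        rw [eq_tsub_iff_add_eq_of_le, Config.count, Config.count, Config.count, ← Set.ncard_union_eq
          _ (γ.finite_inter _ (hbk _ k)) (γ.finite_inter _ (hbk _ k))]
        · congr 1
          ext x
          simp only [Set.mem_union, Set.mem_inter_iff, Set.mem_compl_iff, Set.mem_univ]
          tauto
        · exact Set.disjoint_left.2 fun x hx hx' => hx.2.1 hx'.2.1
        · exact Set.ncard_le_ncard (fun x hx => ⟨hx.1, Set.mem_univ _, hx.2.2⟩)
            (γ.finite_inter _ (hbk _ k))
      rw [this]
      exact (hbase Set.univ h𝒯a.univ_mem k).sub (ih k)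
    · intro f hd hf ih k
      have hE : Measurable fun γ : Config d => (γ.count ((⋃ i, f i) ∩ box d k) : ℝ≥0∞) := by
        have : (fun γ : Config d => (γ.count ((⋃ i, f i) ∩ box d k) : ℝ≥0∞)) =
            fun γ => ∑' i, (γ.count (f i ∩ box d k) : ℝ≥0∞) := by
          funext γ
          simp_rw [count_eq_measure γ (hbk _ k)]
          rw [← measure_iUnion]
          · congr 1
            ext x
            simp
          · refine fun i j hij => Set.disjoint_left.2 fun x hx hx' => ?_
            exact Set.disjoint_left.1 (hd hij) hx.2.1 hx'.2.1
          · exact fun i => (γ.finite_inter _ (hbk _ k)).measurableSet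
        rw [this]
        exact Measurable.tsum fun i =>
          (measurable_from_top (f := fun n : ℕ => (n : ℝ≥0∞))).comp (ih i k)
      refine measurable_to_countable' fun j => ?_
      have : Config.count ((⋃ i, f i) ∩ box d k) ⁻¹' {j} =
          (fun γ : Config d => (γ.count ((⋃ i, f i) ∩ box d k) : ℝ≥0∞)) ⁻¹' {(j : ℝ≥0∞)} := by
        ext γ
        simp
      rw [this]
      exact hE (measurableSet_singleton _)
  refine ⟨𝒢, h𝒢c, le_antisymm ?_ ?_⟩
  · refine iSup_le fun Λ => iSup_le fun hb => iSup_le fun hm => ?_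
    rw [← measurable_iff_comap_le]
    obtain ⟨k, hk⟩ := exists_subset_box hb
    have := hkey Λ hm k
    rwa [Set.inter_eq_left.2 hk] at this
  · refine MeasurableSpace.generateFrom_le fun s hs => ?_
    simp only [h𝒢, Set.mem_iUnion] at hs
    obtain ⟨T, hT, k, j, rfl⟩ := hs
    exact measurable_count ((isBounded_box d k).subset Set.inter_subset_right)
      ((h𝒯m T hT).inter (measurableSet_box d k)) trivial

/-- The trace of a configuration in the window `Λₘ`. -/
abbrev Config.inBox (m : ℕ) (γ : Config d) : FinConf d := γ.finRestrict (box d m) (isBounded_box d m)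

theorem Config.measurable_inBox (m : ℕ) : Measurable (Config.inBox (d := d) m) :=
  Config.measurable_finRestrict _ (measurableSet_box d m)

theorem Config.restrict_inBox {Λ : Set (Space d)} {m : ℕ} (h : Λ ⊆ box d m) (γ : Config d) :
    (γ.inBox m).1.restrict Λ = γ.restrict Λ := by
  ext x
  simp only [Config.carrier_restrict, Config.carrier_finRestrict, Set.mem_inter_iff]
  exact ⟨fun hx => ⟨hx.1.1, hx.2⟩, fun hx => ⟨⟨hx.1, h hx.2⟩, hx.2⟩⟩

/-- A finite measure on configurations is determined by its images in the windows `Λₘ`. -/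
theorem ext_of_map_inBox {μ ν : Measure (Config d)} [IsFiniteMeasure μ]
    (h : ∀ m A, MeasurableSet A → μ (Config.inBox m ⁻¹' A) = ν (Config.inBox m ⁻¹' A)) :
    μ = ν := by
  refine ext_of_generate_finite
    {s | ∃ m : ℕ, ∃ A : Set (FinConf d), MeasurableSet A ∧ Config.inBox m ⁻¹' A = s}
    (le_antisymm ?_ ?_) ?_ ?_ ?_
  · refine iSup_le fun Λ => iSup_le fun hb => iSup_le fun hm => ?_
    obtain ⟨m, hΛm⟩ := exists_subset_box hb
    rintro _ ⟨t, -, rfl⟩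
    refine MeasurableSpace.measurableSet_generateFrom ⟨m, {γ | γ.1.count Λ ∈ t},
      (measurable_count hb hm).comp measurable_subtype_coe trivial, ?_⟩
    ext γ
    have : (γ.inBox m).1.count Λ = γ.count Λ := by
      have := congrArg (fun γ : Config d => γ.carrier.ncard) (Config.restrict_inBox hΛm γ)
      exact this
    simp only [Set.mem_preimage, Set.mem_ofPred_eq, this]
  · refine MeasurableSpace.generateFrom_le ?_
    rintro _ ⟨m, A, hA, rfl⟩
    exact Config.measurable_inBox m hA
  · rintro _ ⟨m, A, hA, rfl⟩ _ ⟨n, B, hB, rfl⟩ -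
    refine ⟨max m n, {γ | γ.restrict (box d m) ∈ A ∧ γ.restrict (box d n) ∈ B},
      (FinConf.measurable_restrict (measurableSet_box d m) hA).inter
        (FinConf.measurable_restrict (measurableSet_box d n) hB), ?_⟩
    ext γ
    have h1 : (γ.inBox (max m n)).restrict (box d m) = γ.inBox m :=
      Subtype.ext (Config.restrict_inBox (box_mono (le_max_left m n)) γ)
    have h2 : (γ.inBox (max m n)).restrict (box d n) = γ.inBox n :=
      Subtype.ext (Config.restrict_inBox (box_mono (le_max_right m n)) γ)
    simp only [Set.mem_preimage, Set.mem_ofPred_eq, h1, h2, Set.mem_inter_iff]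
  · rintro _ ⟨m, A, hA, rfl⟩
    exact h m A hA
  · exact h 0 Set.univ MeasurableSet.univ

end Configurations

/-! ### The Lebesgue-Poisson measure -/

section LebesguePoisson

variable {d : ℕ}

/-- The Lebesgue-Poisson measure of a measure `μ` on `ℝ^d`: the unnormalized Poisson process
`∑ₙ (1 / n!) · law of {x₁, …, xₙ} under μ(dx₁) … μ(dxₙ)` of intensity `μ`. -/
def lpm (μ : Measure (Space d)) : Measure (FinConf d) :=
  Measure.sum fun n : ℕ => ((n.factorial : ℝ≥0∞))⁻¹ •
    (Measure.pi fun _ : Fin n => μ).map FinConf.ofPoints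

theorem poisson_eq_smul_lpm (Λ : Set (Space d)) :
    poisson Λ = ENNReal.ofReal (Real.exp (-(volume Λ).toReal)) • lpm (volume.restrict Λ) := rfl

theorem lintegral_lpm (μ : Measure (Space d)) {f : FinConf d → ℝ≥0∞} (hf : Measurable f) :
    ∫⁻ γ, f γ ∂lpm μ = ∑' n : ℕ, ((n.factorial : ℝ≥0∞))⁻¹ *
      ∫⁻ x, f (FinConf.ofPoints x) ∂(Measure.pi fun _ : Fin n => μ) := by
  rw [lpm, lintegral_sum_measure]
  refine tsum_congr fun n => ?_
  rw [lintegral_smul_measure, lintegral_map hf (measurable_ofPoints n), smul_eq_mul]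

/-- Functions of a finite point set that are measurable in the points. In contrast to measurable
functions on `FinConf d`, this class is visibly stable under the insertion of points. -/
def TupleMeasurable (f : Set (Space d) → ℝ≥0∞) : Prop :=
  ∀ n, Measurable fun x : Fin n → Space d => f (Set.range x)

theorem range_append {α : Type*} {k l : ℕ} (x : Fin k → α) (y : Fin l → α) :
    Set.range (Fin.append x y) = Set.range x ∪ Set.range y := by
  ext a
  constructor
  · rintro ⟨i, rfl⟩
    refine Fin.addCases (fun j => ?_) (fun j => ?_) i
    · exact Or.inl ⟨j, by simp⟩
    · exact Or.inr ⟨j, by simp⟩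
  · rintro (⟨i, rfl⟩ | ⟨i, rfl⟩)
    · exact ⟨Fin.castAdd l i, by simp⟩
    · exact ⟨Fin.natAdd k i, by simp⟩

theorem measurable_append {k l : ℕ} :
    Measurable fun p : (Fin k → Space d) × (Fin l → Space d) => Fin.append p.1 p.2 := by
  refine measurable_pi_iff.2 fun i => ?_
  refine Fin.addCases (fun j => ?_) (fun j => ?_) i
  · simp only [Fin.append_left]
    exact (measurable_pi_apply j).comp measurable_fst
  · simp only [Fin.append_right]
    exact (measurable_pi_apply j).comp measurable_snd

theorem measurable_cons {k : ℕ} :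
    Measurable fun p : Space d × (Fin k → Space d) => (Fin.cons p.1 p.2 : Fin (k + 1) → Space d) := by
  refine measurable_pi_iff.2 fun i => ?_
  refine Fin.cases ?_ (fun j => ?_) i
  · simpa only [Fin.cons_zero] using measurable_fst
  · simp only [Fin.cons_succ]
    exact (measurable_pi_apply j).comp measurable_snd

theorem TupleMeasurable.union {f : Set (Space d) → ℝ≥0∞} (hf : TupleMeasurable f) (k l : ℕ) :
    Measurable fun p : (Fin k → Space d) × (Fin l → Space d) =>
      f (Set.range p.1 ∪ Set.range p.2) := by
  simp_rw [← range_append]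
  exact (hf _).comp measurable_append

theorem TupleMeasurable.insert_union {f : Set (Space d) → ℝ≥0∞} (hf : TupleMeasurable f)
    (k l : ℕ) : Measurable fun p : Space d × ((Fin k → Space d) × (Fin l → Space d)) =>
      f (insert p.1 (Set.range p.2.1 ∪ Set.range p.2.2)) := by
  simp_rw [← range_append, ← Fin.range_cons]
  exact (hf _).comp (measurable_cons.comp
    (measurable_fst.prodMk (measurable_append.comp measurable_snd)))

theorem TupleMeasurable.insert_const {f : Set (Space d) → ℝ≥0∞} (hf : TupleMeasurable f)
    (a : Space d) : TupleMeasurable fun s => f (insert a s) := fun n => by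
  simp_rw [← Fin.range_cons]
  exact (hf _).comp (measurable_cons.comp (measurable_const.prodMk measurable_id))

theorem lintegral_pi_succ (μ : Measure (Space d)) [SigmaFinite μ] {f : Set (Space d) → ℝ≥0∞}
    (hf : TupleMeasurable f) (n : ℕ) :
    ∫⁻ x, f (Set.range x) ∂(Measure.pi fun _ : Fin (n + 1) => μ) =
      ∫⁻ a, ∫⁻ x, f (insert a (Set.range x)) ∂(Measure.pi fun _ : Fin n => μ) ∂μ := by
  have h := (measurePreserving_piFinSuccAbove (fun _ : Fin (n + 1) => μ) 0).symm
  rw [← h.lintegral_comp (hf (n + 1)), lintegral_prod (fun q => f (Set.range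
    ((MeasurableEquiv.piFinSuccAbove (fun _ : Fin (n + 1) => Space d) 0).symm q)))
    ((hf _).comp h.measurable).aemeasurable]
  refine lintegral_congr fun a => lintegral_congr fun x => ?_
  rw [← Fin.range_cons]
  congr 2
  exact Fin.insertNth_zero' a x

/-- The integral of a function of a point set against `k` points with law `μ` and `l` points with
law `ν`. -/
def twoTypeIntegral (μ ν : Measure (Space d)) (f : Set (Space d) → ℝ≥0∞) (k l : ℕ) : ℝ≥0∞ :=
  ∫⁻ x, ∫⁻ y, f (Set.range x ∪ Set.range y) ∂(Measure.pi fun _ : Fin l => ν)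
    ∂(Measure.pi fun _ : Fin k => μ)

theorem twoTypeIntegral_succ_left (μ ν : Measure (Space d)) [SigmaFinite μ] [SigmaFinite ν]
    {f : Set (Space d) → ℝ≥0∞} (hf : TupleMeasurable f) (k l : ℕ) :
    twoTypeIntegral μ ν f (k + 1) l = ∫⁻ a, twoTypeIntegral μ ν (fun s => f (insert a s)) k l ∂μ := by
  have hF : TupleMeasurable fun s =>
      ∫⁻ y, f (s ∪ Set.range y) ∂(Measure.pi fun _ : Fin l => ν) := fun n =>
    (hf.union n l).lintegral_prod_right'
  rw [twoTypeIntegral, lintegral_pi_succ μ hF]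
  simp only [Set.insert_union, twoTypeIntegral]

theorem twoTypeIntegral_succ_right (μ ν : Measure (Space d)) [SigmaFinite μ] [SigmaFinite ν]
    {f : Set (Space d) → ℝ≥0∞} (hf : TupleMeasurable f) (k l : ℕ) :
    twoTypeIntegral μ ν f k (l + 1) = ∫⁻ a, twoTypeIntegral μ ν (fun s => f (insert a s)) k l ∂ν := by
  have hF : ∀ x : Fin k → Space d, TupleMeasurable fun s => f (Set.range x ∪ s) := fun x n =>
    (hf.union k n).comp measurable_prodMk_left
  simp only [twoTypeIntegral]
  simp_rw [fun x => lintegral_pi_succ ν (hF x) l, Set.union_insert]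
  refine lintegral_lintegral_swap ?_
  have : Measurable fun q : ((Fin k → Space d) × Space d) × (Fin l → Space d) =>
      f (insert q.1.2 (Set.range q.1.1 ∪ Set.range q.2)) :=
    (hf.insert_union k l).comp ((measurable_snd.comp measurable_fst).prodMk
      ((measurable_fst.comp measurable_fst).prodMk measurable_snd))
  exact this.lintegral_prod_right'.aemeasurable

theorem measurable_twoTypeIntegral_insert (μ ν : Measure (Space d)) [SigmaFinite μ]
    [SigmaFinite ν] {f : Set (Space d) → ℝ≥0∞} (hf : TupleMeasurable f) (k l : ℕ) :
    Measurable fun a => twoTypeIntegral μ ν (fun s => f (insert a s)) k l := by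
  have : Measurable fun q : (Space d × (Fin k → Space d)) × (Fin l → Space d) =>
      f (insert q.1.1 (Set.range q.1.2 ∪ Set.range q.2)) :=
    (hf.insert_union k l).comp ((measurable_fst.comp measurable_fst).prodMk
      ((measurable_snd.comp measurable_fst).prodMk measurable_snd))
  exact this.lintegral_prod_right'.lintegral_prod_right'

/-- The binomial formula for `n` points whose law is a sum of two measures. -/
theorem lintegral_pi_add (μ ν : Measure (Space d)) [IsFiniteMeasure μ] [IsFiniteMeasure ν] (n : ℕ) :
    ∀ {f : Set (Space d) → ℝ≥0∞}, TupleMeasurable f →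
    ∫⁻ x, f (Set.range x) ∂(Measure.pi fun _ : Fin n => μ + ν) =
      ∑ kl ∈ Finset.HasAntidiagonal.antidiagonal n, (n.choose kl.1 : ℝ≥0∞) * twoTypeIntegral μ ν f kl.1 kl.2 := by
  induction n with
  | zero =>
    intro f hf
    have h0 : ∀ (m : Measure (Space d)) (g : (Fin 0 → Space d) → ℝ≥0∞),
        ∫⁻ x, g x ∂(Measure.pi fun _ : Fin 0 => m) = g Fin.elim0 := fun m g => by
      rw [Measure.pi_of_empty _ Fin.elim0]
      simp
    simp [twoTypeIntegral, h0]
  | succ n ih =>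
    intro f hf
    rw [lintegral_pi_succ _ hf, lintegral_add_measure]
    simp_rw [fun a => ih (hf.insert_const a)]
    have hm := fun kl : ℕ × ℕ => measurable_twoTypeIntegral_insert μ ν hf kl.1 kl.2
    rw [lintegral_finsetSum _ fun kl _ => (hm kl).const_mul _,
      lintegral_finsetSum _ fun kl _ => (hm kl).const_mul _,
      Finset.sum_antidiagonal_choose_succ_mul, add_comm]
    congr 1
    · refine Finset.sum_congr rfl fun kl _ => ?_
      rw [lintegral_const_mul _ (hm kl), twoTypeIntegral_succ_right μ ν hf]
    · refine Finset.sum_congr rfl fun kl hkl => ?_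
      rw [lintegral_const_mul _ (hm kl), twoTypeIntegral_succ_left μ ν hf,
        ← Nat.choose_symm_of_eq_add (Finset.HasAntidiagonal.mem_antidiagonal.1 hkl).symm]

open Classical in
/-- The extension by zero of a function on finite configurations to all sets of points. -/
def FinConf.liftSet (f : FinConf d → ℝ≥0∞) (s : Set (Space d)) : ℝ≥0∞ :=
  if h : s.Finite then f ⟨⟨s, fun _ _ => h.subset Set.inter_subset_left⟩, h⟩ else 0

theorem FinConf.liftSet_carrier (f : FinConf d → ℝ≥0∞) (γ : FinConf d) :
    FinConf.liftSet f γ.1.carrier = f γ := by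
  rw [FinConf.liftSet, dif_pos γ.2]

theorem FinConf.tupleMeasurable_liftSet {f : FinConf d → ℝ≥0∞} (hf : Measurable f) :
    TupleMeasurable (FinConf.liftSet f) := fun n => by
  have : (fun x : Fin n → Space d => FinConf.liftSet f (Set.range x)) =
      fun x => f (FinConf.ofPoints x) := funext fun x => FinConf.liftSet_carrier f (.ofPoints x)
  rw [this]
  exact hf.comp (measurable_ofPoints n)

theorem ae_pi_restrict_mem {n : ℕ} (μ : Measure (Space d)) [SigmaFinite μ] {S : Set (Space d)}
    (hS : MeasurableSet S) :
    ∀ᵐ x ∂(Measure.pi fun _ : Fin n => μ.restrict S), ∀ i, x i ∈ S := by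
  rw [ae_all_iff]
  intro i
  exact Measure.quasiMeasurePreserving_eval _ i |>.ae (ae_restrict_mem hS)

/-- The points of a Lebesgue-Poisson configuration lie in the support of the intensity. -/
theorem lintegral_lpm_restrict_support (μ : Measure (Space d)) [SigmaFinite μ] {S : Set (Space d)}
    (hS : MeasurableSet S) {f g : FinConf d → ℝ≥0∞} (hf : Measurable f) (hg : Measurable g)
    (h : ∀ γ : FinConf d, γ.1.carrier ⊆ S → f γ = g γ) :
    ∫⁻ γ, f γ ∂lpm (μ.restrict S) = ∫⁻ γ, g γ ∂lpm (μ.restrict S) := by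
  rw [lintegral_lpm _ hf, lintegral_lpm _ hg]
  refine tsum_congr fun n => ?_
  congr 1
  refine lintegral_congr_ae ?_
  filter_upwards [ae_pi_restrict_mem μ hS] with x hx
  exact h _ (Set.range_subset_iff.2 hx)

theorem lpm_univ (μ : Measure (Space d)) [IsFiniteMeasure μ] :
    lpm μ Set.univ = ENNReal.ofReal (Real.exp (μ Set.univ).toReal) := by
  have h := lintegral_lpm μ (measurable_one (α := ℝ≥0∞) (β := FinConf d))
  simp only [Pi.one_apply, lintegral_one, Measure.pi_univ, Finset.prod_const, Finset.card_univ,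
    Fintype.card_fin] at h
  have h2 := NormedSpace.expSeries_div_hasSum_exp ((μ Set.univ).toReal)
  rw [h, Real.exp_eq_exp_ℝ, ← h2.tsum_eq, ENNReal.ofReal_tsum_of_nonneg (fun n => by positivity)
    h2.summable]
  refine tsum_congr fun n => ?_
  rw [ENNReal.ofReal_div_of_pos (by positivity), ENNReal.ofReal_pow ENNReal.toReal_nonneg,
    ENNReal.ofReal_toReal (measure_ne_top _ _), ENNReal.ofReal_natCast, mul_comm, div_eq_mul_inv]

instance (μ : Measure (Space d)) [IsFiniteMeasure μ] : IsFiniteMeasure (lpm μ) :=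
  ⟨by rw [lpm_univ]; exact ENNReal.ofReal_lt_top⟩

theorem le_lintegral_lpm (μ : Measure (Space d)) [SigmaFinite μ] {f : FinConf d → ℝ≥0∞}
    (hf : Measurable f) : f FinConf.empty ≤ ∫⁻ γ, f γ ∂lpm μ := by
  rw [lintegral_lpm _ hf]
  refine le_trans ?_ (ENNReal.le_tsum 0)
  rw [Measure.pi_of_empty _ Fin.elim0, lintegral_dirac]
  have : (FinConf.ofPoints (Fin.elim0 : Fin 0 → Space d)) = FinConf.empty :=
    FinConf.ext_carrier (by simp)
  simp [this]

/-- Independence of the Poisson process in `S` and in its complement. -/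
theorem lintegral_lpm_eq_glue (μ : Measure (Space d)) [IsFiniteMeasure μ] {S : Set (Space d)}
    (hS : MeasurableSet S) {f : FinConf d → ℝ≥0∞} (hf : Measurable f) :
    ∫⁻ γ, f γ ∂lpm μ = ∫⁻ γ, ∫⁻ γ', f (FinConf.glue S γ γ') ∂lpm (μ.restrict Sᶜ)
      ∂lpm (μ.restrict S) := by
  have hfS := FinConf.tupleMeasurable_liftSet hf
  have hglue : Measurable fun p : FinConf d × FinConf d => f (FinConf.glue S p.1 p.2) :=
    hf.comp (FinConf.measurable_glue hS)
  have hL : ∫⁻ γ, f γ ∂lpm μ = ∑' n : ℕ, ∑ kl ∈ Finset.HasAntidiagonal.antidiagonal n,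
      ((kl.1.factorial : ℝ≥0∞))⁻¹ * (((kl.2.factorial : ℝ≥0∞))⁻¹ *
        twoTypeIntegral (μ.restrict S) (μ.restrict Sᶜ) (FinConf.liftSet f) kl.1 kl.2) := by
    rw [lintegral_lpm _ hf]
    refine tsum_congr fun n => ?_
    have h1 : ∫⁻ x, f (FinConf.ofPoints x) ∂(Measure.pi fun _ : Fin n => μ) =
        ∫⁻ x, FinConf.liftSet f (Set.range x)
          ∂(Measure.pi fun _ : Fin n => μ.restrict S + μ.restrict Sᶜ) := by
      rw [Measure.restrict_add_restrict_compl hS]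
      exact lintegral_congr fun x => (FinConf.liftSet_carrier f (.ofPoints x)).symm
    rw [h1, lintegral_pi_add _ _ n hfS, Finset.mul_sum]
    refine Finset.sum_congr rfl fun kl hkl => ?_
    rw [← mul_assoc, ← mul_assoc]
    congr 1
    obtain ⟨k, l⟩ := kl
    have hkl' : k + l = n := Finset.HasAntidiagonal.mem_antidiagonal.1 hkl
    subst hkl'
    have h2 := Nat.add_choose_mul_factorial_mul_factorial k l
    have h3 : ((k + l).choose k : ℝ≥0∞) * (k.factorial * l.factorial) = (k + l).factorial := by
      rw [Nat.choose_symm_add]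
      exact_mod_cast (mul_assoc _ _ _).symm.trans h2
    have hne : ∀ m : ℕ, (m.factorial : ℝ≥0∞) ≠ 0 := fun m => by
      exact_mod_cast m.factorial_ne_zero
    have hnt : ∀ m : ℕ, (m.factorial : ℝ≥0∞) ≠ ⊤ := fun m => ENNReal.natCast_ne_top _
    rw [← ENNReal.mul_inv (Or.inl (hne k)) (Or.inl (hnt k))]
    refine ENNReal.eq_inv_of_mul_eq_one_left ?_
    rw [mul_assoc, h3, ENNReal.inv_mul_cancel (hne _) (hnt _)]
  have hin : ∀ γ, Measurable fun γ' => f (FinConf.glue S γ γ') := fun γ =>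
    hglue.comp measurable_prodMk_left
  have hR : ∫⁻ γ, ∫⁻ γ', f (FinConf.glue S γ γ') ∂lpm (μ.restrict Sᶜ) ∂lpm (μ.restrict S) =
      ∑' k : ℕ, ∑' l : ℕ, ((k.factorial : ℝ≥0∞))⁻¹ * (((l.factorial : ℝ≥0∞))⁻¹ *
        twoTypeIntegral (μ.restrict S) (μ.restrict Sᶜ) (FinConf.liftSet f) k l) := by
    rw [lintegral_lpm _ hglue.lintegral_prod_right']
    refine tsum_congr fun k => ?_
    rw [ENNReal.tsum_mul_left]
    congr 1
    simp_rw [fun γ => lintegral_lpm (μ.restrict Sᶜ) (hin γ)]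
    have hgm : ∀ l, Measurable fun p : (Fin k → Space d) × (Fin l → Space d) =>
        f (FinConf.glue S (.ofPoints p.1) (.ofPoints p.2)) := fun l =>
      hglue.comp (((measurable_ofPoints k).comp measurable_fst).prodMk
        ((measurable_ofPoints l).comp measurable_snd))
    rw [lintegral_tsum fun l => ((hgm l).lintegral_prod_right'.const_mul _).aemeasurable]
    refine tsum_congr fun l => ?_
    rw [lintegral_const_mul _ (hgm l).lintegral_prod_right']
    congr 1
    refine lintegral_congr_ae ?_
    filter_upwards [ae_pi_restrict_mem μ hS] with x hx
    refine lintegral_congr_ae ?_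
    filter_upwards [ae_pi_restrict_mem μ hS.compl] with y hy
    have : (FinConf.glue S (.ofPoints x) (.ofPoints y)).1.carrier = Set.range x ∪ Set.range y := by
      rw [FinConf.carrier_glue, FinConf.carrier_ofPoints, FinConf.carrier_ofPoints,
        Set.inter_eq_left.2 (Set.range_subset_iff.2 hx),
        Set.inter_eq_left.2 (Set.range_subset_iff.2 hy)]
    rw [← FinConf.liftSet_carrier f, this]
  rw [hL, hR]
  rw [← ENNReal.tsum_prod (f := fun k l : ℕ => ((k.factorial : ℝ≥0∞))⁻¹ *
    (((l.factorial : ℝ≥0∞))⁻¹ *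
      twoTypeIntegral (μ.restrict S) (μ.restrict Sᶜ) (FinConf.liftSet f) k l)),
    ← (Finset.HasAntidiagonal.sigmaAntidiagonalEquivProd (A := ℕ)).tsum_eq, ENNReal.tsum_sigma']
  refine tsum_congr fun n => ?_
  rw [← Finset.tsum_subtype (Finset.HasAntidiagonal.antidiagonal n) fun kl : ℕ × ℕ => ((kl.1.factorial : ℝ≥0∞))⁻¹ *
    (((kl.2.factorial : ℝ≥0∞))⁻¹ *
      twoTypeIntegral (μ.restrict S) (μ.restrict Sᶜ) (FinConf.liftSet f) kl.1 kl.2)]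
  rfl

theorem lpm_restrict_le (μ : Measure (Space d)) [IsFiniteMeasure μ] {S : Set (Space d)}
    (hS : MeasurableSet S) {A : Set (FinConf d)} (hA : MeasurableSet A) :
    lpm (μ.restrict S) A ≤ lpm μ A := by
  have hg : Measurable fun p : FinConf d × FinConf d =>
      A.indicator (1 : FinConf d → ℝ≥0∞) (FinConf.glue S p.1 p.2) :=
    (measurable_one.indicator hA).comp (FinConf.measurable_glue hS)
  rw [← lintegral_indicator_one hA, ← lintegral_indicator_one hA,
    lintegral_lpm_eq_glue μ hS (measurable_one.indicator hA)]
  calc ∫⁻ γ, A.indicator 1 γ ∂lpm (μ.restrict S)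
      = ∫⁻ γ, A.indicator 1 (FinConf.glue S γ FinConf.empty) ∂lpm (μ.restrict S) := by
        refine lintegral_lpm_restrict_support μ hS (measurable_one.indicator hA)
          (hg.comp measurable_prodMk_right) fun γ hγ => ?_
        congr 1
        exact FinConf.ext_carrier (by simp [Set.inter_eq_left.2 hγ])
    _ ≤ _ := lintegral_mono fun γ => le_lintegral_lpm _ (hg.comp measurable_prodMk_left)

theorem lintegral_lpm_translate (μ : Measure (Space d)) [SigmaFinite μ] (u : Space d)
    {f : FinConf d → ℝ≥0∞} (hf : Measurable f) :
    ∫⁻ γ, f (γ.translate u) ∂lpm μ = ∫⁻ γ, f γ ∂lpm (μ.map fun x => x + u) := by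
  have hu : Measurable fun x : Space d => x + u := measurable_id.add_const u
  have : SigmaFinite (μ.map fun x => x + u) :=
    (MeasurableEquiv.addRight u).sigmaFinite_map
  have hft : Measurable fun γ : FinConf d => f (γ.translate u) :=
    hf.comp (FinConf.measurable_translate u)
  rw [lintegral_lpm _ hft, lintegral_lpm _ hf]
  refine tsum_congr fun n => ?_
  congr 1
  have hmp : MeasurePreserving (fun (x : Fin n → Space d) i => x i + u)
      (Measure.pi fun _ => μ) (Measure.pi fun _ => μ.map fun x => x + u) :=
    measurePreserving_pi _ _ fun _ => ⟨hu, rfl⟩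
  have hfo : Measurable fun x : Fin n → Space d => f (FinConf.ofPoints x) :=
    hf.comp (measurable_ofPoints n)
  rw [← hmp.lintegral_comp hfo]
  refine lintegral_congr fun x => ?_
  congr 1
  exact FinConf.ext_carrier (by
    rw [FinConf.carrier_translate, FinConf.carrier_ofPoints, FinConf.carrier_ofPoints,
      ← Set.range_comp]
    rfl)

end LebesguePoisson

/-! ### Gibbs measures and disjoint cells -/

section GibbsBounds

variable {d : ℕ}

theorem pi_smul_const (c : ℝ≥0) (μ : Measure (Space d)) [IsFiniteMeasure μ] (n : ℕ) :
    (Measure.pi fun _ : Fin n => c • μ) = (c : ℝ≥0∞) ^ n • Measure.pi fun _ : Fin n => μ := by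
  refine Measure.pi_eq (μ := fun _ : Fin n => c • μ) fun s _ => ?_
  rw [Measure.smul_apply, Measure.pi_pi, smul_eq_mul]
  simp only [Measure.smul_apply, ENNReal.smul_def, smul_eq_mul, Finset.prod_mul_distrib,
    Finset.prod_const, Finset.card_univ, Fintype.card_fin]

/-- A weight of at most `cⁿ` on configurations of `n` points is absorbed by multiplying the
intensity by `c`. -/
theorem lintegral_lpm_mul_le (c : ℝ≥0) (μ : Measure (Space d)) [IsFiniteMeasure μ]
    {w f : FinConf d → ℝ≥0∞} (hw : Measurable w) (hf : Measurable f)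
    (hc : ∀ (n : ℕ) (x : Fin n → Space d), w (FinConf.ofPoints x) ≤ (c : ℝ≥0∞) ^ n) :
    ∫⁻ γ, w γ * f γ ∂lpm μ ≤ ∫⁻ γ, f γ ∂lpm (c • μ) := by
  have hwf : Measurable fun γ => w γ * f γ := hw.mul hf
  rw [lintegral_lpm _ hwf, lintegral_lpm _ hf]
  refine ENNReal.tsum_le_tsum fun n => mul_le_mul' le_rfl ?_
  have hfo : Measurable fun x : Fin n → Space d => f (FinConf.ofPoints x) :=
    hf.comp (measurable_ofPoints n)
  rw [pi_smul_const, lintegral_smul_measure, smul_eq_mul, ← lintegral_const_mul _ hfo]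
  exact lintegral_mono fun x => mul_le_mul' (hc n x) le_rfl

/-- By stability the Gibbs weight of `n` points grows at most exponentially in `n`, uniformly in
the volume. -/
theorem exists_gibbsWeight_le (H : EnergyFunction d) (z β : ℝ≥0) :
    ∃ c : ℝ≥0, ∀ (Λ : Set (Space d)) (n : ℕ) (x : Fin n → Space d),
      gibbsWeight H z β Λ (FinConf.ofPoints x) ≤ (c : ℝ≥0∞) ^ n := by
  obtain ⟨A, hA⟩ := H.stable
  set b : ℝ≥0 := ⟨Real.exp (β * |A|), (Real.exp_pos _).le⟩ with hbdef
  refine ⟨max 1 z * b, fun Λ n x => ?_⟩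
  set N := (FinConf.ofPoints x).1.carrier.ncard with hN
  have hNn : N ≤ n := by
    calc N = (x '' Set.univ).ncard := by rw [Set.image_univ]; rfl
      _ ≤ (Set.univ : Set (Fin n)).ncard := Set.ncard_image_le
      _ = n := by simp [Set.ncard_univ]
  have hcN : (FinConf.ofPoints x).1.count Λ ≤ n :=
    (Set.ncard_le_ncard Set.inter_subset_left (FinConf.ofPoints x).2).trans hNn
  have h1 : (z : ℝ≥0∞) ^ (FinConf.ofPoints x).1.count Λ ≤ ((max 1 z : ℝ≥0) : ℝ≥0∞) ^ n := by
    have hz1 : (1 : ℝ≥0) ≤ max 1 z := le_max_left 1 z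
    exact_mod_cast (pow_le_pow_left' (le_max_right 1 z) _).trans (pow_le_pow_right' hz1 hcN)
  have h2 : boltzmann β (H (FinConf.ofPoints x)) ≤ (b : ℝ≥0∞) ^ n := by
    have hle : ((-|A| * n : ℝ) : EReal) ≤ H (FinConf.ofPoints x) := by
      refine le_trans ?_ (hA _)
      rw [EReal.coe_le_coe_iff]
      have h3 : (N : ℝ) ≤ n := by exact_mod_cast hNn
      have h4 : -|A| ≤ A := neg_abs_le A
      have h5 : (0 : ℝ) ≤ N := by positivity
      have h6 : 0 ≤ |A| := abs_nonneg A
      nlinarith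
    have hmono : boltzmann β (H (FinConf.ofPoints x)) ≤ boltzmann β ((-|A| * n : ℝ) : EReal) :=
      EReal.exp_monotone (EReal.neg_le_neg_iff.2
        (mul_le_mul_of_nonneg_left hle (by exact_mod_cast β.2)))
    refine hmono.trans (le_of_eq ?_)
    rw [boltzmann, ← EReal.coe_mul, ← EReal.coe_neg, EReal.exp_coe]
    have hr : -((β : ℝ) * (-|A| * n)) = n * (β * |A|) := by ring
    rw [hr, Real.exp_nat_mul, ENNReal.ofReal_pow (Real.exp_pos _).le]
    congr 1
    exact ENNReal.ofReal_eq_coe_nnreal _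
  calc gibbsWeight H z β Λ (FinConf.ofPoints x)
      ≤ ((max 1 z : ℝ≥0) : ℝ≥0∞) ^ n * (b : ℝ≥0∞) ^ n := mul_le_mul' h1 h2
    _ = ((max 1 z * b : ℝ≥0) : ℝ≥0∞) ^ n := by rw [ENNReal.coe_mul, mul_pow]

theorem energy_ne_bot (H : EnergyFunction d) (γ : FinConf d) : H γ ≠ ⊥ := by
  obtain ⟨A, hA⟩ := H.stable
  exact ((EReal.bot_lt_coe _).trans_le (hA γ)).ne'

theorem boltzmann_ne_zero (β : ℝ≥0) {E : EReal} (h : E ≠ ⊤) (h' : E ≠ ⊥) :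
    boltzmann β E ≠ 0 := by
  rw [boltzmann, Ne, EReal.exp_eq_zero_iff, EReal.neg_eq_bot_iff,
    ← EReal.coe_toReal h h', ← EReal.coe_mul]
  exact EReal.coe_ne_top _

/-- In a measure with normalized density with respect to the Poisson process the factor `e^{-|Λ|}`
cancels. -/
theorem lintegral_normalized_poisson (Λ : Set (Space d)) {w f : FinConf d → ℝ≥0∞}
    (hw : Measurable w) (hf : Measurable f) :
    ∫⁻ γ, f γ ∂((∫⁻ γ, w γ ∂poisson Λ)⁻¹ • (poisson Λ).withDensity w) =
      (∫⁻ γ, w γ ∂lpm (volume.restrict Λ))⁻¹ * ∫⁻ γ, w γ * f γ ∂lpm (volume.restrict Λ) := by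
  have h0 : ENNReal.ofReal (Real.exp (-(volume Λ).toReal)) ≠ 0 := by simp [Real.exp_pos]
  rw [lintegral_smul_measure, lintegral_withDensity_eq_lintegral_mul _ hw hf,
    poisson_eq_smul_lpm, lintegral_smul_measure, lintegral_smul_measure,
    smul_eq_mul, smul_eq_mul, smul_eq_mul,
    ENNReal.mul_inv (Or.inl h0) (Or.inl ENNReal.ofReal_ne_top), mul_comm (ENNReal.ofReal _)⁻¹,
    mul_assoc, ← mul_assoc (ENNReal.ofReal _)⁻¹, ENNReal.inv_mul_cancel h0 ENNReal.ofReal_ne_top,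
    one_mul]
  rfl

theorem lintegral_gibbsMeasure (H : EnergyFunction d) (z β : ℝ≥0) {Λ : Set (Space d)}
    (hb : IsBounded Λ) (hm : MeasurableSet Λ) {f : FinConf d → ℝ≥0∞} (hf : Measurable f) :
    ∫⁻ γ, f γ ∂gibbsMeasure H z β Λ =
      (∫⁻ γ, gibbsWeight H z β Λ γ ∂lpm (volume.restrict Λ))⁻¹ *
        ∫⁻ γ, gibbsWeight H z β Λ γ * f γ ∂lpm (volume.restrict Λ) :=
  lintegral_normalized_poisson Λ (measurable_gibbsWeight H z β hb hm) hf

/-- The finite volume Gibbs measures are dominated, with a constant that does not depend on the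
volume, by Lebesgue-Poisson measures of a fixed intensity. -/
theorem exists_gibbsMeasure_le (H : EnergyFunction d) (z β : ℝ≥0) :
    ∃ (c : ℝ≥0) (C : ℝ≥0∞), C ≠ ⊤ ∧ ∀ Λ : Set (Space d), IsBounded Λ → MeasurableSet Λ →
      ∀ f : FinConf d → ℝ≥0∞, Measurable f →
        ∫⁻ γ, f γ ∂gibbsMeasure H z β Λ ≤ C * ∫⁻ γ, f γ ∂lpm (c • volume.restrict Λ) := by
  obtain ⟨c, hc⟩ := exists_gibbsWeight_le H z β
  refine ⟨c, (boltzmann β (H FinConf.empty))⁻¹, ?_, fun Λ hb hm f hf => ?_⟩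
  · rw [Ne, ENNReal.inv_eq_top]
    exact boltzmann_ne_zero β H.nondegenerate.ne (energy_ne_bot H _)
  have := isFiniteMeasure_volume_restrict hb
  have hw := measurable_gibbsWeight H z β hb hm
  rw [lintegral_gibbsMeasure H z β hb hm hf]
  refine mul_le_mul' (ENNReal.inv_le_inv.2 ?_) (lintegral_lpm_mul_le c _ hw hf (hc Λ))
  -- The partition function is at least the weight of the empty configuration.
  refine le_trans (le_of_eq ?_) (le_lintegral_lpm _ hw)
  simp [gibbsWeight, Config.count]

/-- The product of cell functions `1 + b 1_{A_i}(γ_{Q_i})`, over disjoint cells `Q_i`, integrates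
to at most the product of the cell integrals. -/
theorem lintegral_prod_cells_le {ι : Type*} (s : Finset ι) {Q : ι → Set (Space d)}
    (hQ : ∀ i, MeasurableSet (Q i)) {A : ι → Set (FinConf d)} (hA : ∀ i, MeasurableSet (A i))
    (b a : ℝ≥0∞) :
    ∀ (μ : Measure (Space d)) [IsFiniteMeasure μ],
      (∀ i ∈ s, ∀ j ∈ s, i ≠ j → Disjoint (Q i) (Q j)) →
      (∀ i ∈ s, lpm (μ.restrict (Q i)) (A i) ≤ a) →
      ∫⁻ γ, ∏ i ∈ s, (1 + b * (A i).indicator 1 (γ.restrict (Q i))) ∂lpm μ ≤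
        ENNReal.ofReal (Real.exp (μ Set.univ).toReal) * (1 + b * a) ^ s.card := by
  classical
  have hφ : ∀ i, Measurable fun γ : FinConf d =>
      1 + b * (A i).indicator (1 : FinConf d → ℝ≥0∞) (γ.restrict (Q i)) := fun i =>
    measurable_const.add (((measurable_one.indicator (hA i)).comp
      (FinConf.measurable_restrict (hQ i))).const_mul b)
  induction s using Finset.induction_on with
  | empty =>
    intro μ _ _ _
    simp [lpm_univ]
  | insert j s hj ih =>
    intro μ _ hdisj ha
    have hΦ : Measurable fun γ : FinConf d =>
        ∏ i ∈ s, (1 + b * (A i).indicator (1 : FinConf d → ℝ≥0∞) (γ.restrict (Q i))) :=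
      Finset.measurable_fun_prod s fun i _ => hφ i
    have hφΦ : Measurable fun γ : FinConf d =>
        (1 + b * (A j).indicator (1 : FinConf d → ℝ≥0∞) (γ.restrict (Q j))) *
          ∏ i ∈ s, (1 + b * (A i).indicator (1 : FinConf d → ℝ≥0∞) (γ.restrict (Q i))) :=
      (hφ j).mul hΦ
    simp_rw [Finset.prod_insert hj]
    rw [lintegral_lpm_eq_glue μ (hQ j) hφΦ]
    have hne : ∀ i ∈ s, Disjoint (Q j) (Q i) := fun i hi =>
      hdisj j (Finset.mem_insert_self j s) i (Finset.mem_insert_of_mem hi)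
        (fun h => hj (h ▸ hi))
    have h2 : ∀ i ∈ s, ∀ γ γ' : FinConf d,
        (FinConf.glue (Q j) γ γ').restrict (Q i) = γ'.restrict (Q i) := fun i hi γ γ' =>
      FinConf.ext_carrier (by
        ext x
        have := fun h : x ∈ Q j => Set.disjoint_left.1 (hne i hi) h
        simp only [FinConf.carrier_restrict, FinConf.carrier_glue, Set.mem_inter_iff,
          Set.mem_union, Set.mem_compl_iff]
        tauto)
    have hsplit : ∀ γ γ' : FinConf d,
        (1 + b * (A j).indicator (1 : FinConf d → ℝ≥0∞)
          ((FinConf.glue (Q j) γ γ').restrict (Q j))) *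
          ∏ i ∈ s, (1 + b * (A i).indicator (1 : FinConf d → ℝ≥0∞)
            ((FinConf.glue (Q j) γ γ').restrict (Q i))) =
        (1 + b * (A j).indicator (1 : FinConf d → ℝ≥0∞) (γ.restrict (Q j))) *
          ∏ i ∈ s, (1 + b * (A i).indicator (1 : FinConf d → ℝ≥0∞) (γ'.restrict (Q i))) := by
      intro γ γ'
      rw [FinConf.restrict_glue]
      congr 1
      exact Finset.prod_congr rfl fun i hi => by rw [h2 i hi]
    simp_rw [hsplit, fun γ : FinConf d => lintegral_const_mul
      (μ := lpm (μ.restrict (Q j)ᶜ)) (1 + b * (A j).indicator (1 : FinConf d → ℝ≥0∞)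
        (γ.restrict (Q j))) hΦ]
    rw [lintegral_mul_const _ (hφ j), Finset.card_insert_of_notMem hj, pow_succ]
    have hfirst : ∫⁻ γ, (1 + b * (A j).indicator (1 : FinConf d → ℝ≥0∞) (γ.restrict (Q j)))
        ∂lpm (μ.restrict (Q j)) ≤
        ENNReal.ofReal (Real.exp (μ (Q j)).toReal) * (1 + b * a) := by
      rw [lintegral_lpm_restrict_support μ (hQ j) (hφ j) (g := fun γ => 1 + b * (A j).indicator 1 γ)
        (measurable_const.add ((measurable_one.indicator (hA j)).const_mul b))
        fun γ hγ => by
          have : γ.restrict (Q j) = γ := FinConf.ext_carrier (Set.inter_eq_left.2 hγ)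
          rw [this]]
      rw [lintegral_add_left measurable_const,
        lintegral_const_mul _ (measurable_one.indicator (hA j)), lintegral_indicator_one (hA j),
        lintegral_const, lpm_univ, Measure.restrict_apply_univ, one_mul, mul_add, mul_one]
      refine add_le_add le_rfl ?_
      calc b * lpm (μ.restrict (Q j)) (A j) ≤ 1 * (b * a) := by
            rw [one_mul]; gcongr; exact ha j (Finset.mem_insert_self j s)
        _ ≤ _ := by
            gcongr
            rw [ENNReal.one_le_ofReal]
            exact Real.one_le_exp ENNReal.toReal_nonneg
    have hsecond := ih (μ.restrict (Q j)ᶜ)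
      (fun i hi k hk hik => hdisj i (Finset.mem_insert_of_mem hi) k (Finset.mem_insert_of_mem hk) hik)
      (fun i hi => by
        rw [Measure.restrict_restrict (hQ i),
          Set.inter_eq_left.2 (Set.subset_compl_iff_disjoint_left.2 (hne i hi))]
        exact ha i (Finset.mem_insert_of_mem hi))
    rw [Measure.restrict_apply_univ] at hsecond
    refine (mul_le_mul' hfirst hsecond).trans (le_of_eq ?_)
    have hexp : ENNReal.ofReal (Real.exp (μ Set.univ).toReal) =
        ENNReal.ofReal (Real.exp (μ (Q j)).toReal) *
          ENNReal.ofReal (Real.exp (μ (Q j)ᶜ).toReal) := by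
      rw [← ENNReal.ofReal_mul (Real.exp_pos _).le, ← Real.exp_add,
        ← ENNReal.toReal_add (measure_ne_top _ _) (measure_ne_top _ _), measure_add_measure_compl
        (hQ j)]
    rw [hexp]
    ring

/-- If a probability measure is dominated by a multiple of a Lebesgue-Poisson measure, the expected
number of cells whose trace falls into prescribed events is controlled: this is the exponential
Chebyshev inequality `c N ≤ t + e^{c N - t}` and the independence of the cells. -/
theorem sum_measure_cells_le {ι : Type*} (s : Finset ι) {Q : ι → Set (Space d)}
    (hQ : ∀ i, MeasurableSet (Q i)) {A : ι → Set (FinConf d)} (hA : ∀ i, MeasurableSet (A i))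
    (hdisj : ∀ i ∈ s, ∀ j ∈ s, i ≠ j → Disjoint (Q i) (Q j))
    (μ : Measure (Space d)) [IsFiniteMeasure μ] {a c L : ℝ} (ha0 : 0 ≤ a) (hc : 0 ≤ c)
    (hL : 0 ≤ L)
    (ha : ∀ i ∈ s, lpm (μ.restrict (Q i)) (A i) ≤ ENNReal.ofReal a)
    {P : Measure (FinConf d)} [IsProbabilityMeasure P]
    (hP : ∀ f : FinConf d → ℝ≥0∞, Measurable f →
      ∫⁻ γ, f γ ∂P ≤ ENNReal.ofReal (Real.exp L) * ∫⁻ γ, f γ ∂lpm μ) :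
    ENNReal.ofReal c * ∑ i ∈ s, P {γ | γ.restrict (Q i) ∈ A i} ≤
      ENNReal.ofReal (L + (μ Set.univ).toReal + s.card * ((Real.exp c - 1) * a) + 1) := by
  set b : ℝ := Real.exp c - 1 with hb
  have hb0 : 0 ≤ b := by have := Real.one_le_exp hc; linarith
  set t : ℝ := L + (μ Set.univ).toReal + s.card * (b * a) with ht
  have ht0 : 0 ≤ t := by positivity
  have hAm : ∀ i, MeasurableSet {γ : FinConf d | γ.restrict (Q i) ∈ A i} := fun i =>
    FinConf.measurable_restrict (hQ i) (hA i)
  set F : FinConf d → ℝ≥0∞ := fun γ =>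
    ∏ i ∈ s, (1 + ENNReal.ofReal b * (A i).indicator 1 (γ.restrict (Q i))) with hF
  have hone : ∀ i, Measurable fun γ : FinConf d =>
      (A i).indicator (1 : FinConf d → ℝ≥0∞) (γ.restrict (Q i)) := fun i =>
    (measurable_one.indicator (hA i)).comp (FinConf.measurable_restrict (hQ i))
  have hFm : Measurable F := Finset.measurable_fun_prod s fun i _ =>
    ((hone i).const_mul _).const_add _
  -- Pointwise, `F = e^{c N}` for the number `N` of cells whose trace is in the prescribed event.
  have hpt : ∀ γ : FinConf d, ENNReal.ofReal c *
      ∑ i ∈ s, {γ : FinConf d | γ.restrict (Q i) ∈ A i}.indicator (1 : FinConf d → ℝ≥0∞) γ ≤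
      ENNReal.ofReal t + ENNReal.ofReal (Real.exp (-t)) * F γ := by
    classical
    intro γ
    set N : ℕ := (s.filter fun i => γ.restrict (Q i) ∈ A i).card with hN
    have h1 : ∑ i ∈ s, {γ : FinConf d | γ.restrict (Q i) ∈ A i}.indicator
        (1 : FinConf d → ℝ≥0∞) γ = N := by
      simp only [Set.indicator_apply, Set.mem_ofPred_eq, Pi.one_apply]
      rw [Finset.sum_boole]
    have h2 : F γ = ENNReal.ofReal (Real.exp (N * c)) := by
      have h3 : ∀ i, (1 + ENNReal.ofReal b * (A i).indicator 1 (γ.restrict (Q i)) : ℝ≥0∞) =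
          if γ.restrict (Q i) ∈ A i then ENNReal.ofReal (Real.exp c) else 1 := by
        intro i
        by_cases h : γ.restrict (Q i) ∈ A i
        · rw [Set.indicator_of_mem h, if_pos h, Pi.one_apply, mul_one, ← ENNReal.ofReal_one,
            ← ENNReal.ofReal_add zero_le_one hb0]
          congr 1
          rw [hb]; ring
        · rw [Set.indicator_of_notMem h, if_neg h, mul_zero, add_zero]
      simp only [hF, h3]
      rw [Finset.prod_ite, Finset.prod_const, Finset.prod_const_one, mul_one,
        ← ENNReal.ofReal_pow (Real.exp_pos _).le, ← Real.exp_nat_mul]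
    rw [h1, h2, ← ENNReal.ofReal_mul (Real.exp_pos _).le, ← Real.exp_add,
      ← ENNReal.ofReal_add ht0 (Real.exp_pos _).le, ← ENNReal.ofReal_natCast,
      ← ENNReal.ofReal_mul hc]
    refine ENNReal.ofReal_le_ofReal ?_
    have := Real.add_one_le_exp (-t + N * c)
    linarith [mul_comm c (N : ℝ)]
  have hint := lintegral_mono (μ := P) hpt
  rw [lintegral_const_mul _ (Finset.measurable_fun_sum s fun i _ => measurable_one.indicator (hAm i)),
    lintegral_finsetSum _ fun i _ => measurable_one.indicator (hAm i),
    lintegral_add_left measurable_const, lintegral_const, measure_univ, mul_one,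
    lintegral_const_mul _ hFm] at hint
  simp_rw [fun i => lintegral_indicator_one (μ := P) (hAm i)] at hint
  refine hint.trans ?_
  rw [ENNReal.ofReal_add ht0 zero_le_one, ENNReal.ofReal_one]
  gcongr
  have hcell := lintegral_prod_cells_le s hQ hA (ENNReal.ofReal b) (ENNReal.ofReal a) μ hdisj ha
  have hpow : (1 + ENNReal.ofReal b * ENNReal.ofReal a) ^ s.card ≤
      ENNReal.ofReal (Real.exp (s.card * (b * a))) := by
    rw [← ENNReal.ofReal_mul hb0, ← ENNReal.ofReal_one,
      ← ENNReal.ofReal_add zero_le_one (by positivity), Real.exp_nat_mul,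
      ENNReal.ofReal_pow (Real.exp_pos _).le]
    gcongr
    linarith [Real.add_one_le_exp (b * a)]
  calc ENNReal.ofReal (Real.exp (-t)) * ∫⁻ γ, F γ ∂P
      ≤ ENNReal.ofReal (Real.exp (-t)) * (ENNReal.ofReal (Real.exp L) *
          (ENNReal.ofReal (Real.exp (μ Set.univ).toReal) *
            ENNReal.ofReal (Real.exp (s.card * (b * a))))) := by
        gcongr
        refine (hP F hFm).trans ?_
        gcongr
        exact hcell.trans (by gcongr)
    _ = 1 := by
        rw [← ENNReal.ofReal_mul (Real.exp_pos _).le, ← ENNReal.ofReal_mul (Real.exp_pos _).le,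
          ← ENNReal.ofReal_mul (Real.exp_pos _).le, ← Real.exp_add, ← Real.exp_add, ← Real.exp_add,
          ← ENNReal.ofReal_one, ht]
        congr 1
        rw [Real.exp_eq_one_iff]
        ring

end GibbsBounds

/-! ### Uniform absolute continuity of the empirical fields -/

section EmpiricalField

variable {d : ℕ}

theorem measurable_finConf_translate :
    Measurable fun p : Space d × FinConf d => p.2.translate p.1 :=
  (measurable_translate.comp
    (measurable_fst.prodMk (measurable_subtype_coe.comp measurable_snd))).subtype_mk

theorem lintegral_empiricalMeasure (H : EnergyFunction d) (z β : ℝ≥0) (n : ℕ)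
    {f : Config d → ℝ≥0∞} (hf : Measurable f) :
    ∫⁻ γ, f γ ∂empiricalMeasure H z β n = (volume (box d n))⁻¹ *
      ∫⁻ u in box d n, ∫⁻ γ, f (γ.translate u).1 ∂gibbsMeasure H z β (box d n) := by
  have := isProbabilityMeasure_gibbsMeasure H z β (isBounded_box d n) (measurableSet_box d n)
  have hmeas : Measurable fun p : Space d × FinConf d => p.2.1.translate p.1 :=
    measurable_translate.comp
      (measurable_fst.prodMk (measurable_subtype_coe.comp measurable_snd))
  rw [empiricalMeasure, lintegral_smul_measure, lintegral_map hf hmeas, smul_eq_mul,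
    lintegral_prod (fun p : Space d × FinConf d => f (p.2.1.translate p.1))
      (hf.comp hmeas).aemeasurable]
  rfl

theorem empiricalMeasure_apply (H : EnergyFunction d) (z β : ℝ≥0) (n : ℕ)
    {T : Set (Config d)} (hT : MeasurableSet T) :
    empiricalMeasure H z β n T = (volume (box d n))⁻¹ *
      ∫⁻ u in box d n, gibbsMeasure H z β (box d n) {γ | (γ.translate u).1 ∈ T} := by
  rw [← lintegral_indicator_one hT, lintegral_empiricalMeasure _ _ _ _ (measurable_one.indicator hT)]
  congr 1
  refine lintegral_congr fun u => ?_
  have : MeasurableSet {γ : FinConf d | (γ.translate u).1 ∈ T} :=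
    measurable_subtype_coe.comp (FinConf.measurable_translate u) hT
  rw [← lintegral_indicator_one this]
  rfl

/-- The point `s k` of the lattice `s ℤ^d`. -/
def latticePoint (s : ℕ) (k : Fin d → ℤ) : Space d := WithLp.toLp 2 fun i => (s : ℝ) * k i

/-- The indices `{-n, …, n}^d`. -/
def latticeIndices (d n : ℕ) : Finset (Fin d → ℤ) :=
  Fintype.piFinset fun _ => Finset.Icc (-(n : ℤ)) n

theorem card_latticeIndices (d n : ℕ) : (latticeIndices d n).card = (2 * n + 1) ^ d := by
  rw [latticeIndices, Fintype.card_piFinset]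
  simp only [Int.card_Icc, Finset.prod_const, Finset.card_univ, Fintype.card_fin]
  congr 1
  omega

/-- Averaging over lattice translates: if the sums of `g` over all translates of a piece of the
lattice are bounded by `B`, so is the mean of `g` over a window, up to a volume factor. Only the
translation invariance of the volume is used. -/
theorem card_mul_setLIntegral_box_le (n s : ℕ) {g : Space d → ℝ≥0∞} (hg : Measurable g) {B : ℝ≥0∞}
    (hB : ∀ u, ∑ k ∈ latticeIndices d n, g (u + latticePoint s k) ≤ B) :
    ((latticeIndices d n).card : ℝ≥0∞) * ∫⁻ u in box d n, g u ≤
      volume (box d (n + s * n)) * B := by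
  set G : Space d → ℝ≥0∞ := (box d n).indicator g with hG
  have hGm : Measurable G := hg.indicator (measurableSet_box d n)
  have h1 : ∀ k : Fin d → ℤ, ∫⁻ u in box d n, g u = ∫⁻ u, G (u + latticePoint s k) := fun k => by
    rw [lintegral_add_right_eq_self, hG, lintegral_indicator (measurableSet_box d n)]
  calc ((latticeIndices d n).card : ℝ≥0∞) * ∫⁻ u in box d n, g u
      = ∑ k ∈ latticeIndices d n, ∫⁻ u, G (u + latticePoint s k) := by
        rw [← nsmul_eq_mul, ← Finset.sum_const]
        exact Finset.sum_congr rfl fun k _ => h1 k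
    _ = ∫⁻ u, ∑ k ∈ latticeIndices d n, G (u + latticePoint s k) := by
        rw [lintegral_finsetSum]
        exact fun k _ => hGm.comp (measurable_id.add_const _)
    _ ≤ ∫⁻ u, (box d (n + s * n)).indicator (fun _ => B) u := by
        refine lintegral_mono fun u => ?_
        by_cases hu : u ∈ box d (n + s * n)
        · rw [Set.indicator_of_mem hu]
          refine le_trans (Finset.sum_le_sum fun k _ => ?_) (hB u)
          exact Set.indicator_le_self (box d n) g (u + latticePoint s k)
        · rw [Set.indicator_of_notMem hu, nonpos_iff_eq_zero]
          refine Finset.sum_eq_zero fun k hk => Set.indicator_of_notMem (fun hmem => hu ?_) _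
          intro i
          have h2 : u i + (s : ℝ) * k i ∈ Set.Icc (-(n : ℝ)) n := hmem i
          have h3 := Finset.mem_Icc.1 (Fintype.mem_piFinset.1 hk i)
          have h4 : -(n : ℝ) ≤ k i := by exact_mod_cast h3.1
          have h5 : (k i : ℝ) ≤ n := by exact_mod_cast h3.2
          have hs : (0 : ℝ) ≤ s := Nat.cast_nonneg s
          have h6 := mul_le_mul_of_nonneg_left h4 hs
          have h7 := mul_le_mul_of_nonneg_left h5 hs
          push_cast
          constructor <;> linarith [h2.1, h2.2]
    _ = volume (box d (n + s * n)) * B := by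
        rw [lintegral_indicator (measurableSet_box _ _), setLIntegral_const, mul_comm]

/-- Each cell `Λₘ - w` is a translate of `Λₘ`, so the Lebesgue-Poisson measure of the translated
event is that of the event in `Λₘ`; intersecting the cell with a window decreases it. -/
theorem lpm_cell_le (c : ℝ≥0) (m : ℕ) (w : Space d) {Λ : Set (Space d)} (hΛ : MeasurableSet Λ)
    {A : Set (FinConf d)} (hA : MeasurableSet A) :
    lpm ((c • (volume : Measure (Space d)).restrict Λ).restrict {x | x + w ∈ box d m})
      {γ | γ.translate w ∈ A} ≤ lpm (c • (volume : Measure (Space d)).restrict (box d m)) A := by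
  have hw : Measurable fun x : Space d => x + w := measurable_id.add_const w
  have hQ : MeasurableSet {x : Space d | x + w ∈ box d m} := hw (measurableSet_box d m)
  have hcell : ((c • (volume : Measure (Space d))).restrict {x | x + w ∈ box d m}).map
      (fun x => x + w) = c • (volume : Measure (Space d)).restrict (box d m) := by
    have := Measure.restrict_map (μ := c • (volume : Measure (Space d))) hw (measurableSet_box d m)
    rw [Measure.map_smul, map_add_right_eq_self, Measure.restrict_smul] at this
    exact this.symm
  have hfin : IsFiniteMeasure
      ((c • (volume : Measure (Space d))).restrict {x | x + w ∈ box d m}) := by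
    constructor
    have h1 := congrArg (fun μ : Measure (Space d) => μ Set.univ) hcell
    simp only [Measure.map_apply hw MeasurableSet.univ, Set.preimage_univ] at h1
    rw [h1, Measure.smul_apply, Measure.restrict_apply_univ, ENNReal.smul_def, smul_eq_mul]
    exact ENNReal.mul_lt_top ENNReal.coe_lt_top (isBounded_box d m).measure_lt_top
  have hA' : MeasurableSet {γ : FinConf d | γ.translate w ∈ A} := FinConf.measurable_translate w hA
  rw [← Measure.restrict_smul, Measure.restrict_comm hQ]
  refine (lpm_restrict_le _ hΛ hA').trans (le_of_eq ?_)
  rw [← hcell, ← lintegral_indicator_one hA, ← lintegral_lpm_translate _ w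
    (measurable_one.indicator hA), ← lintegral_indicator_one hA']
  rfl

/-- The traces of the empirical fields in a fixed window are uniformly absolutely continuous with
respect to a Lebesgue-Poisson measure. -/
theorem exists_empiricalMeasure_uniformlyAC (H : EnergyFunction d) (z β : ℝ≥0) :
    ∃ c : ℝ≥0, ∀ (m : ℕ) (ε : ℝ≥0∞), ε ≠ 0 → ∃ δ : ℝ≥0∞, δ ≠ 0 ∧
      ∀ A : Set (FinConf d), MeasurableSet A →
        lpm (c • (volume : Measure (Space d)).restrict (box d m)) A ≤ δ →
        ∀ n : ℕ, 1 ≤ n → empiricalMeasure H z β n (Config.inBox m ⁻¹' A) ≤ ε := by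
  obtain ⟨c, C, hC, hdom⟩ := exists_gibbsMeasure_le H z β
  refine ⟨c, fun m ε hε => ?_⟩
  obtain ⟨e, he0, heε⟩ : ∃ e : ℝ, 0 < e ∧ ENNReal.ofReal e ≤ ε := by
    by_cases ht : ε = ⊤
    · exact ⟨1, one_pos, by simp [ht]⟩
    · exact ⟨ε.toReal, ENNReal.toReal_pos hε ht, by rw [ENNReal.ofReal_toReal ht]⟩
  -- Translates of `Λₘ` by vectors of a lattice of spacing `2m + 1` are disjoint.
  set s : ℕ := 2 * m + 1 with hs
  set L : ℝ := C.toReal with hL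
  have hL0 : 0 ≤ L := ENNReal.toReal_nonneg
  set p : ℝ := (1 + s : ℝ) ^ d * (L + c + 2) / e with hp
  have hp0 : 0 < p := by positivity
  -- With `δ = e^{-p}` a cell contributes at most `(e^p - 1) δ ≤ 1` to the bound on `p` times the
  -- expected number of bad cells; `p` is so large that the mean fraction of bad cells is at most `e`.
  refine ⟨ENNReal.ofReal (Real.exp (-p)), by simp [Real.exp_pos], fun A hA hAδ n hn => ?_⟩
  set Λ := box d n with hΛ
  set P := gibbsMeasure H z β Λ with hP
  have hprob : IsProbabilityMeasure P :=
    isProbabilityMeasure_gibbsMeasure H z β (isBounded_box d n) (measurableSet_box d n)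
  have hvol : volume Λ = ENNReal.ofReal ((2 * n : ℝ) ^ d) := volume_box d n
  have hfinΛ := isFiniteMeasure_volume_restrict (isBounded_box d n)
  set k : ℕ := (latticeIndices d n).card with hk
  have hk' : (k : ℝ) = (2 * n + 1 : ℝ) ^ d := by
    rw [hk, card_latticeIndices]; push_cast; ring
  have hk1 : (1 : ℝ) ≤ k := by
    rw [hk']
    refine one_le_pow₀ ?_
    have : (0 : ℝ) ≤ n := Nat.cast_nonneg n
    linarith
  have hvk : ((2 * n : ℝ) ^ d) ≤ k := by
    rw [hk']
    gcongr
    linarith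
  have hT : MeasurableSet (Config.inBox m ⁻¹' A) := Config.measurable_inBox m hA
  set g : Space d → ℝ≥0∞ := fun u => P {γ | (γ.translate u).1 ∈ Config.inBox m ⁻¹' A} with hg
  have hgm : Measurable g := by
    have hS : MeasurableSet {q : Space d × FinConf d | (q.2.translate q.1).1 ∈
        Config.inBox m ⁻¹' A} :=
      measurable_subtype_coe.comp measurable_finConf_translate hT
    exact measurable_measure_prodMk_left hS
  have hdomL : ∀ f : FinConf d → ℝ≥0∞, Measurable f → ∫⁻ γ, f γ ∂P ≤
      ENNReal.ofReal (Real.exp L) * ∫⁻ γ, f γ ∂lpm (c • volume.restrict Λ) := fun f hf => by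
    refine (hdom Λ (isBounded_box d n) (measurableSet_box d n) f hf).trans ?_
    gcongr
    rw [← ENNReal.ofReal_toReal hC]
    exact ENNReal.ofReal_le_ofReal (by linarith [Real.add_one_le_exp L])
  have hsum : ∀ u, ∑ j ∈ latticeIndices d n, g (u + latticePoint s j) ≤
      ENNReal.ofReal (k * (L + c + 2) / p) := by
    intro u
    have hcells := sum_measure_cells_le (latticeIndices d n)
      (Q := fun j => {x : Space d | x + (u + latticePoint s j) ∈ box d m})
      (fun j => (measurable_id.add_const _ : Measurable fun x : Space d => x + _)
        (measurableSet_box d m))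
      (A := fun j => {γ : FinConf d | γ.translate (u + latticePoint s j) ∈ A})
      (fun j => FinConf.measurable_translate _ hA) ?_ (c • volume.restrict Λ)
      (Real.exp_pos (-p)).le hp0.le hL0
      (fun j _ => (lpm_cell_le c m _ (measurableSet_box d n) hA).trans hAδ) hdomL
    · have hset : ∀ j, {γ : FinConf d | γ.restrict {x | x + (u + latticePoint s j) ∈ box d m} ∈
          {γ : FinConf d | γ.translate (u + latticePoint s j) ∈ A}} =
          {γ | (γ.translate (u + latticePoint s j)).1 ∈ Config.inBox m ⁻¹' A} := by
        intro j
        ext γ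
        have : (γ.restrict {x | x + (u + latticePoint s j) ∈ box d m}).translate
            (u + latticePoint s j) = (γ.translate (u + latticePoint s j)).1.inBox m := by
          refine FinConf.ext_carrier ?_
          ext y
          simp only [FinConf.carrier_translate, FinConf.carrier_restrict,
            Config.carrier_finRestrict, Set.mem_image, Set.mem_inter_iff, Set.mem_ofPred_eq]
          constructor
          · rintro ⟨x, ⟨hx, hx'⟩, rfl⟩
            exact ⟨⟨x, hx, rfl⟩, hx'⟩
          · rintro ⟨⟨x, hx, rfl⟩, hx'⟩
            exact ⟨x, ⟨hx, hx'⟩, rfl⟩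
        simp only [Set.mem_ofPred_eq, this, Set.mem_preimage]
      simp_rw [hset] at hcells
      have hμ : ((c • (volume : Measure (Space d)).restrict Λ) Set.univ).toReal =
          c * (2 * n : ℝ) ^ d := by
        rw [Measure.smul_apply, Measure.restrict_apply_univ, ENNReal.smul_def, smul_eq_mul, hvol,
          ENNReal.toReal_mul, ENNReal.toReal_ofReal (by positivity), ENNReal.coe_toReal]
      rw [hμ] at hcells
      have hreal : L + c * (2 * n : ℝ) ^ d + k * ((Real.exp p - 1) * Real.exp (-p)) + 1 ≤
          k * (L + c + 2) := by
        have h1 : (Real.exp p - 1) * Real.exp (-p) ≤ 1 := by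
          rw [sub_mul, ← Real.exp_add, add_neg_cancel, Real.exp_zero]
          linarith [Real.exp_pos (-p)]
        have h2 : (c : ℝ) * (2 * n : ℝ) ^ d ≤ c * k := by gcongr
        have h3 : (k : ℝ) * ((Real.exp p - 1) * Real.exp (-p)) ≤ k * 1 := by gcongr
        have h4 : L * 1 ≤ L * k := by gcongr
        linarith
      rw [ENNReal.ofReal_div_of_pos hp0, ENNReal.le_div_iff_mul_le (Or.inl (by simpa using hp0))
        (Or.inl ENNReal.ofReal_ne_top), mul_comm]
      exact hcells.trans (ENNReal.ofReal_le_ofReal hreal)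
    · intro i _ j _ hij
      refine Set.disjoint_left.2 fun x hx hx' => hij ?_
      funext l
      have h1 : x l + (u l + (s : ℝ) * i l) ∈ Set.Icc (-(m : ℝ)) m := hx l
      have h2 : x l + (u l + (s : ℝ) * j l) ∈ Set.Icc (-(m : ℝ)) m := hx' l
      have hs' : (s : ℝ) = 2 * m + 1 := by rw [hs]; push_cast; ring
      have hm0 : (0 : ℝ) ≤ m := Nat.cast_nonneg m
      by_contra hne
      rcases lt_or_gt_of_ne hne with h | h
      · have h3 : (i l : ℝ) + 1 ≤ j l := by exact_mod_cast h
        have := mul_le_mul_of_nonneg_left h3 (by rw [hs']; positivity : (0 : ℝ) ≤ s)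
        rw [mul_add, mul_one] at this
        linarith [h1.1, h2.2]
      · have h3 : (j l : ℝ) + 1 ≤ i l := by exact_mod_cast h
        have := mul_le_mul_of_nonneg_left h3 (by rw [hs']; positivity : (0 : ℝ) ≤ s)
        rw [mul_add, mul_one] at this
        linarith [h1.2, h2.1]
  have hav := card_mul_setLIntegral_box_le n s hgm hsum
  rw [empiricalMeasure_apply H z β n hT]
  refine le_trans ?_ heε
  have hn0 : (0 : ℝ) < (2 * n : ℝ) ^ d := by
    have : (1 : ℝ) ≤ n := by exact_mod_cast hn
    positivity
  have hkpos : (0 : ℝ) < k := by linarith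
  have hvol2 : volume (box d (n + s * n)) =
      ENNReal.ofReal ((1 + s : ℝ) ^ d * (2 * n : ℝ) ^ d) := by
    rw [volume_box]
    congr 1
    rw [← mul_pow]
    push_cast
    ring
  have hreal : (1 + s : ℝ) ^ d * (2 * n : ℝ) ^ d * (k * (L + c + 2) / p) =
      k * ((2 * n : ℝ) ^ d * e) := by
    rw [hp]
    field_simp
  rw [hvol2, ← ENNReal.ofReal_mul (by positivity), hreal, ← hk, ← ENNReal.ofReal_natCast k,
    ENNReal.ofReal_mul hkpos.le] at hav
  have hI := (ENNReal.mul_le_mul_iff_right (ENNReal.ofReal_pos.2 hkpos).ne' ENNReal.ofReal_ne_top).1 hav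
  rw [hvol, ENNReal.inv_mul_le_iff (ENNReal.ofReal_pos.2 hn0).ne' ENNReal.ofReal_ne_top,
    ← ENNReal.ofReal_mul hn0.le]
  exact hI

end EmpiricalField

/-! ### Sequential compactness for the local convergence topology -/

section ProjectiveLimit

variable {d : ℕ}

/-- Two finite configurations are told apart by the counting function of a single point. -/
instance : MeasurableSpace.SeparatesPoints (FinConf d) := by
  refine ⟨fun γ γ' h => FinConf.ext_carrier ?_⟩
  have hcount : ∀ (γ : FinConf d) (x : Space d), γ.1.count {x} = 0 ↔ x ∉ γ.1.carrier := by
    intro γ x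
    rw [Config.count, Set.ncard_eq_zero (γ.2.subset Set.inter_subset_left)]
    simp
  have hm : ∀ x : Space d, Measurable fun γ : FinConf d => γ.1.count {x} := fun x =>
    (measurable_count isBounded_singleton (measurableSet_singleton x)).comp
      measurable_subtype_coe
  ext x
  constructor
  · intro hx
    have := h _ (hm x (measurableSet_singleton 0)).compl
    simp only [Set.mem_compl_iff, Set.mem_preimage, Set.mem_singleton_iff, hcount, not_not] at this
    exact this hx
  · intro hx
    by_contra hx'
    have := h _ (hm x (measurableSet_singleton 0))
    simp only [Set.mem_preimage, Set.mem_singleton_iff, hcount] at this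
    exact this hx' hx

instance : MeasurableEq (FinConf d) := by
  obtain ⟨f, hf, hinj⟩ :=
    MeasurableSpace.measurable_injection_nat_bool_of_countablySeparated (FinConf d)
  refine ⟨?_⟩
  have := measurableSet_eq_fun (hf.comp measurable_fst) (hf.comp (measurable_snd (α := FinConf d)))
  convert this using 1
  ext p
  exact hinj.eq_iff.symm

theorem measurable_of_measurable_natCast_ennreal {α : Type*} [MeasurableSpace α] {f : α → ℕ}
    (h : Measurable fun a => (f a : ℝ≥0∞)) : Measurable f := by
  refine measurable_to_countable' fun j => ?_
  have : f ⁻¹' {j} = (fun a => (f a : ℝ≥0∞)) ⁻¹' {(j : ℝ≥0∞)} := by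
    ext a
    simp
  rw [this]
  exact h (measurableSet_singleton _)

/-- The configuration that consists of the points of `xₖ` in the shell `Λₖ \ (Λ₀ ∪ … ∪ Λₖ₋₁)`,
for all `k`. If the `xₖ` are the traces in the windows `Λₖ` of one configuration, it is that
configuration. -/
def assemble (x : ℕ → FinConf d) : Config d where
  carrier := ⋃ k, (x k).1.carrier ∩ disjointed (box d) k
  finite_inter Λ hΛ := by
    obtain ⟨m, hm⟩ := exists_subset_box hΛ
    refine ((Set.finite_Iic m).biUnion fun k _ => (x k).2).subset ?_
    rintro y ⟨hy, hyΛ⟩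
    obtain ⟨k, hk, hyk⟩ := Set.mem_iUnion.1 hy
    refine Set.mem_biUnion (x := k) ?_ hk
    by_contra hkm
    have : y ∈ disjointed (box d) m ∨ ∃ j < m, y ∈ box d j := by
      by_cases h : ∃ j < m, y ∈ box d j
      · exact Or.inr h
      · refine Or.inl ?_
        rw [disjointed_eq_inter_compl]
        refine ⟨hm hyΛ, Set.mem_iInter₂.2 fun j hj hy' => h ⟨j, hj, hy'⟩⟩
    rw [disjointed_eq_inter_compl] at hyk
    exact Set.mem_iInter₂.1 hyk.2 m (not_le.1 hkm) (hm hyΛ)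

theorem disjointed_box_inter {m k : ℕ} (h : m < k) : disjointed (box d) k ∩ box d m = ∅ := by
  rw [disjointed_eq_inter_compl]
  exact Set.eq_empty_of_forall_notMem fun y hy => Set.mem_iInter₂.1 hy.1.2 m h hy.2

theorem measurable_assemble : Measurable (assemble (d := d)) := by
  refine measurable_config fun Λ hb hm => measurable_of_measurable_natCast_ennreal ?_
  obtain ⟨m, hΛm⟩ := exists_subset_box hb
  have hD : ∀ k, MeasurableSet (disjointed (box d) k) := fun k =>
    MeasurableSet.disjointed (fun i => measurableSet_box d i) k
  have : (fun x : ℕ → FinConf d => ((assemble x).count Λ : ℝ≥0∞)) = fun x =>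
      ∑' k, ((x k).1.count (disjointed (box d) k ∩ Λ) : ℝ≥0∞) := by
    funext x
    simp_rw [fun k => count_eq_measure (x k).1 (hb.subset (Set.inter_subset_right
      (s := disjointed (box d) k))), count_eq_measure (assemble x) hb]
    rw [← measure_iUnion]
    · congr 1
      rw [assemble, Set.iUnion_inter]
      simp only [Set.inter_assoc]
    · intro i j hij
      refine Set.disjoint_left.2 fun y hy hy' => ?_
      exact Set.disjoint_left.1 (disjoint_disjointed (box d) hij) hy.2.1 hy'.2.1
    · exact fun k => ((x k).1.finite_inter _ (hb.subset Set.inter_subset_right)).measurableSet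
  rw [this]
  refine Measurable.tsum fun k => (measurable_from_top (f := fun n : ℕ => (n : ℝ≥0∞))).comp ?_
  exact (measurable_count (hb.subset Set.inter_subset_right) ((hD k).inter hm)).comp
    (measurable_subtype_coe.comp (measurable_pi_apply k))

theorem inBox_assemble {x : ℕ → FinConf d} (h : ∀ n, x n = (x (n + 1)).restrict (box d n)) (m : ℕ) :
    (assemble x).inBox m = x m := by
  have hle : ∀ j k, x k = (x (k + j + 1)).restrict (box d k) := by
    intro j k
    induction j with
    | zero => exact h k
    | succ j ih =>
      rw [ih]
      refine FinConf.ext_carrier ?_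
      have h1 := congrArg (fun γ : FinConf d => γ.1.carrier) (h (k + j + 1))
      simp only [FinConf.carrier_restrict] at h1 ⊢
      rw [h1, Set.inter_assoc,
        Set.inter_eq_right.2 (box_mono (by omega : k ≤ k + j + 1))]
      rfl
  have hcons : ∀ k m, k ≤ m → (x k).1.carrier = (x m).1.carrier ∩ box d k := by
    intro k m hkm
    rcases hkm.eq_or_lt with rfl | hlt
    · have := congrArg (fun γ : FinConf d => γ.1.carrier) (h k)
      simp only [FinConf.carrier_restrict] at this
      rw [this, Set.inter_assoc, Set.inter_self]
    · obtain ⟨j, rfl⟩ : ∃ j, m = k + j + 1 := ⟨m - k - 1, by omega⟩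
      exact congrArg (fun γ : FinConf d => γ.1.carrier) (hle j k)
  refine FinConf.ext_carrier ?_
  rw [Config.carrier_finRestrict]
  ext y
  constructor
  · rintro ⟨hy, hym⟩
    obtain ⟨k, hyk, hyd⟩ := Set.mem_iUnion.1 hy
    have hkm : k ≤ m := by
      by_contra hkm
      have : y ∈ disjointed (box d) k ∩ box d m := ⟨hyd, hym⟩
      rwa [disjointed_box_inter (not_le.1 hkm)] at this
    rw [hcons k m hkm] at hyk
    exact hyk.1
  · intro hy
    have hym : y ∈ box d m := by rw [hcons m m le_rfl] at hy; exact hy.2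
    refine ⟨?_, hym⟩
    have : y ∈ ⋃ k, disjointed (box d) k := by
      rw [iUnion_disjointed]; exact Set.mem_iUnion.2 ⟨m, hym⟩
    obtain ⟨k, hk⟩ := Set.mem_iUnion.1 this
    have hkm : k ≤ m := by
      by_contra hkm
      have : y ∈ disjointed (box d) k ∩ box d m := ⟨hk, hym⟩
      rwa [disjointed_box_inter (not_le.1 hkm)] at this
    refine Set.mem_iUnion.2 ⟨k, ?_, hk⟩
    rw [hcons k m hkm]
    exact ⟨hy, disjointed_subset (box d) k hk⟩

theorem FinConf.glue_restrict (S : Set (Space d)) (γ : FinConf d) :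
    FinConf.glue S (γ.restrict S) (γ.restrict Sᶜ) = γ :=
  FinConf.ext_carrier (by
    rw [FinConf.carrier_glue, FinConf.carrier_restrict, FinConf.carrier_restrict, Set.inter_assoc,
      Set.inter_assoc, Set.inter_self, Set.inter_self, Set.inter_union_compl])

/-- A law that is absolutely continuous with respect to a Lebesgue-Poisson measure disintegrates
over the trace in a Borel set `S`. -/
theorem exists_kernel_restrict {κ : Measure (Space d)} [IsFiniteMeasure κ] {S : Set (Space d)}
    (hS : MeasurableSet S) {μ : Measure (FinConf d)} [IsProbabilityMeasure μ] (hμ : μ ≪ lpm κ) :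
    ∃ η : Kernel (FinConf d) (FinConf d), IsMarkovKernel η ∧
      μ.map (fun γ => γ.restrict S) ⊗ₘ η = μ.map fun γ => (γ.restrict S, γ) := by
  have hr := FinConf.measurable_restrict hS
  have hrc := FinConf.measurable_restrict hS.compl
  have hpair : Measurable fun γ : FinConf d => (γ.restrict S, γ.restrict Sᶜ) := hr.prodMk hrc
  have hpair' : Measurable fun γ : FinConf d => (γ.restrict S, γ) := hr.prodMk measurable_id
  have hglue := FinConf.measurable_glue hS
  set ρ := μ.map fun γ : FinConf d => (γ.restrict S, γ.restrict Sᶜ) with hρ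
  have hρp : IsProbabilityMeasure ρ := Measure.isProbabilityMeasure_map hpair.aemeasurable
  -- The traces in `S` and `Sᶜ` are independent under the Lebesgue-Poisson measure, so their joint
  -- law under `μ` has a density with respect to a product measure.
  have hac : ρ ≪ (lpm (κ.restrict S)).prod (lpm (κ.restrict Sᶜ)) := by
    refine Measure.AbsolutelyContinuous.mk fun N hN hN0 => ?_
    rw [hρ, Measure.map_apply hpair hN]
    refine hμ ?_
    have hf : Measurable (N.indicator (1 : FinConf d × FinConf d → ℝ≥0∞)) :=
      measurable_one.indicator hN
    rw [← lintegral_indicator_one (hpair hN), lintegral_lpm_eq_glue κ hS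
      (measurable_one.indicator (hpair hN))]
    have hrr : Measurable fun p : FinConf d × FinConf d =>
        N.indicator (1 : FinConf d × FinConf d → ℝ≥0∞) (p.1.restrict S, p.2.restrict Sᶜ) :=
      hf.comp ((hr.comp measurable_fst).prodMk (hrc.comp measurable_snd))
    have h1 : ∀ γ γ' : FinConf d,
        ((fun γ : FinConf d => (γ.restrict S, γ.restrict Sᶜ)) ⁻¹' N).indicator
          (1 : FinConf d → ℝ≥0∞) (FinConf.glue S γ γ') =
        N.indicator (1 : FinConf d × FinConf d → ℝ≥0∞) (γ.restrict S, γ'.restrict Sᶜ) := by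
      intro γ γ'
      rw [← FinConf.restrict_glue S γ γ', ← FinConf.restrict_compl_glue S γ γ']
      rfl
    simp_rw [h1]
    rw [lintegral_lpm_restrict_support κ hS (g := fun γ => ∫⁻ γ', N.indicator 1 (γ, γ')
      ∂lpm (κ.restrict Sᶜ)) hrr.lintegral_prod_right' hf.lintegral_prod_right', ← lintegral_prod _
      hf.aemeasurable, lintegral_indicator_one hN, hN0]
    intro γ hγ
    have e3 : γ.restrict S = γ := FinConf.ext_carrier (Set.inter_eq_left.2 hγ)
    dsimp only
    rw [e3]
    refine lintegral_lpm_restrict_support κ hS.compl (f := fun γ' => N.indicator 1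
      (γ, γ'.restrict Sᶜ)) (g := fun γ' => N.indicator 1 (γ, γ'))
      (hf.comp (measurable_const.prodMk hrc))
      (hf.comp measurable_prodMk_left) fun γ' hγ' => ?_
    have e4 : γ'.restrict Sᶜ = γ' := FinConf.ext_carrier (Set.inter_eq_left.2 hγ')
    rw [e4]
  have : Nonempty (FinConf d) := ⟨FinConf.empty⟩
  obtain ⟨κ', hκ', hκρ⟩ := exists_isMarkovKernel_fst_compProd_eq hac
  have hfst : ρ.fst = μ.map fun γ => γ.restrict S := by
    rw [Measure.fst, hρ, Measure.map_map measurable_fst hpair]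
    rfl
  refine ⟨(Kernel.id ×ₖ κ').map fun p => FinConf.glue S p.1 p.2,
    Kernel.IsMarkovKernel.map _ hglue, ?_⟩
  rw [← hfst]
  ext T hT
  rw [Measure.compProd_apply hT]
  have h2 : ∀ γ, ((Kernel.id ×ₖ κ').map fun p : FinConf d × FinConf d => FinConf.glue S p.1 p.2) γ
      (Prod.mk γ ⁻¹' T) = κ' γ (Prod.mk γ ⁻¹' {p | (p.1, FinConf.glue S p.1 p.2) ∈ T}) := by
    intro γ
    have hm := measurable_prodMk_left hT (x := γ)
    rw [Kernel.map_apply' _ hglue _ hm, Kernel.prod_apply, Kernel.id_apply,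
      Measure.prod_apply (hglue hm), lintegral_dirac' _ (measurable_measure_prodMk_left (hglue hm))]
    rfl
  have hT' : MeasurableSet {p : FinConf d × FinConf d | (p.1, FinConf.glue S p.1 p.2) ∈ T} :=
    measurable_fst.prodMk hglue hT
  simp_rw [h2]
  rw [← Measure.compProd_apply hT', hκρ, hρ, Measure.map_apply hpair hT',
    Measure.map_apply hpair' hT]
  congr 1
  ext γ
  simp only [Set.mem_preimage, Set.mem_ofPred_eq, FinConf.glue_restrict]

/-- Consistent laws of the traces in the windows, absolutely continuous with respect to
Lebesgue-Poisson measures, are the traces of a law on configurations. -/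
theorem exists_projective_limit (c : ℝ≥0) (μ : ℕ → Measure (FinConf d))
    [∀ m, IsProbabilityMeasure (μ m)]
    (hac : ∀ m, μ m ≪ lpm (c • (volume : Measure (Space d)).restrict (box d m)))
    (hcons : ∀ m, (μ (m + 1)).map (fun γ => γ.restrict (box d m)) = μ m) :
    ∃ P : Measure (Config d), IsProbabilityMeasure P ∧ ∀ m, P.map (Config.inBox m) = μ m := by
  have hfin := fun m => isFiniteMeasure_volume_restrict (isBounded_box d m)
  have hker : ∀ m, ∃ η : Kernel (FinConf d) (FinConf d), IsMarkovKernel η ∧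
      μ m ⊗ₘ η = (μ (m + 1)).map fun γ => (γ.restrict (box d m), γ) := fun m => by
    obtain ⟨η, h1, h2⟩ := exists_kernel_restrict (measurableSet_box d m) (hac (m + 1))
    exact ⟨η, h1, by rw [← h2, hcons]⟩
  choose η hη hμη using hker
  have hpair : ∀ m, Measurable fun γ : FinConf d => (γ.restrict (box d m), γ) := fun m =>
    (FinConf.measurable_restrict (measurableSet_box d m)).prodMk measurable_id
  -- The chain whose state at time `m` has the law of the trace in `Λₘ` grows the configuration
  -- window by window.
  obtain ⟨P, hP, hPη⟩ := exists_markovChain μ η fun m => by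
    rw [hμη, Measure.snd, Measure.map_map measurable_snd (hpair m)]
    exact Measure.map_id
  have hae : ∀ᵐ x ∂P, ∀ n, x n = (x (n + 1)).restrict (box d n) := by
    rw [ae_all_iff]
    intro n
    have hm2 : Measurable fun x : ℕ → FinConf d => (x n, x (n + 1)) := by fun_prop
    have hset : MeasurableSet {p : FinConf d × FinConf d | p.1 = p.2.restrict (box d n)} :=
      measurableSet_eq_fun measurable_fst
        ((FinConf.measurable_restrict (measurableSet_box d n)).comp measurable_snd)
    have h1 : ∀ᵐ p ∂(P.map fun x => (x n, x (n + 1))), p.1 = p.2.restrict (box d n) := by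
      rw [hPη, hμη, ae_map_iff (hpair n).aemeasurable hset]
      exact ae_of_all _ fun _ => rfl
    exact ae_of_ae_map hm2.aemeasurable h1
  refine ⟨P.map assemble, Measure.isProbabilityMeasure_map measurable_assemble.aemeasurable,
    fun m => ?_⟩
  rw [Measure.map_map (Config.measurable_inBox m) measurable_assemble]
  have h2 : P.map (Config.inBox m ∘ assemble) = P.map fun x => x m := by
    refine Measure.map_congr ?_
    filter_upwards [hae] with x hx
    exact inBox_assemble hx m
  have h3 := congrArg Measure.fst (hPη m)
  rw [Measure.fst_compProd, Measure.fst, Measure.map_map measurable_fst (by fun_prop)] at h3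
  rw [h2]
  exact h3

/-- Relative sequential compactness: if the traces in all windows are uniformly absolutely
continuous with respect to Lebesgue-Poisson measures, a subsequence converges on all events that
depend on the trace in a window. -/
theorem exists_subseq_tendsto_inBox (c : ℝ≥0) (Q : ℕ → Measure (Config d))
    [∀ n, IsProbabilityMeasure (Q n)]
    (hQ : ∀ m, UniformlyAC (fun n => (Q n).map (Config.inBox m))
      (lpm (c • (volume : Measure (Space d)).restrict (box d m)))) :
    ∃ ψ : ℕ → ℕ, StrictMono ψ ∧ ∃ P : Measure (Config d), IsProbabilityMeasure P ∧
      ∀ m A, MeasurableSet A → Tendsto (fun n => (Q (ψ n)).map (Config.inBox m) A) atTop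
        (𝓝 (P.map (Config.inBox m) A)) := by
  have hfin := fun m => isFiniteMeasure_volume_restrict (isBounded_box d m)
  have hprob : ∀ n m, IsProbabilityMeasure ((Q n).map (Config.inBox m)) := fun n m =>
    Measure.isProbabilityMeasure_map (Config.measurable_inBox m).aemeasurable
  have hsep := fun m => exists_countable_measureDense
    (μ := lpm (c • (volume : Measure (Space d)).restrict (box d m)))
  choose 𝒜 h𝒜c h𝒜 using hsep
  have : ∀ m, Countable (𝒜 m) := fun m => (h𝒜c m).to_subtype
  let F : ℕ → (Σ m, 𝒜 m) → ℝ := fun n i => ((Q n).map (Config.inBox i.1)).real i.2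
  have hF : ∀ n, F n ∈ Set.univ.pi fun _ : Σ m, 𝒜 m => Set.Icc (0 : ℝ) 1 := fun n i _ =>
    ⟨measureReal_nonneg, measureReal_le_one⟩
  -- By compactness of a countable product of intervals one subsequence serves a countable dense
  -- family of events in every window.
  obtain ⟨l, -, ψ, hψ, hl⟩ := (isCompact_univ_pi fun _ => isCompact_Icc).tendsto_subseq hF
  have hlim := fun m => UniformlyAC.exists_setwise_limit
    (Q := fun n => (Q (ψ n)).map (Config.inBox m))
    (fun ε hε => by
      obtain ⟨δ, hδ, h⟩ := hQ m ε hε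
      exact ⟨δ, hδ, fun A hA hAδ n => h A hA hAδ (ψ n)⟩) (h𝒜 m)
    (fun A hA => ⟨l ⟨m, A, hA⟩, (tendsto_pi_nhds.1 hl) ⟨m, A, hA⟩⟩)
  choose μ hμp hμac hμ using hlim
  have hcons : ∀ m, (μ (m + 1)).map (fun γ => γ.restrict (box d m)) = μ m := by
    intro m
    have hr := FinConf.measurable_restrict (measurableSet_box d m)
    ext A hA
    rw [Measure.map_apply hr hA]
    refine tendsto_nhds_unique (hμ (m + 1) _ (hr hA)) ((hμ m A hA).congr fun n => ?_)
    rw [Measure.map_apply (Config.measurable_inBox m) hA,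
      Measure.map_apply (Config.measurable_inBox (m + 1)) (hr hA)]
    congr 1
    ext γ
    have : (γ.inBox (m + 1)).restrict (box d m) = γ.inBox m :=
      Subtype.ext (Config.restrict_inBox (box_mono (Nat.le_succ m)) γ)
    simp only [Set.mem_preimage, this]
  obtain ⟨P, hP, hPμ⟩ := exists_projective_limit c μ hμac hcons
  refine ⟨ψ, hψ, P, hP, fun m A hA => ?_⟩
  rw [hPμ]
  exact hμ m A hA

/-- Local functions depend on the trace in some window. -/
theorem IsBoundedLocal.exists_inBox {f : Config d → ℝ} (hf : IsBoundedLocal f) :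
    ∃ m, ∀ γ : Config d, f γ = f (γ.inBox m).1 := by
  obtain ⟨-, -, Δ, hΔ, hfΔ⟩ := hf
  obtain ⟨m, hm⟩ := exists_subset_box hΔ
  refine ⟨m, fun γ => ?_⟩
  rw [hfΔ γ, hfΔ (γ.inBox m).1, Config.restrict_inBox hm]

theorem tendsto_localTopology_iff {ι : Type*} {l : Filter ι} {u : ι → ProbabilityMeasure (Config d)}
    {P : ProbabilityMeasure (Config d)} :
    Tendsto u l (@nhds _ (localTopology d) P) ↔ ∀ f : Config d → ℝ, IsBoundedLocal f →
      Tendsto (fun i => ∫ γ, f γ ∂(u i : Measure (Config d))) l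
        (𝓝 (∫ γ, f γ ∂(P : Measure (Config d)))) := by
  simp only [nhds_iInf, nhds_induced, tendsto_iInf, tendsto_comap_iff,
    Function.comp_def]

/-- Sequential compactness of the empirical fields in the local convergence topology. -/
theorem exists_subseq_empiricalField (H : EnergyFunction d) (z β : ℝ≥0) (φ : ℕ → ℕ) :
    ∃ ψ : ℕ → ℕ, StrictMono ψ ∧ ∃ P : ProbabilityMeasure (Config d),
      Tendsto (fun k => empiricalField H z β (φ (ψ k))) atTop (@nhds _ (localTopology d) P) := by
  obtain ⟨c, hc⟩ := exists_empiricalMeasure_uniformlyAC H z β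
  obtain ⟨ψ, hψ, P, hP, hconv⟩ := exists_subseq_tendsto_inBox c
    (fun n => (empiricalField H z β (φ n) : Measure (Config d))) (fun m ε hε => by
      obtain ⟨δ, hδ, h⟩ := hc m ε hε
      refine ⟨δ, hδ, fun A hA hAδ n => ?_⟩
      rw [Measure.map_apply (Config.measurable_inBox m) hA]
      exact h A hA hAδ _ (Nat.succ_pos _))
  let P' : ProbabilityMeasure (Config d) := ⟨P, hP⟩
  refine ⟨ψ, hψ, P', tendsto_localTopology_iff.2 fun f hf => ?_⟩
  obtain ⟨m, hm⟩ := hf.exists_inBox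
  obtain ⟨hfm, ⟨C, hC⟩, -⟩ := hf
  have hprob : ∀ n, IsProbabilityMeasure ((empiricalField H z β (φ (ψ n)) :
      Measure (Config d)).map (Config.inBox m)) := fun n =>
    Measure.isProbabilityMeasure_map (Config.measurable_inBox m).aemeasurable
  have hprob' : IsProbabilityMeasure (P.map (Config.inBox m)) :=
    Measure.isProbabilityMeasure_map (Config.measurable_inBox m).aemeasurable
  have hfm' : Measurable fun γ : FinConf d => f γ.1 := hfm.comp measurable_subtype_coe
  have hlim := tendsto_integral_of_tendsto_setwise (hconv m) hfm' fun γ => hC γ.1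
  have hint : ∀ Q : Measure (Config d), ∫ γ, f γ.1 ∂(Q.map (Config.inBox m)) = ∫ γ, f γ ∂Q := by
    intro Q
    rw [integral_map (Config.measurable_inBox m).aemeasurable hfm'.aestronglyMeasurable]
    exact integral_congr_ae (ae_of_all _ fun γ => (hm γ).symm)
  simp only [hint] at hlim
  exact hlim

end ProjectiveLimit

/-! ### Accumulation points and stationarity -/

section Accumulation

variable {d : ℕ}

theorem indicator_one_congr {α β : Type*} {s : Set α} {t : Set β} {x : α} {y : β}
    (h : x ∈ s ↔ y ∈ t) : s.indicator (1 : α → ℝ≥0∞) x = t.indicator 1 y := by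
  by_cases hx : x ∈ s
  · rw [Set.indicator_of_mem hx, Set.indicator_of_mem (h.1 hx), Pi.one_apply, Pi.one_apply]
  · rw [Set.indicator_of_notMem hx, Set.indicator_of_notMem fun hy => hx (h.2 hy)]

/-- The fraction of the volume of a window in a boundary layer of fixed width vanishes. -/
theorem tendsto_boundary_fraction (d r : ℕ) :
    Tendsto (fun n : ℕ => (volume (box d (n + 1)))⁻¹ *
      volume (box d (n + 1) \ box d (n + 1 - r))) atTop (𝓝 0) := by
  have hreal : Tendsto (fun n : ℕ => 1 - (1 - (r : ℝ) / ((n : ℝ) + 1)) ^ d) atTop (𝓝 0) := by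
    have h1 : Tendsto (fun n : ℕ => (r : ℝ) / ((n : ℝ) + 1)) atTop (𝓝 0) := by
      have := (tendsto_one_div_add_atTop_nhds_zero_nat (𝕜 := ℝ)).const_mul (r : ℝ)
      simpa [div_eq_mul_inv] using this
    have h2 := ((h1.const_sub 1).pow d).const_sub 1
    simpa using h2
  have h2 := (ENNReal.continuous_ofReal.tendsto _).comp hreal
  rw [ENNReal.ofReal_zero] at h2
  refine h2.congr' ?_
  filter_upwards [eventually_ge_atTop r] with n hn
  have hn0 : (0 : ℝ) < (2 * ((n : ℝ) + 1)) ^ d := by positivity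
  have hsub : ((n + 1 - r : ℕ) : ℝ) = n + 1 - r := by
    rw [Nat.cast_sub (by omega)]; push_cast; ring
  rw [measure_sdiff (box_mono (Nat.sub_le _ _)) (measurableSet_box _ _).nullMeasurableSet
    (isBounded_box _ _).measure_lt_top.ne, volume_box, volume_box, hsub, Nat.cast_add, Nat.cast_one,
    ← ENNReal.ofReal_sub _ (by
      have : (r : ℝ) ≤ n := by exact_mod_cast hn
      have : (0 : ℝ) ≤ 2 * (n + 1 - r) := by linarith
      positivity), ← ENNReal.ofReal_inv_of_pos hn0, ← ENNReal.ofReal_mul (by positivity),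
    Function.comp_apply]
  congr 1
  rw [mul_sub, inv_mul_cancel₀ hn0.ne', ← inv_pow, ← mul_pow]
  congr 2
  field_simp

/-- An inequality between the means of two functions under the translated Gibbs measures that holds
away from the boundary of the window holds for the empirical field up to a boundary term. -/
theorem lintegral_empiricalMeasure_le (H : EnergyFunction d) (z β : ℝ≥0) (n r : ℕ)
    {f g : Config d → ℝ≥0∞} (hf : Measurable f) (hg : Measurable g) (hf1 : ∀ γ, f γ ≤ 1)
    (h : ∀ u ∈ box d (n - r), ∫⁻ γ, f (γ.translate u).1 ∂gibbsMeasure H z β (box d n) ≤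
      ∫⁻ γ, g (γ.translate u).1 ∂gibbsMeasure H z β (box d n)) :
    ∫⁻ γ, f γ ∂empiricalMeasure H z β n ≤ ∫⁻ γ, g γ ∂empiricalMeasure H z β n +
      (volume (box d n))⁻¹ * volume (box d n \ box d (n - r)) := by
  have hprob := isProbabilityMeasure_gibbsMeasure H z β (isBounded_box d n) (measurableSet_box d n)
  rw [lintegral_empiricalMeasure H z β n hf, lintegral_empiricalMeasure H z β n hg, ← mul_add]
  gcongr
  have hsub : box d (n - r) ⊆ box d n := box_mono (Nat.sub_le n r)
  have hD := measurableSet_box d (n - r)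
  rw [← lintegral_inter_add_sdiff _ (box d n) hD, Set.inter_eq_right.2 hsub]
  refine add_le_add ?_ ?_
  · refine le_trans ?_ (lintegral_mono_set hsub)
    exact setLIntegral_mono' hD h
  · refine (lintegral_mono (g := fun _ => 1) fun u => ?_).trans (by simp)
    exact (lintegral_mono fun γ => hf1 _).trans (by simp)

/-- Inequalities between means of local functions pass to the accumulation points of the empirical
fields, where errors that vanish in the limit are allowed. -/
theorem lintegral_le_of_mapClusterPt {u : ℕ → ProbabilityMeasure (Config d)}
    {P : ProbabilityMeasure (Config d)} (hP : @MapClusterPt _ (localTopology d) _ P atTop u)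
    {f g : Config d → ℝ≥0∞} (hf : Measurable f) (hg : Measurable g) (hf1 : ∀ γ, f γ ≤ 1)
    (hg1 : ∀ γ, g γ ≤ 1) {Δ : Set (Space d)} (hΔ : IsBounded Δ)
    (hfΔ : ∀ γ, f γ = f (γ.restrict Δ)) (hgΔ : ∀ γ, g γ = g (γ.restrict Δ))
    {e : ℕ → ℝ≥0∞} (he : Tendsto e atTop (𝓝 0))
    (h : ∀ᶠ n in atTop, ∫⁻ γ, f γ ∂(u n : Measure (Config d)) ≤
      ∫⁻ γ, g γ ∂(u n : Measure (Config d)) + e n) :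
    ∫⁻ γ, f γ ∂(P : Measure (Config d)) ≤ ∫⁻ γ, g γ ∂(P : Measure (Config d)) := by
  have hloc : ∀ f : Config d → ℝ≥0∞, Measurable f → (∀ γ, f γ ≤ 1) →
      (∀ γ, f γ = f (γ.restrict Δ)) → IsBoundedLocal fun γ => (f γ).toReal :=
    fun f hf hf1 hfΔ => ⟨hf.ennreal_toReal, ⟨1, fun γ => by
      rw [abs_of_nonneg ENNReal.toReal_nonneg]
      exact ENNReal.toReal_le_of_le_ofReal zero_le_one (by simpa using hf1 γ)⟩, Δ, hΔ,
      fun γ => congrArg ENNReal.toReal (hfΔ γ)⟩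
  have hfin : ∀ f : Config d → ℝ≥0∞, (∀ γ, f γ ≤ 1) → ∀ Q : ProbabilityMeasure (Config d),
      ∫⁻ γ, f γ ∂(Q : Measure (Config d)) ≠ ⊤ := fun f hf1 Q =>
    ((lintegral_mono hf1).trans_lt (by simp)).ne
  have hint : ∀ f : Config d → ℝ≥0∞, Measurable f → (∀ γ, f γ ≤ 1) →
      ∀ Q : ProbabilityMeasure (Config d), ∫ γ, (f γ).toReal ∂(Q : Measure (Config d)) =
        (∫⁻ γ, f γ ∂(Q : Measure (Config d))).toReal := fun f hf hf1 Q =>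
    integral_toReal hf.aemeasurable (ae_of_all _ fun γ => (hf1 γ).trans_lt ENNReal.one_lt_top)
  have hcont : ∀ f : Config d → ℝ, IsBoundedLocal f →
      Tendsto (fun Q : ProbabilityMeasure (Config d) => ∫ γ, f γ ∂(Q : Measure (Config d)))
        (@nhds _ (localTopology d) P) (𝓝 (∫ γ, f γ ∂(P : Measure (Config d)))) := fun f hf =>
    tendsto_localTopology_iff.1 tendsto_id f hf
  have hΨ := (hcont _ (hloc f hf hf1 hfΔ)).sub (hcont _ (hloc g hg hg1 hgΔ))
  simp only [hint f hf hf1, hint g hg hg1] at hΨ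
  set y : ℝ := (∫⁻ γ, f γ ∂(P : Measure (Config d))).toReal -
    (∫⁻ γ, g γ ∂(P : Measure (Config d))).toReal with hy
  have hcl : MapClusterPt y atTop fun n => (∫⁻ γ, f γ ∂(u n : Measure (Config d))).toReal -
      (∫⁻ γ, g γ ∂(u n : Measure (Config d))).toReal :=
    let _ := localTopology d
    MapClusterPt.tendsto_comp hΨ hP
  have hy0 : y ≤ 0 := by
    by_contra hpos
    have hpos := not_le.1 hpos
    have h1 := hcl.frequently (Ioi_mem_nhds (half_lt_self hpos))
    have h2 := he.eventually (gt_mem_nhds (ENNReal.ofReal_pos.2 (half_pos hpos)))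
    obtain ⟨n, hn1, hn2, hn⟩ := (h1.and_eventually (h2.and h)).exists
    have h3 := ENNReal.toReal_mono (ENNReal.add_ne_top.2 ⟨hfin g hg1 (u n),
      ENNReal.ofReal_ne_top⟩) (hn.trans (add_le_add le_rfl hn2.le))
    rw [ENNReal.toReal_add (hfin g hg1 (u n)) ENNReal.ofReal_ne_top,
      ENNReal.toReal_ofReal (half_pos hpos).le] at h3
    have h4 : y / 2 < _ := hn1
    linarith
  exact (ENNReal.toReal_le_toReal (hfin f hf1 P) (hfin g hg1 P)).1 (by linarith)

/-- Translating by `v` changes the averaging window by a boundary layer only. -/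
theorem empiricalMeasure_le_translate (H : EnergyFunction d) (z β : ℝ≥0) {n r : ℕ} (hnr : r ≤ n)
    {v : Space d} (hv : ∀ i, |v i| ≤ r) {T : Set (Config d)} (hT : MeasurableSet T) :
    empiricalMeasure H z β n T ≤ empiricalMeasure H z β n {γ | γ.translate v ∈ T} +
      (volume (box d n))⁻¹ * volume (box d n \ box d (n - r)) := by
  have hprob := isProbabilityMeasure_gibbsMeasure H z β (isBounded_box d n) (measurableSet_box d n)
  have hTv : MeasurableSet {γ : Config d | γ.translate v ∈ T} := Config.measurable_translate v hT
  rw [empiricalMeasure_apply H z β n hT, empiricalMeasure_apply H z β n hTv, ← mul_add]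
  gcongr
  set a : Space d → ℝ≥0∞ := fun u => gibbsMeasure H z β (box d n) {γ | (γ.translate u).1 ∈ T}
    with ha
  have ham : Measurable a := by
    have hS : MeasurableSet {q : Space d × FinConf d | (q.2.translate q.1).1 ∈ T} :=
      measurable_subtype_coe.comp measurable_finConf_translate hT
    exact measurable_measure_prodMk_left hS
  have hav : ∀ u, gibbsMeasure H z β (box d n)
      {γ | (γ.translate u).1 ∈ {γ : Config d | γ.translate v ∈ T}} = a (u + v) := by
    intro u
    rw [ha]
    congr 1
    ext γ
    simp only [Set.mem_ofPred_eq]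
    rw [← FinConf.translate_translate]
    rfl
  simp_rw [hav]
  have hsub : box d (n - r) ⊆ box d n := box_mono (Nat.sub_le n r)
  have hD := measurableSet_box d (n - r)
  rw [← lintegral_inter_add_sdiff _ (box d n) hD, Set.inter_eq_right.2 hsub]
  refine add_le_add ?_ ?_
  · have hmp : MeasurePreserving (fun u : Space d => u + v) volume volume :=
      measurePreserving_add_right volume v
    rw [← hmp.setLIntegral_comp_preimage hD ham]
    refine lintegral_mono_set fun u hu i => ?_
    have h1 : u i + v i ∈ Set.Icc (-((n - r : ℕ) : ℝ)) ((n - r : ℕ) : ℝ) := hu i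
    have h2 := abs_le.1 (hv i)
    rw [Nat.cast_sub hnr] at h1
    constructor <;> linarith [h1.1, h1.2, h2.1, h2.2]
  · refine (lintegral_mono (g := fun _ => 1) fun u => ?_).trans (by simp)
    exact prob_le_one

/-- Accumulation points of the empirical fields are stationary. -/
theorem isStationaryLaw_of_mapClusterPt (H : EnergyFunction d) (z β : ℝ≥0)
    {P : ProbabilityMeasure (Config d)}
    (hP : @MapClusterPt _ (localTopology d) _ P atTop fun n => empiricalField H z β n) :
    IsStationaryLaw P := by
  intro v
  have hcoord : ∀ v : Space d, ∀ i, |v i| ≤ (⌈‖v‖⌉₊ : ℝ) := fun v i =>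
    (PiLp.norm_apply_le v i).trans (Nat.le_ceil _)
  have hle : ∀ (v : Space d) (T : Set (Config d)), MeasurableSet T →
      (∃ Δ, IsBounded Δ ∧ (∀ γ : Config d, γ ∈ T ↔ γ.restrict Δ ∈ T) ∧
        ∀ γ : Config d, γ.translate v ∈ T ↔ (γ.restrict Δ).translate v ∈ T) →
      (P : Measure (Config d)) T ≤ (P : Measure (Config d)) {γ | γ.translate v ∈ T} := by
    rintro v T hT ⟨Δ, hΔ, h1, h2⟩
    have hTv : MeasurableSet {γ : Config d | γ.translate v ∈ T} := Config.measurable_translate v hT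
    rw [← lintegral_indicator_one hT, ← lintegral_indicator_one hTv]
    have hind : ∀ (S : Set (Config d)) γ, S.indicator (1 : Config d → ℝ≥0∞) γ ≤ 1 := fun S γ =>
      Set.indicator_le_self S 1 γ
    refine lintegral_le_of_mapClusterPt hP (measurable_one.indicator hT)
      (measurable_one.indicator hTv) (hind _) (hind _) hΔ (fun γ => ?_) (fun γ => ?_)
      (tendsto_boundary_fraction d ⌈‖v‖⌉₊) ?_
    · exact indicator_one_congr (h1 γ)
    · exact indicator_one_congr (h2 γ)
    · filter_upwards [eventually_ge_atTop ⌈‖v‖⌉₊] with n hn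
      rw [lintegral_indicator_one hT, lintegral_indicator_one hTv]
      exact empiricalMeasure_le_translate H z β (hn.trans (Nat.le_succ n)) (hcoord v) hT
  have hcell : ∀ (v : Space d) {Δ : Set (Space d)}, IsBounded Δ →
      IsBounded {x : Space d | x + v ∈ Δ} := by
    intro v Δ hΔ
    have hb : IsBounded ((fun x : Space d => x + -v) '' Δ) :=
      (LipschitzWith.id.add (LipschitzWith.const (-v))).isBounded_image hΔ
    exact hb.subset fun x hx => ⟨x + v, hx, by simp⟩
  have := Measure.isProbabilityMeasure_map (μ := (P : Measure (Config d)))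
    (Config.measurable_translate v).aemeasurable
  refine ext_of_map_inBox fun m A hA => ?_
  set T : Set (Config d) := Config.inBox m ⁻¹' A with hTdef
  have hT : MeasurableSet T := Config.measurable_inBox m hA
  have hTloc : ∀ (γ : Config d) (Δ : Set (Space d)), box d m ⊆ Δ →
      (γ ∈ T ↔ γ.restrict Δ ∈ T) := by
    intro γ Δ hΔ
    have : (γ.restrict Δ).inBox m = γ.inBox m := FinConf.ext_carrier (by
      simp only [Config.carrier_finRestrict, Config.carrier_restrict]
      rw [Set.inter_assoc, Set.inter_eq_right.2 hΔ])
    simp only [hTdef, Set.mem_preimage, this]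
  have hTloc' : ∀ (γ : Config d) (Δ : Set (Space d)), {x | x + v ∈ box d m} ⊆ Δ →
      (γ.translate v ∈ T ↔ (γ.restrict Δ).translate v ∈ T) := by
    intro γ Δ hΔ
    have : ((γ.restrict Δ).translate v).inBox m = (γ.translate v).inBox m := FinConf.ext_carrier (by
      ext y
      simp only [Config.carrier_finRestrict, Config.carrier_restrict, Config.carrier_translate,
        Set.mem_inter_iff, Set.mem_image]
      constructor
      · rintro ⟨⟨x, hx, rfl⟩, hy⟩
        exact ⟨⟨x, hx.1, rfl⟩, hy⟩
      · rintro ⟨⟨x, hx, rfl⟩, hy⟩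
        exact ⟨⟨x, ⟨hx, hΔ hy⟩, rfl⟩, hy⟩)
    simp only [hTdef, Set.mem_preimage, this]
  set Δ : Set (Space d) := box d m ∪ {x | x + v ∈ box d m} with hΔdef
  have hΔ : IsBounded Δ := (isBounded_box d m).union (hcell v (isBounded_box d m))
  have hTv : MeasurableSet {γ : Config d | γ.translate v ∈ T} := Config.measurable_translate v hT
  rw [Measure.map_apply (Config.measurable_translate v) hT]
  have h1 := hle v T hT ⟨Δ, hΔ, fun γ => hTloc γ Δ Set.subset_union_left,
    fun γ => hTloc' γ Δ Set.subset_union_right⟩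
  have hback : ∀ γ : Config d, (γ.translate (-v)).translate v = γ := fun γ => by
    rw [Config.translate_translate, neg_add_cancel]
    ext x
    simp
  -- The reverse inequality is the first one for the translate of `T` and the vector `-v`.
  have h2 := hle (-v) {γ | γ.translate v ∈ T} hTv ⟨Δ ∪ {x | x + -v ∈ Δ},
    hΔ.union (hcell (-v) hΔ), fun γ => hTloc' γ _
      (Set.subset_union_right.trans Set.subset_union_left), fun γ => by
      simp only [Set.mem_ofPred_eq, hback]
      exact hTloc γ _ (Set.subset_union_left.trans Set.subset_union_left)⟩
  simp only [Set.mem_ofPred_eq, hback] at h2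
  exact le_antisymm h2 h1

end Accumulation

/-! ### Local energies of finite range -/

section LocalEnergy

variable {d : ℕ}

/-- Any part of a configuration of finite energy has finite energy. -/
theorem EnergyFunction.restrict_lt_top (H : EnergyFunction d) {γ : FinConf d} (h : H γ < ⊤)
    (S : Set (Space d)) : H (γ.restrict S) < ⊤ := by
  -- The points outside `S` are removed one at a time.
  have key : ∀ s : Set (Space d), s.Finite → s ⊆ γ.1.carrier → H (γ.restrict sᶜ) < ⊤ := by
    intro s hs
    refine Set.Finite.induction_on s hs (fun _ => ?_) fun {a s} ha _ ih hsub => ?_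
    · have : γ.restrict ∅ᶜ = γ := FinConf.ext_carrier (by simp)
      rwa [this]
    · have h1 := ih ((Set.subset_insert a s).trans hsub)
      have h2 := H.hereditary (γ.restrict sᶜ) a ⟨hsub (Set.mem_insert a s), ha⟩ h1
      have : (γ.restrict sᶜ).restrict {a}ᶜ = γ.restrict (insert a s)ᶜ := FinConf.ext_carrier (by
        ext x
        simp only [FinConf.carrier_restrict, Set.mem_inter_iff, Set.mem_compl_iff,
          Set.mem_singleton_iff, Set.mem_insert_iff]
        tauto)
      rwa [this] at h2
  have h1 := key (γ.1.carrier \ S) (γ.2.subset Set.sdiff_subset) Set.sdiff_subset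
  have : γ.restrict (γ.1.carrier \ S)ᶜ = γ.restrict S := FinConf.ext_carrier (by
    ext x
    simp only [FinConf.carrier_restrict, Set.mem_inter_iff, Set.mem_compl_iff, Set.mem_sdiff]
    tauto)
  rwa [this] at h1

theorem boltzmann_zero_left (E : EReal) : boltzmann 0 E = 1 := by
  simp [boltzmann]

theorem boltzmann_top {β : ℝ≥0} (hβ : β ≠ 0) : boltzmann β ⊤ = 0 := by
  have : (0 : ℝ) < β := by exact_mod_cast pos_iff_ne_zero.2 hβ
  rw [boltzmann, EReal.coe_mul_top_of_pos this, EReal.neg_top, EReal.exp_bot]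

theorem boltzmann_energyDiff_mul (β : ℝ≥0) {E F : EReal} (hE : E ≠ ⊥) (hF : F ≠ ⊥) (hF' : F ≠ ⊤) :
    boltzmann β E = boltzmann β F * boltzmann β (energyDiff E F) := by
  by_cases hβ : β = 0
  · simp [hβ, boltzmann_zero_left]
  rw [energyDiff, if_neg fun h => hF' h.2]
  lift F to ℝ using ⟨hF', hF⟩
  by_cases hE' : E = ⊤
  · rw [hE', EReal.top_sub_coe, boltzmann_top hβ, mul_zero]
  · lift E to ℝ using ⟨hE', hE⟩
    rw [boltzmann, boltzmann, boltzmann, ← EReal.exp_add]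
    congr 1
    norm_cast
    ring

theorem energyDiff_self {E : EReal} (hE : E ≠ ⊥) : energyDiff E E = 0 := by
  rw [energyDiff]
  split_ifs with h
  · rfl
  · exact EReal.sub_self (fun h' => h ⟨h', h'⟩) hE

theorem measurable_energyDiff : Measurable fun p : EReal × EReal => energyDiff p.1 p.2 := by
  classical
  have h : Measurable fun p : EReal × EReal => if p.1 = ⊤ ∧ p.2 = ⊤ then 0 else p.1 + -p.2 :=
    Measurable.ite ((measurable_fst (measurableSet_singleton ⊤)).inter
      (measurable_snd (measurableSet_singleton ⊤))) measurable_const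
      (measurable_fst.add measurable_snd.neg)
  convert h using 2 with p
  rw [energyDiff]
  congr 1

theorem EnergyFunction.measurable_localEnergy (H : EnergyFunction d) {Δ : Set (Space d)}
    (hΔ : MeasurableSet Δ) : Measurable (H.localEnergy Δ) :=
  measurable_energyDiff.comp
    (H.measurable'.prodMk (H.measurable'.comp (FinConf.measurable_restrict hΔ.compl)))

theorem FinConf.glue_congr (Δ : Set (Space d)) (η : FinConf d) {ξ ξ' : FinConf d}
    (h : ξ.restrict Δᶜ = ξ'.restrict Δᶜ) : FinConf.glue Δ η ξ = FinConf.glue Δ η ξ' :=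
  FinConf.ext_carrier (by
    have := congrArg (fun γ : FinConf d => γ.1.carrier) h
    simp only [FinConf.carrier_restrict] at this
    rw [FinConf.carrier_glue, FinConf.carrier_glue, this])

theorem FinConf.restrict_restrict_comm (γ : FinConf d) (S T : Set (Space d)) :
    (γ.restrict S).restrict T = (γ.restrict T).restrict S :=
  FinConf.ext_carrier (by simp only [FinConf.carrier_restrict, Set.inter_right_comm])

/-- For an allowed exterior configuration the local energy is determined by the points in any set
`D` that contains all points within the range of `Δ`. -/
theorem EnergyFunction.HasFiniteRange.localEnergy_congr {H : EnergyFunction d} {R : ℝ}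
    (hR : H.HasFiniteRange R) {Δ : Set (Space d)} (hΔ : IsBounded Δ) {γ γ' : FinConf d}
    (h : H (γ.restrict Δᶜ) < ⊤) (h' : H (γ'.restrict Δᶜ) < ⊤)
    (heq : γ.restrict (Δ + Metric.closedBall 0 R) = γ'.restrict (Δ + Metric.closedBall 0 R)) :
    H.localEnergy Δ γ = H.localEnergy Δ γ' := by
  rw [hR.2 Δ hΔ γ h, hR.2 Δ hΔ γ' h', heq]

/-- The Boltzmann factor of `η_Δ ∪ ξ_{Δᶜ}` splits into a factor of `ξ_{Δᶜ}` and a factor that sees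
`ξ` only in a bounded set `D`. -/
theorem boltzmann_glue {H : EnergyFunction d} {R : ℝ} (hR : H.HasFiniteRange R) (β : ℝ≥0)
    {Δ D : Set (Space d)} (hΔ : IsBounded Δ) (hD : Δ + Metric.closedBall 0 R ⊆ D)
    (η ξ : FinConf d) :
    boltzmann β (H (FinConf.glue Δ η ξ)) = boltzmann β (H (ξ.restrict Δᶜ)) *
      boltzmann β (H.localEnergy Δ (FinConf.glue Δ η (ξ.restrict D))) := by
  by_cases hβ : β = 0
  · simp [hβ, boltzmann_zero_left]
  by_cases hξ : H (ξ.restrict Δᶜ) = ⊤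
  · have : H (FinConf.glue Δ η ξ) = ⊤ := by
      by_contra hne
      have := H.restrict_lt_top (lt_top_iff_ne_top.2 hne) Δᶜ
      rw [FinConf.restrict_compl_glue, hξ] at this
      exact lt_irrefl _ this
    rw [this, hξ, boltzmann_top hβ, zero_mul]
  · have hξ' := lt_top_iff_ne_top.2 hξ
    have h1 : H ((FinConf.glue Δ η ξ).restrict Δᶜ) < ⊤ := by
      rwa [FinConf.restrict_compl_glue]
    have h2 : H ((FinConf.glue Δ η (ξ.restrict D)).restrict Δᶜ) < ⊤ := by
      rw [FinConf.restrict_compl_glue, FinConf.restrict_restrict_comm]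
      exact H.restrict_lt_top hξ' D
    have h3 := hR.localEnergy_congr hΔ h1 h2 (FinConf.ext_carrier (by
      ext x
      have := @hD x
      simp only [FinConf.carrier_restrict, FinConf.carrier_glue, Set.mem_inter_iff, Set.mem_union,
        Set.mem_compl_iff]
      tauto))
    rw [← h3, EnergyFunction.localEnergy, FinConf.restrict_compl_glue]
    exact boltzmann_energyDiff_mul β (energy_ne_bot H _) (energy_ne_bot H _) hξ

end LocalEnergy

/-! ### The local specification for finite exterior configurations -/

section LocalSpecification

variable {d : ℕ} (H : EnergyFunction d) (z β : ℝ≥0) (Δ : Set (Space d))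

/-- The density `z^{N_Δ(η)} e^{-β H_Δ(η_Δ ∪ ξ_{Δᶜ})}` in the variable `η`, for a finite exterior
configuration `ξ`. In contrast to `dlrWeight`, the configuration is not cut off at the range of the
interaction, which avoids the set `Δ ⊕ B(0,R)`: it need not be Borel. -/
def localWeight (ξ η : FinConf d) : ℝ≥0∞ :=
  (z : ℝ≥0∞) ^ η.1.count Δ * boltzmann β (H.localEnergy Δ (FinConf.glue Δ η ξ))

/-- The normalizing constant of `localWeight`, with respect to the Lebesgue-Poisson measure. -/
def localMass (ξ : FinConf d) : ℝ≥0∞ :=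
  ∫⁻ η, localWeight H z β Δ ξ η ∂lpm ((volume : Measure (Space d)).restrict Δ)

/-- The probability that `η_Δ` lies in `A` under the normalized density `localWeight`. It is zero
where `localMass` is infinite, which Gibbs measures do not charge. -/
def localProb (A : Set (FinConf d)) (ξ : FinConf d) : ℝ≥0∞ :=
  (localMass H z β Δ ξ)⁻¹ * ∫⁻ η, localWeight H z β Δ ξ η *
    A.indicator 1 (η.restrict Δ) ∂lpm ((volume : Measure (Space d)).restrict Δ)

variable {Δ}

theorem measurable_localWeight (hΔb : IsBounded Δ) (hΔ : MeasurableSet Δ) :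
    Measurable fun p : FinConf d × FinConf d => localWeight H z β Δ p.1 p.2 := by
  have h1 : Measurable fun p : FinConf d × FinConf d => (z : ℝ≥0∞) ^ p.2.1.count Δ :=
    (measurable_from_top (f := fun n : ℕ => (z : ℝ≥0∞) ^ n)).comp
      ((measurable_count hΔb hΔ).comp (measurable_subtype_coe.comp measurable_snd))
  exact h1.mul ((measurable_boltzmann β).comp ((H.measurable_localEnergy hΔ).comp
    ((FinConf.measurable_glue hΔ).comp measurable_swap)))

theorem measurable_localWeight_right (hΔb : IsBounded Δ) (hΔ : MeasurableSet Δ) (ξ : FinConf d) :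
    Measurable (localWeight H z β Δ ξ) :=
  Measurable.of_uncurry_left (f := localWeight H z β Δ) (measurable_localWeight H z β hΔb hΔ)

theorem measurable_localWeight_indicator (hΔb : IsBounded Δ) (hΔ : MeasurableSet Δ)
    {A : Set (FinConf d)} (hA : MeasurableSet A) :
    Measurable fun p : FinConf d × FinConf d =>
      localWeight H z β Δ p.1 p.2 * A.indicator 1 (p.2.restrict Δ) :=
  (measurable_localWeight H z β hΔb hΔ).mul ((measurable_one.indicator hA).comp
    ((FinConf.measurable_restrict hΔ).comp measurable_snd))

theorem measurable_localMass (hΔb : IsBounded Δ) (hΔ : MeasurableSet Δ) :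
    Measurable (localMass H z β Δ) := by
  have := isFiniteMeasure_volume_restrict hΔb
  exact (measurable_localWeight H z β hΔb hΔ).lintegral_prod_right'

theorem measurable_localProb (hΔb : IsBounded Δ) (hΔ : MeasurableSet Δ) {A : Set (FinConf d)}
    (hA : MeasurableSet A) : Measurable (localProb H z β Δ A) := by
  have := isFiniteMeasure_volume_restrict hΔb
  exact (measurable_localMass H z β hΔb hΔ).inv.mul
    (measurable_localWeight_indicator H z β hΔb hΔ hA).lintegral_prod_right'

theorem localProb_le_one (A : Set (FinConf d)) (ξ : FinConf d) : localProb H z β Δ A ξ ≤ 1 := by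
  refine le_trans (mul_le_mul' le_rfl (lintegral_mono fun η => ?_)) (ENNReal.inv_mul_le_one _)
  exact mul_le_of_le_one_right zero_le (Set.indicator_le_self A 1 _)

/-- The weight of the empty configuration is one, whatever the exterior configuration. -/
theorem one_le_localMass (hΔb : IsBounded Δ) (hΔ : MeasurableSet Δ) (ξ : FinConf d) :
    1 ≤ localMass H z β Δ ξ := by
  have := isFiniteMeasure_volume_restrict hΔb
  refine le_trans (le_of_eq ?_)
    (le_lintegral_lpm _ (measurable_localWeight_right H z β hΔb hΔ ξ))
  have h0 : (FinConf.empty : FinConf d).1.count Δ = 0 := by simp [Config.count]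
  have h1 : (FinConf.glue Δ FinConf.empty ξ).restrict Δᶜ = FinConf.glue Δ FinConf.empty ξ :=
    FinConf.ext_carrier (by simp [Set.inter_assoc])
  rw [localWeight, h0, pow_zero, one_mul, EnergyFunction.localEnergy, h1,
    energyDiff_self (energy_ne_bot H _), boltzmann]
  simp

theorem localProb_congr (A : Set (FinConf d)) {ξ ξ' : FinConf d}
    (h : ξ.restrict Δᶜ = ξ'.restrict Δᶜ) : localProb H z β Δ A ξ = localProb H z β Δ A ξ' := by
  have : ∀ η, localWeight H z β Δ ξ η = localWeight H z β Δ ξ' η := fun η => by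
    rw [localWeight, localWeight, FinConf.glue_congr Δ η h]
  simp only [localProb, localMass, this]

end LocalSpecification

/-! ### The DLR equations in finite volume -/

section FiniteVolumeDLR

variable {d : ℕ}

theorem lintegral_gibbsWeight_ne_top (H : EnergyFunction d) (z β : ℝ≥0) {Λ : Set (Space d)}
    (hb : IsBounded Λ) (hm : MeasurableSet Λ) :
    ∫⁻ γ, gibbsWeight H z β Λ γ ∂lpm ((volume : Measure (Space d)).restrict Λ) ≠ ⊤ := by
  have := isProbabilityMeasure_gibbsMeasure H z β hb hm
  have h := lintegral_gibbsMeasure H z β hb hm (measurable_one (α := ℝ≥0∞))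
  intro ht
  simp [ht] at h

theorem FinConf.count_glue {Δ Λ : Set (Space d)} (h : Δ ⊆ Λ) (η ξ : FinConf d) :
    (FinConf.glue Δ η ξ).1.count Λ = η.1.count Δ + ξ.1.count (Λ ∩ Δᶜ) := by
  have h1 : (FinConf.glue Δ η ξ).1.carrier ∩ Λ =
      (η.1.carrier ∩ Δ) ∪ (ξ.1.carrier ∩ (Λ ∩ Δᶜ)) := by
    ext x
    have := @h x
    simp only [FinConf.carrier_glue, Set.mem_inter_iff, Set.mem_union, Set.mem_compl_iff]
    tauto
  rw [Config.count, h1, Set.ncard_union_eq _ (η.2.subset Set.inter_subset_left)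
    (ξ.2.subset Set.inter_subset_left)]
  · rfl
  · exact Set.disjoint_left.2 fun x hx hx' => hx'.2.2 hx.2

/-- Finite volume Gibbs measures satisfy the DLR equations: the Gibbs weight in `Λ` factorizes into a
function of the exterior of `Δ` and the local weight, and the Lebesgue-Poisson measure is a product
of its parts in `Δ` and in `Λ \ Δ`. -/
theorem lintegral_gibbsMeasure_localProb {H : EnergyFunction d} {R : ℝ} (hR : H.HasFiniteRange R)
    (z β : ℝ≥0) {Δ D Λ : Set (Space d)} (hΔb : IsBounded Δ) (hΔ : MeasurableSet Δ)
    (hD : MeasurableSet D) (hDR : Δ + Metric.closedBall 0 R ⊆ D) (hΛb : IsBounded Λ)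
    (hΛ : MeasurableSet Λ) (hΔΛ : Δ ⊆ Λ) {A : Set (FinConf d)} (hA : MeasurableSet A)
    {b : FinConf d → ℝ≥0∞} (hb : Measurable b) (hbΔ : ∀ γ, b γ = b (γ.restrict Δᶜ)) :
    ∫⁻ γ, A.indicator 1 (γ.restrict Δ) * b γ ∂gibbsMeasure H z β Λ =
      ∫⁻ γ, localProb H z β Δ A (γ.restrict D) * b γ ∂gibbsMeasure H z β Λ := by
  have hfΔ := isFiniteMeasure_volume_restrict hΔb
  have hfΛ := isFiniteMeasure_volume_restrict hΛb
  have hAm : Measurable fun γ : FinConf d => A.indicator (1 : FinConf d → ℝ≥0∞) (γ.restrict Δ) :=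
    (measurable_one.indicator hA).comp (FinConf.measurable_restrict hΔ)
  have hKm : Measurable fun γ : FinConf d => localProb H z β Δ A (γ.restrict D) :=
    (measurable_localProb H z β hΔb hΔ hA).comp (FinConf.measurable_restrict hD)
  have hwm := measurable_gibbsWeight H z β hΛb hΛ
  -- The Gibbs weight in `Λ` is `m`, a function of the exterior of `Δ`, times the local weight.
  set m : FinConf d → ℝ≥0∞ := fun ξ =>
    (z : ℝ≥0∞) ^ ξ.1.count (Λ ∩ Δᶜ) * boltzmann β (H (ξ.restrict Δᶜ)) with hm
  have hmm : Measurable m := by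
    have h1 : Measurable fun γ : FinConf d => (z : ℝ≥0∞) ^ γ.1.count (Λ ∩ Δᶜ) :=
      (measurable_from_top (f := fun n : ℕ => (z : ℝ≥0∞) ^ n)).comp
        ((measurable_count (hΛb.subset Set.inter_subset_left) (hΛ.inter hΔ.compl)).comp
          measurable_subtype_coe)
    exact h1.mul ((measurable_boltzmann β).comp
      (H.measurable'.comp (FinConf.measurable_restrict hΔ.compl)))
  have hw : ∀ η ξ, gibbsWeight H z β Λ (FinConf.glue Δ η ξ) =
      m ξ * localWeight H z β Δ (ξ.restrict D) η := by
    intro η ξ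
    rw [gibbsWeight, FinConf.count_glue hΔΛ, boltzmann_glue hR β hΔb hDR, hm, localWeight, pow_add]
    ring
  have hlocm : ∀ ξ, Measurable (localWeight H z β Δ ξ) :=
    measurable_localWeight_right H z β hΔb hΔ
  have hsplit : ∀ F : FinConf d → ℝ≥0∞, Measurable F →
      ∫⁻ γ, F γ ∂lpm ((volume : Measure (Space d)).restrict Λ) =
        ∫⁻ ξ, ∫⁻ η, F (FinConf.glue Δ η ξ) ∂lpm ((volume : Measure (Space d)).restrict Δ)
          ∂lpm (((volume : Measure (Space d)).restrict Λ).restrict Δᶜ) := fun F hF => by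
    rw [lintegral_lpm_eq_glue _ hΔ hF, Measure.restrict_restrict hΔ, Set.inter_eq_left.2 hΔΛ]
    exact lintegral_lintegral_swap (hF.comp (FinConf.measurable_glue hΔ)).aemeasurable
  -- The mass of the local density is finite wherever the exterior configuration has weight.
  have hfin : ∀ᵐ ξ ∂lpm (((volume : Measure (Space d)).restrict Λ).restrict Δᶜ),
      m ξ * localMass H z β Δ (ξ.restrict D) < ⊤ := by
    have h := lintegral_gibbsWeight_ne_top H z β hΛb hΛ
    rw [hsplit _ hwm] at h
    simp_rw [hw] at h
    simp_rw [fun ξ => lintegral_const_mul (μ := lpm ((volume : Measure (Space d)).restrict Δ)) (m ξ)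
      (hlocm (ξ.restrict D))] at h
    exact ae_lt_top (hmm.mul ((measurable_localMass H z β hΔb hΔ).comp
      (FinConf.measurable_restrict hD))) h
  have hwA : Measurable fun γ => gibbsWeight H z β Λ γ * (A.indicator 1 (γ.restrict Δ) * b γ) :=
    hwm.mul (hAm.mul hb)
  have hwK : Measurable fun γ =>
      gibbsWeight H z β Λ γ * (localProb H z β Δ A (γ.restrict D) * b γ) := hwm.mul (hKm.mul hb)
  have hAb : Measurable fun γ : FinConf d =>
      A.indicator (1 : FinConf d → ℝ≥0∞) (γ.restrict Δ) * b γ := hAm.mul hb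
  have hKb : Measurable fun γ => localProb H z β Δ A (γ.restrict D) * b γ := hKm.mul hb
  rw [lintegral_gibbsMeasure H z β hΛb hΛ hAb,
    lintegral_gibbsMeasure H z β hΛb hΛ hKb, hsplit _ hwA, hsplit _ hwK]
  congr 1
  refine lintegral_congr_ae ?_
  filter_upwards [hfin] with ξ hξ
  have hbg : ∀ η, b (FinConf.glue Δ η ξ) = b ξ := fun η => by
    rw [hbΔ, FinConf.restrict_compl_glue, ← hbΔ]
  have hKg : ∀ η, localProb H z β Δ A ((FinConf.glue Δ η ξ).restrict D) =
      localProb H z β Δ A (ξ.restrict D) := fun η => localProb_congr H z β A (by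
    rw [FinConf.restrict_restrict_comm, FinConf.restrict_compl_glue,
      FinConf.restrict_restrict_comm])
  simp only [hbg, hKg, hw, FinConf.restrict_glue]
  have hlocA : Measurable fun η =>
      localWeight H z β Δ (ξ.restrict D) η * A.indicator 1 (η.restrict Δ) :=
    (hlocm _).mul hAm
  have e1 : ∀ η, m ξ * localWeight H z β Δ (ξ.restrict D) η *
      (A.indicator 1 (η.restrict Δ) * b ξ) = m ξ * b ξ *
        (localWeight H z β Δ (ξ.restrict D) η * A.indicator 1 (η.restrict Δ)) := fun η => by ring
  have e2 : ∀ η, m ξ * localWeight H z β Δ (ξ.restrict D) η *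
      (localProb H z β Δ A (ξ.restrict D) * b ξ) =
        m ξ * b ξ * localProb H z β Δ A (ξ.restrict D) *
          localWeight H z β Δ (ξ.restrict D) η := fun η => by ring
  simp_rw [e1, e2]
  rw [lintegral_const_mul _ hlocA, lintegral_const_mul _ (hlocm _)]
  change _ = _ * localMass H z β Δ (ξ.restrict D)
  by_cases hm0 : m ξ = 0
  · simp [hm0]
  have hne0 : localMass H z β Δ (ξ.restrict D) ≠ 0 :=
    (one_pos.trans_le (one_le_localMass H z β hΔb hΔ _)).ne'
  have hnet : localMass H z β Δ (ξ.restrict D) ≠ ⊤ := fun ht => by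
    rw [ht, ENNReal.mul_top hm0] at hξ
    exact lt_irrefl _ hξ
  rw [localProb, mul_assoc (m ξ * b ξ), mul_right_comm (localMass H z β Δ (ξ.restrict D))⁻¹,
    ENNReal.inv_mul_cancel hne0 hnet, one_mul]

/-- Translates of Gibbs measures for stationary energies are Gibbs measures in the translated
window. -/
theorem lintegral_gibbsMeasure_translate {H : EnergyFunction d} (hH : H.IsStationary) (z β : ℝ≥0)
    {Λ : Set (Space d)} (hb : IsBounded Λ) (hm : MeasurableSet Λ) (u : Space d)
    {f : FinConf d → ℝ≥0∞} (hf : Measurable f) :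
    IsBounded {x : Space d | x + -u ∈ Λ} ∧ MeasurableSet {x : Space d | x + -u ∈ Λ} ∧
      ∫⁻ γ, f (γ.translate u) ∂gibbsMeasure H z β Λ =
        ∫⁻ γ, f γ ∂gibbsMeasure H z β {x | x + -u ∈ Λ} := by
  have hΛu : MeasurableSet {x : Space d | x + -u ∈ Λ} :=
    (measurable_id.add_const (-u) : Measurable fun x : Space d => x + -u) hm
  have himg : {x : Space d | x + -u ∈ Λ} = (fun x => x + u) '' Λ := by
    ext x
    constructor
    · exact fun hx => ⟨x + -u, hx, by simp⟩
    · rintro ⟨y, hy, rfl⟩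
      simpa using hy
  have hbu : IsBounded {x : Space d | x + -u ∈ Λ} := by
    rw [himg]
    exact (LipschitzWith.id.add (LipschitzWith.const u)).isBounded_image hb
  refine ⟨hbu, hΛu, ?_⟩
  have := isFiniteMeasure_volume_restrict hb
  have hmap : ((volume : Measure (Space d)).restrict Λ).map (fun x => x + u) =
      volume.restrict {x : Space d | x + -u ∈ Λ} := by
    have hu : Measurable fun x : Space d => x + u := measurable_id.add_const u
    have h1 := Measure.restrict_map (μ := (volume : Measure (Space d))) hu hΛu
    rw [map_add_right_eq_self] at h1
    rw [h1]
    congr 2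
    ext x
    simp
  have hw : ∀ γ : FinConf d, gibbsWeight H z β Λ γ =
      gibbsWeight H z β {x : Space d | x + -u ∈ Λ} (γ.translate u) := by
    intro γ
    have hc : (γ.translate u).1.count {x : Space d | x + -u ∈ Λ} = γ.1.count Λ := by
      rw [Config.count, Config.count, himg, FinConf.carrier_translate,
        ← Set.image_inter (add_left_injective u), Set.ncard_image_of_injective _
          (add_left_injective u)]
    rw [gibbsWeight, gibbsWeight, hH, hc]
  have hwm := measurable_gibbsWeight H z β hbu hΛu
  have hwf : Measurable fun γ => gibbsWeight H z β {x : Space d | x + -u ∈ Λ} γ * f γ := hwm.mul hf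
  have hft : Measurable fun γ : FinConf d => f (γ.translate u) :=
    hf.comp (FinConf.measurable_translate u)
  rw [lintegral_gibbsMeasure H z β hb hm hft, lintegral_gibbsMeasure H z β hbu hΛu hf, ← hmap,
    ← lintegral_lpm_translate _ u hwm, ← lintegral_lpm_translate _ u hwf]
  simp_rw [hw]

end FiniteVolumeDLR

/-! ### The DLR equations in infinite volume -/

section DLR

variable {d : ℕ}

/-- Accumulation points of the empirical fields charge no configuration whose trace in a window is
forbidden. -/
theorem measure_energy_inBox_eq_top (H : EnergyFunction d) (hH : H.IsStationary) (z : ℝ≥0)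
    {β : ℝ≥0} (hβ : β ≠ 0) {P : ProbabilityMeasure (Config d)}
    (hP : @MapClusterPt _ (localTopology d) _ P atTop fun n => empiricalField H z β n) (M : ℕ) :
    ∀ᵐ γ ∂(P : Measure (Config d)), H (γ.inBox M) ≠ ⊤ := by
  set T : Set (Config d) := {γ | H (γ.inBox M) = ⊤} with hTdef
  have hT : MeasurableSet T :=
    (H.measurable'.comp (Config.measurable_inBox M)) (measurableSet_singleton ⊤)
  have h0 : (P : Measure (Config d)) T ≤ 0 := by
    rw [← lintegral_indicator_one hT, ← lintegral_zero (μ := (P : Measure (Config d)))]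
    refine lintegral_le_of_mapClusterPt hP (measurable_one.indicator hT) measurable_zero
      (fun γ => Set.indicator_le_self T 1 γ) (fun _ => zero_le) (isBounded_box d M)
      (fun γ => indicator_one_congr ?_) (fun _ => rfl) (tendsto_boundary_fraction d 0) ?_
    · have : (γ.restrict (box d M)).inBox M = γ.inBox M := FinConf.ext_carrier (by
        simp only [Config.carrier_finRestrict, Config.carrier_restrict, Set.inter_assoc,
          Set.inter_self])
      simp only [hTdef, Set.mem_ofPred_eq, this]
    · refine Eventually.of_forall fun n => ?_
      refine lintegral_empiricalMeasure_le H z β (n + 1) 0 (measurable_one.indicator hT)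
        measurable_zero (fun γ => Set.indicator_le_self T 1 γ) fun u _ => ?_
      have hm : Measurable fun γ : FinConf d =>
          T.indicator (1 : Config d → ℝ≥0∞) (γ.translate u).1 :=
        (measurable_one.indicator hT).comp
          (measurable_subtype_coe.comp (FinConf.measurable_translate u))
      rw [lintegral_gibbsMeasure H z β (isBounded_box d _) (measurableSet_box d _) hm]
      refine le_of_eq ?_
      have hz : ∀ γ : FinConf d, gibbsWeight H z β (box d (n + 1)) γ *
          T.indicator (1 : Config d → ℝ≥0∞) (γ.translate u).1 = 0 := by
        intro γ
        by_cases hγ : (γ.translate u).1 ∈ T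
        · have hE : H γ = ⊤ := by
            by_contra hne
            rw [← hH u] at hne
            exact (H.restrict_lt_top (lt_top_iff_ne_top.2 hne) (box d M)).ne hγ
          rw [gibbsWeight, hE, boltzmann_top hβ, mul_zero, zero_mul]
        · rw [Set.indicator_of_notMem hγ, mul_zero]
      simp [hz]
  rw [ae_iff]
  simpa [hTdef] using h0

/-- For an allowed exterior configuration the local specification is determined by the trace of the
configuration in a large window. -/
theorem dlrMeasure_apply {H : EnergyFunction d} {R : ℝ} (hR : H.HasFiniteRange R) (z β : ℝ≥0)
    {Δ : Set (Space d)} (hΔb : IsBounded Δ) (hΔ : MeasurableSet Δ) {M : ℕ}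
    (hM : Δ + Metric.closedBall 0 R ⊆ box d M) {γ : Config d} (hγ : β = 0 ∨ H (γ.inBox M) ≠ ⊤)
    {A : Set (FinConf d)} (hA : MeasurableSet A) :
    dlrMeasure H R z β Δ hΔb γ A = localProb H z β Δ A (γ.inBox M) := by
  have hw : dlrWeight H R z β Δ hΔb γ = localWeight H z β Δ (γ.inBox M) := by
    funext η
    rw [dlrWeight, localWeight]
    congr 1
    rcases hγ with hβ | hγ
    · rw [hβ, boltzmann_zero_left, boltzmann_zero_left]
    congr 1
    have h1 : H ((FinConf.glue Δ η (γ.inBox M)).restrict Δᶜ) < ⊤ := by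
      rw [FinConf.restrict_compl_glue]
      exact H.restrict_lt_top (lt_top_iff_ne_top.2 hγ) _
    rw [hR.2 Δ hΔb _ h1, EnergyFunction.localEnergyExt]
    congr 1
    refine FinConf.ext_carrier ?_
    ext x
    have := @hM x
    simp only [FinConf.carrier_restrict, FinConf.carrier_glue, Config.carrier_finRestrict,
      Config.union, Config.carrier_restrict, Set.mem_inter_iff, Set.mem_union, Set.mem_compl_iff]
    tauto
  have hwm := measurable_localWeight_right H z β hΔb hΔ (γ.inBox M)
  rw [← lintegral_indicator_one hA, dlrMeasure, hw,
    lintegral_normalized_poisson Δ hwm (measurable_one.indicator hA), localProb, localMass]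
  congr 1
  refine lintegral_lpm_restrict_support volume hΔ (hwm.mul (measurable_one.indicator hA))
    (hwm.mul ((measurable_one.indicator hA).comp (FinConf.measurable_restrict hΔ)))
    fun η hη => ?_
  have : η.restrict Δ = η := FinConf.ext_carrier (by
    rw [FinConf.carrier_restrict, Set.inter_eq_left.2 hη])
  simp only [this]

/-- The integrated DLR equations for events of the exterior configuration in a window. -/
theorem lintegral_localProb_eq {H : EnergyFunction d} (hH : H.IsStationary) {R : ℝ}
    (hR : H.HasFiniteRange R) (z β : ℝ≥0) {P : ProbabilityMeasure (Config d)}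
    (hP : @MapClusterPt _ (localTopology d) _ P atTop fun n => empiricalField H z β n)
    {Δ : Set (Space d)} (hΔb : IsBounded Δ) (hΔ : MeasurableSet Δ) {M : ℕ} (hΔM : Δ ⊆ box d M)
    (hM : Δ + Metric.closedBall 0 R ⊆ box d M) {A : Set (FinConf d)} (hA : MeasurableSet A)
    (m : ℕ) {B : Set (FinConf d)} (hB : MeasurableSet B) :
    ∫⁻ γ, A.indicator 1 (γ.finRestrict Δ hΔb) * B.indicator 1 ((γ.restrict Δᶜ).inBox m)
        ∂(P : Measure (Config d)) =
      ∫⁻ γ, localProb H z β Δ A (γ.inBox M) * B.indicator 1 ((γ.restrict Δᶜ).inBox m)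
        ∂(P : Measure (Config d)) := by
  set f : Config d → ℝ≥0∞ := fun γ =>
    A.indicator 1 (γ.finRestrict Δ hΔb) * B.indicator 1 ((γ.restrict Δᶜ).inBox m) with hf
  set g : Config d → ℝ≥0∞ := fun γ =>
    localProb H z β Δ A (γ.inBox M) * B.indicator 1 ((γ.restrict Δᶜ).inBox m) with hg
  have hBm : Measurable fun γ : Config d =>
      B.indicator (1 : FinConf d → ℝ≥0∞) ((γ.restrict Δᶜ).inBox m) :=
    (measurable_one.indicator hB).comp
      ((Config.measurable_inBox m).comp (Config.measurable_restrict hΔ.compl))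
  have hAm : Measurable fun γ : Config d =>
      A.indicator (1 : FinConf d → ℝ≥0∞) (γ.finRestrict Δ hΔb) :=
    (measurable_one.indicator hA).comp (Config.measurable_finRestrict hΔb hΔ)
  have hfm : Measurable f := hAm.mul hBm
  have hgm : Measurable g :=
    ((measurable_localProb H z β hΔb hΔ hA).comp (Config.measurable_inBox M)).mul hBm
  have hind : ∀ (S : Set (FinConf d)) γ, S.indicator (1 : FinConf d → ℝ≥0∞) γ ≤ 1 := fun S γ =>
    Set.indicator_le_self S 1 γ
  have hf1 : ∀ γ, f γ ≤ 1 := fun γ => mul_le_one' (hind _ _) (hind _ _)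
  have hg1 : ∀ γ, g γ ≤ 1 := fun γ => mul_le_one' (localProb_le_one H z β _ _) (hind _ _)
  set Λ : Set (Space d) := box d (max m M) with hΛ
  have hmΛ : box d m ⊆ Λ := box_mono (le_max_left m M)
  have hMΛ : box d M ⊆ Λ := box_mono (le_max_right m M)
  have hloc1 : ∀ γ : Config d, ((γ.restrict Λ).restrict Δᶜ).inBox m = (γ.restrict Δᶜ).inBox m :=
    fun γ => FinConf.ext_carrier (by
      ext x
      have := @hmΛ x
      simp only [Config.carrier_finRestrict, Config.carrier_restrict, Set.mem_inter_iff]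
      tauto)
  have hloc2 : ∀ γ : Config d, (γ.restrict Λ).finRestrict Δ hΔb = γ.finRestrict Δ hΔb :=
    fun γ => FinConf.ext_carrier (by
      ext x
      have h1 := @hMΛ x
      have h2 := @hΔM x
      simp only [Config.carrier_finRestrict, Config.carrier_restrict, Set.mem_inter_iff]
      tauto)
  have hloc3 : ∀ γ : Config d, (γ.restrict Λ).inBox M = γ.inBox M :=
    fun γ => FinConf.ext_carrier (by
      ext x
      have h1 := @hMΛ x
      simp only [Config.carrier_finRestrict, Config.carrier_restrict, Set.mem_inter_iff]
      tauto)
  have hfloc : ∀ γ, f γ = f (γ.restrict Λ) := fun γ => by simp only [hf, hloc1, hloc2]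
  have hgloc : ∀ γ, g γ = g (γ.restrict Λ) := fun γ => by simp only [hg, hloc1, hloc3]
  -- Inside the window the identity is exact: translating the window, it is the DLR equation of a
  -- finite volume Gibbs measure.
  have hwin : ∀ n, M ≤ n → ∀ u ∈ box d (n - M),
      ∫⁻ γ, f (γ.translate u).1 ∂gibbsMeasure H z β (box d n) =
        ∫⁻ γ, g (γ.translate u).1 ∂gibbsMeasure H z β (box d n) := by
    intro n hn u hu
    have hfm' : Measurable fun γ : FinConf d => f γ.1 := hfm.comp measurable_subtype_coe
    have hgm' : Measurable fun γ : FinConf d => g γ.1 := hgm.comp measurable_subtype_coe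
    obtain ⟨hb, hms, hF⟩ := lintegral_gibbsMeasure_translate hH z β (isBounded_box d n)
      (measurableSet_box d n) u hfm'
    obtain ⟨-, -, hG⟩ := lintegral_gibbsMeasure_translate hH z β (isBounded_box d n)
      (measurableSet_box d n) u hgm'
    rw [hF, hG]
    refine lintegral_gibbsMeasure_localProb hR z β hΔb hΔ (measurableSet_box d M) hM hb hms ?_ hA
      (b := fun γ => B.indicator 1 ((γ.1.restrict Δᶜ).inBox m))
      (hBm.comp measurable_subtype_coe) fun γ => ?_
    · intro x hx i
      have h1 := hΔM hx i
      have h2 := hu i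
      rw [Nat.cast_sub hn] at h2
      change x i + -u i ∈ _
      constructor <;> linarith [h1.1, h1.2, h2.1, h2.2]
    · have : ((γ.restrict Δᶜ).1.restrict Δᶜ).inBox m = (γ.1.restrict Δᶜ).inBox m :=
        FinConf.ext_carrier (by
          simp only [Config.carrier_finRestrict, Config.carrier_restrict,
            FinConf.carrier_restrict, Set.inter_assoc, Set.inter_self])
      simp only [this]
  refine le_antisymm ?_ ?_
  · refine lintegral_le_of_mapClusterPt hP hfm hgm hf1 hg1 (isBounded_box d _) hfloc hgloc
      (tendsto_boundary_fraction d M) ?_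
    filter_upwards [eventually_ge_atTop M] with n hn
    exact lintegral_empiricalMeasure_le H z β (n + 1) M hfm hgm hf1 fun u hu =>
      (hwin (n + 1) (hn.trans (Nat.le_succ n)) u hu).le
  · refine lintegral_le_of_mapClusterPt hP hgm hfm hg1 hf1 (isBounded_box d _) hgloc hfloc
      (tendsto_boundary_fraction d M) ?_
    filter_upwards [eventually_ge_atTop M] with n hn
    exact lintegral_empiricalMeasure_le H z β (n + 1) M hgm hfm hg1 fun u hu =>
      (hwin (n + 1) (hn.trans (Nat.le_succ n)) u hu).ge

/-- Accumulation points of the empirical fields satisfy the DLR equations. -/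
theorem satisfiesDLR_of_mapClusterPt {H : EnergyFunction d} (hH : H.IsStationary) {R : ℝ}
    (hR : H.HasFiniteRange R) (z β : ℝ≥0) {P : ProbabilityMeasure (Config d)}
    (hP : @MapClusterPt _ (localTopology d) _ P atTop fun n => empiricalField H z β n) :
    SatisfiesDLR H R z β P := by
  intro Δ hΔb hΔ _ A hA
  obtain ⟨M, hMu⟩ := exists_subset_box
    (hΔb.union (hΔb.add (Metric.isBounded_closedBall (x := (0 : Space d)) (r := R))))
  have hΔM : Δ ⊆ box d M := Set.subset_union_left.trans hMu
  have hM : Δ + Metric.closedBall 0 R ⊆ box d M := Set.subset_union_right.trans hMu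
  set μ : Measure (Config d) := (P : Measure (Config d)) with hμ
  set E : Set (Config d) := {γ | γ.finRestrict Δ hΔb ∈ A} with hE
  have hEm : MeasurableSet E := Config.measurable_finRestrict hΔb hΔ hA
  set k : Config d → ℝ≥0∞ := fun γ => localProb H z β Δ A (γ.inBox M) with hk
  have hkm : Measurable k :=
    (measurable_localProb H z β hΔb hΔ hA).comp (Config.measurable_inBox M)
  have hk1 : ∀ γ, k γ ≤ 1 := fun γ => localProb_le_one H z β A _
  have hres : Measurable fun γ : Config d => γ.restrict Δᶜ := Config.measurable_restrict hΔ.compl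
  have hle : exteriorSigma Δ ≤ (inferInstance : MeasurableSpace (Config d)) :=
    measurable_iff_comap_le.1 hres
  -- The two sides of the integrated DLR equations, as measures in the exterior configuration.
  have hmeas : (μ.restrict E).map (fun γ => γ.restrict Δᶜ) =
      (μ.withDensity k).map fun γ => γ.restrict Δᶜ := by
    refine ext_of_map_inBox fun m B hB => ?_
    have hB' : MeasurableSet (Config.inBox m ⁻¹' B) := Config.measurable_inBox m hB
    have h := lintegral_localProb_eq hH hR z β hP hΔb hΔ hΔM hM hA m hB
    have hBr := hres hB'
    rw [Measure.map_apply hres hB', Measure.map_apply hres hB', Measure.restrict_apply hBr,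
      withDensity_apply _ hBr, ← lintegral_indicator_one (hBr.inter hEm),
      ← lintegral_indicator hBr]
    refine Eq.trans (lintegral_congr fun γ => ?_) (h.trans (lintegral_congr fun γ => ?_))
    · rw [Set.inter_comm, Set.inter_indicator_one]
      rfl
    · by_cases hγ : (γ.restrict Δᶜ).inBox m ∈ B
      · rw [Set.indicator_of_mem hγ, Set.indicator_of_mem (by exact hγ), Pi.one_apply, mul_one]
      · rw [Set.indicator_of_notMem hγ, Set.indicator_of_notMem (by exact hγ), mul_zero]
  -- The local probability depends on the exterior configuration only.
  have hkE : StronglyMeasurable[exteriorSigma Δ] fun γ => (k γ).toReal := by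
    have h1 : (fun γ => (k γ).toReal) = (fun γ => (k γ).toReal) ∘ fun γ => γ.restrict Δᶜ := by
      funext γ
      simp only [Function.comp_apply, hk]
      congr 1
      refine localProb_congr H z β A (FinConf.ext_carrier ?_)
      ext x
      simp only [FinConf.carrier_restrict, Config.carrier_finRestrict, Config.carrier_restrict,
        Set.mem_inter_iff]
      tauto
    rw [h1]
    exact (hkm.ennreal_toReal.comp (comap_measurable _)).stronglyMeasurable
  have hkint : Integrable (fun γ => (k γ).toReal) μ := by
    refine Integrable.of_bound hkm.ennreal_toReal.aestronglyMeasurable 1 (ae_of_all _ fun γ => ?_)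
    rw [Real.norm_of_nonneg ENNReal.toReal_nonneg]
    exact ENNReal.toReal_le_of_le_ofReal zero_le_one (by simpa using hk1 γ)
  have hcond : (fun γ => (k γ).toReal) =ᵐ[μ] μ⟦E | exteriorSigma Δ⟧ := by
    refine ae_eq_condExp_of_forall_setIntegral_eq hle
      ((integrable_const (1 : ℝ)).indicator hEm) (fun s _ _ => hkint.integrableOn) ?_
      hkE.aestronglyMeasurable
    rintro _ ⟨C, hC, rfl⟩ _
    have hCr := hres hC
    have h1 := congrArg (fun ν : Measure (Config d) => ν C) hmeas
    simp only [Measure.map_apply hres hC] at h1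
    rw [Measure.restrict_apply hCr, withDensity_apply _ hCr] at h1
    rw [integral_toReal hkm.aemeasurable (ae_of_all _ fun γ => (hk1 γ).trans_lt ENNReal.one_lt_top),
      ← h1, setIntegral_indicator hEm, setIntegral_const, smul_eq_mul, mul_one, Measure.real]
  refine hcond.symm.trans ?_
  have hallowed : ∀ᵐ γ ∂μ, β = 0 ∨ H (γ.inBox M) ≠ ⊤ := by
    by_cases hβ : β = 0
    · exact ae_of_all _ fun _ => Or.inl hβ
    · exact (measure_energy_inBox_eq_top H hH z hβ hP M).mono fun _ h => Or.inr h
  filter_upwards [hallowed] with γ hγ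
  rw [Measure.real, dlrMeasure_apply hR z β hΔb hΔ hM hγ hA]

end DLR

end GibbsPP

end

/-- Existence of infinite volume Gibbs measures: the sequence of empirical fields is tight for the
local convergence topology (every subsequence has a convergent further subsequence), and each of its
accumulation points is an infinite volume Gibbs measure. -/
theorem mainTheorem1 (d : ℕ) (hd : 1 ≤ d) (H : GibbsPP.EnergyFunction d) (hH : H.IsStationary)
    (R : ℝ) (hR : H.HasFiniteRange R) (z β : ℝ≥0) (hz : 0 < z) :
    (∀ φ : ℕ → ℕ, StrictMono φ → ∃ ψ : ℕ → ℕ, StrictMono ψ ∧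
      ∃ P : ProbabilityMeasure (GibbsPP.Config d),
        Tendsto (fun k => GibbsPP.empiricalField H z β (φ (ψ k))) atTop
          (@nhds _ (GibbsPP.localTopology d) P)) ∧
    ∀ P : ProbabilityMeasure (GibbsPP.Config d),
      @MapClusterPt _ (GibbsPP.localTopology d) _ P atTop
        (fun n => GibbsPP.empiricalField H z β n) →
      GibbsPP.IsInfiniteVolumeGibbs H R z β P := by
  exact ⟨fun φ hφ => GibbsPP.exists_subseq_empiricalField H z β φ, fun P hP =>
    ⟨GibbsPP.isStationaryLaw_of_mapClusterPt H z β hP,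
      GibbsPP.satisfiesDLR_of_mapClusterPt hH hR z β hP⟩⟩
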